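/- For integers $k\ge1$ and $r>1$, let $p_{[1^kr^k]}(n)$ be the number of partitions of $n$ in which multiples of $r$ appear in $2k$ colors and all other parts in $k$ colors (so that $\sum_{n\ge0}p_{[1^kr^k]}(n)q^n=1/(E_1^kE_r^k)$), where for a positive integer $m$ $$E_m:=(q^m;q^m)_\infty=\prod_{j=1}^{\infty}(1-q^{mj}).$$ Then, as identities of formal power series in $q$ with rational coefficients, $$\sum_{n=0}^{\infty}p_{[1^13^1]}(5n+1)q^n=\frac{E_{5}^{5}}{E_{1}^{6}E_{15}}+10q\frac{E_{5}^{10}}{E_{1}^{7}E_{3}^{5}}+q^{2}\frac{E_{15}^{5}}{E_{3}^{6}E_{5}}+45q^{3}\frac{E_{5}^{5}E_{15}^{5}}{E_{1}^{6}E_{3}^{6}}-90q^{5}\frac{E_{15}^{10}}{E_{1}^{5}E_{3}^{7}},$$ $$\sum_{n=0}^{\infty}p_{[1^23^2]}(5n+2)q^n=5\bigg(\frac{E_{5}^{10}}{E_{1}^{12}E_{15}^{2}}+20q\frac{E_{5}^{15}}{E_{1}^{13}E_{3}^{5}E_{15}}+80q^{2}\frac{E_{5}^{20}}{E_{1}^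{14}E_{3}^{10}}+12q^{2}\frac{E_{5}^{4}E_{15}^{4}}{E_{1}^{6}E_{3}^{6}}+306q^{3}\frac{E_{5}^{10}E_{15}^{4}}{E_{1}^{12}E_{3}^{6}}-36q^{3}\frac{E_{5}^{9}E_{15}^{5}}{E_{1}^{7}E_{3}^{11}}+q^{4}\frac{E_{15}^{10}}{E_{3}^{12}E_{5}^{2}}+540q^{4}\frac{E_{5}^{15}E_{15}^{5}}{E_{1}^{13}E_{3}^{11}}+306q^{5}\frac{E_{5}^{4}E_{15}^{10}}{E_{1}^{6}E_{3}^{12}}+324q^{5}\frac{E_{5}^{5}E_{15}^{9}}{E_{1}^{11}E_{3}^{7}}+4745q^{6}\frac{E_{5}^{10}E_{15}^{10}}{E_{1}^{12}E_{3}^{12}}-180q^{7}\frac{E_{15}^{15}}{E_{1}^{5}E_{3}^{13}E_{5}}-4860q^{8}\frac{E_{5}^{5}E_{15}^{15}}{E_{1}^{11}E_{3}^{13}}+6480q^{10}\frac{E_{15}^{20}}{E_{1}^{10}E_{3}^{14}}\bigg),$$ and $$\sum_{n=0}^{\infty}p_{[1^33^3]}(5n+3)q^n=25\frac{E_{5}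^{15}}{E_{1}^{18}E_{15}^{3}}+216q\frac{E_{5}^{35}}{E_{1}^{22}E_{3}^{14}E_{15}^{5}}+234q\frac{E_{5}^{20}}{E_{1}^{19}E_{3}^{5}E_{15}^{2}}+234q\frac{E_{5}^{19}}{E_{1}^{14}E_{3}^{10}E_{15}}+81q\frac{E_{5}^{3}E_{15}^{3}}{E_{1}^{6}E_{3}^{6}}+2976q^{2}\frac{E_{5}^{25}}{E_{1}^{20}E_{3}^{10}E_{15}}+2049q^{2}\frac{E_{5}^{24}}{E_{1}^{15}E_{3}^{15}}+27q^{2}\frac{E_{5}^{10}E_{15}^{2}}{E_{1}^{17}E_{3}}+3528q^{2}\frac{E_{5}^{9}E_{15}^{3}}{E_{1}^{12}E_{3}^{6}}+13224q^{3}\frac{E_{5}^{30}}{E_{1}^{21}E_{3}^{15}}+38858q^{3}\frac{E_{5}^{15}E_{15}^{3}}{E_{1}^{18}E_{3}^{6}}+6075q^{3}\frac{E_{5}^{14}E_{15}^{4}}{E_{1}^{13}E_{3}^{11}}+134q^{3}\frac{E_{5}^{13}E_{15}^{5}}{E_{1}^{8}E_{3}^{16}}+109101q^{4}\frac{E_{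5}^{20}E_{15}^{4}}{E_{1}^{19}E_{3}^{11}}+22226q^{4}\frac{E_{5}^{19}E_{15}^{5}}{E_{1}^{14}E_{3}^{16}}+3528q^{4}\frac{E_{5}^{3}E_{15}^{9}}{E_{1}^{6}E_{3}^{12}}-3q^{4}\frac{E_{5}^{2}E_{15}^{10}}{E_{1}E_{3}^{17}}+270086q^{5}\frac{E_{5}^{25}E_{15}^{5}}{E_{1}^{20}E_{3}^{16}}+18018q^{5}\frac{E_{5}^{10}E_{15}^{8}}{E_{1}^{17}E_{3}^{7}}+138555q^{5}\frac{E_{5}^{9}E_{15}^{9}}{E_{1}^{12}E_{3}^{12}}-2002q^{5}\frac{E_{5}^{8}E_{15}^{10}}{E_{1}^{7}E_{3}^{17}}+1270766q^{6}\frac{E_{5}^{15}E_{15}^{9}}{E_{1}^{18}E_{3}^{12}}-55171q^{6}\frac{E_{5}^{14}E_{15}^{10}}{E_{1}^{13}E_{3}^{17}}+25q^{6}\frac{E_{15}^{15}}{E_{3}^{18}E_{5}^{3}}+441524q^{7}\frac{E_{5}^{20}E_{15}^{10}}{E_{1}^{19}E_{3}^{17}}+10854q^{7}\frac{E_{5}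^{5}E_{15}^{13}}{E_{1}^{16}E_{3}^{8}}-54675q^{7}\frac{E_{5}^{4}E_{15}^{14}}{E_{1}^{11}E_{3}^{13}}+38858q^{7}\frac{E_{5}^{3}E_{15}^{15}}{E_{1}^{6}E_{3}^{18}}+1270766q^{8}\frac{E_{5}^{9}E_{15}^{15}}{E_{1}^{12}E_{3}^{18}}+496539q^{8}\frac{E_{5}^{10}E_{15}^{14}}{E_{1}^{17}E_{3}^{13}}+12104417q^{9}\frac{E_{5}^{15}E_{15}^{15}}{E_{1}^{18}E_{3}^{18}}-2106q^{9}\frac{E_{15}^{20}}{E_{1}^{5}E_{3}^{19}E_{5}^{2}}+18954q^{9}\frac{E_{15}^{19}}{E_{1}^{10}E_{3}^{14}E_{5}}+1800306q^{10}\frac{E_{5}^{5}E_{15}^{19}}{E_{1}^{16}E_{3}^{14}}-981909q^{10}\frac{E_{5}^{4}E_{15}^{20}}{E_{1}^{11}E_{3}^{19}}-3973716q^{11}\frac{E_{5}^{10}E_{15}^{20}}{E_{1}^{17}E_{3}^{19}}+241056q^{12}\frac{E_{15}^{25}}{E_{1}^{10}E_{3}^{20}E_{5}}-1493721q^{12}\frac{E_{15}^{24}}{E_{1}^{15}E_{3}^{15}}+21876966q^{13}\frac{E_{5}^{5}E_{15}^{25}}{E_{1}^{16}E_{3}^{20}}-9640296q^{15}\frac{E_{15}^{30}}{E_{1}^{15}E_{3}^{21}}+1417176q^{17}\frac{E_{15}^{35}}{E_{1}^{14}E_{3}^{22}E_{5}^{5}}.$$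 -/

import Mathlib

/-- The number of colors available to a part `m` in the partitions counted by `p_{[1^k r^k]}`:
every part comes in `k` colors, and a multiple of `r` comes in `k` further colors. -/
def numColors (k r m : ℕ) : ℕ :=
  k + if r ∣ m then k else 0

/-- A colored partition of `n`: a multiset of pairs (part, color of this part), in which the parts
are positive integers with sum `n`, and a part `m` has one of `numColors k r m` colors. -/
@[ext]
structure ColoredPartition (k r n : ℕ) where
  /-- the colored parts, with multiplicity -/
  parts : Multiset (Σ m : ℕ, Fin (numColors k r m))
  /-- the parts are positive -/
  parts_pos : ∀ x ∈ parts, 0 < x.1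
  /-- the parts sum to `n` -/
  parts_sum : (parts.map fun x => x.1).sum = n

/-- There are only finitely many colored partitions of `n`. -/
instance (k r n : ℕ) : Finite (ColoredPartition k r n) := by
  classical
  let A : Finset (Σ m : ℕ, Fin (numColors k r m)) :=
    (Finset.range (n + 1)).sigma fun _ => Finset.univ
  have hfin : (Set.Iic (n • A.val)).Finite := Set.finite_Iic _
  have hmem : ∀ p : ColoredPartition k r n, p.parts ∈ Set.Iic (n • A.val) := by
    intro p
    have hcard : p.parts.card ≤ n := by
      have h := Multiset.card_nsmul_le_sum (s := p.parts.map fun x => x.1) (a := 1) (by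
        intro y hy
        obtain ⟨x, hx, rfl⟩ := Multiset.mem_map.1 hy
        exact p.parts_pos x hx)
      rw [p.parts_sum] at h
      simpa using h
    refine Multiset.le_iff_count.2 fun a => ?_
    by_cases ha : a ∈ p.parts
    · have hle : a.1 ≤ n := by
        have h := Multiset.le_sum_of_mem (Multiset.mem_map_of_mem (fun x => x.1) ha)
        rwa [p.parts_sum] at h
      have haA : a ∈ A.val := by
        change a ∈ A
        simp only [A, Finset.mem_sigma, Finset.mem_range, Finset.mem_univ, and_true]
        omega
      have h1 : 1 ≤ Multiset.count a A.val := Multiset.one_le_count_iff_mem.2 haA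
      rw [Multiset.count_nsmul]
      exact ((Multiset.count_le_card a p.parts).trans hcard).trans (Nat.le_mul_of_pos_right n h1)
    · simp [Multiset.count_eq_zero_of_notMem ha]
  have : Finite (Set.Iic (n • A.val)) := hfin.to_subtype
  exact Finite.of_injective (fun p => (⟨p.parts, hmem p⟩ : Set.Iic (n • A.val)))
    fun p p' h => ColoredPartition.ext (congrArg Subtype.val h)

/-- `p_{[1^k r^k]}(n)`: the number of partitions of `n` in which multiples of `r` appear in `2 k`
colors and the other parts in `k` colors. -/
noncomputable def coloredPartitionCount (k r n : ℕ) : ℕ :=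
  Nat.card (ColoredPartition k r n)

open scoped PowerSeries.WithPiTopology in
/-- `E_n = (q^n; q^n)_∞ = ∏_{j ≥ 0} (1 - q^(n (j + 1)))`, for `n ≥ 1`, as a formal power series
in the indeterminate `q`, with rational coefficients. -/
noncomputable def E (n : ℕ) : PowerSeries ℚ :=
  ∏' j : ℕ, (1 - (PowerSeries.X : PowerSeries ℚ) ^ (n * (j + 1)))

/-- The generating function `∑_{n ≥ 0} p_{[1^k 3^k]}(5 n + s) q^n`. -/
noncomputable def coloredSection (k s : ℕ) : PowerSeries ℚ :=
  PowerSeries.mk fun n => (coloredPartitionCount k 3 (5 * n + s) : ℚ)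

/-- The indeterminate `q`. -/
noncomputable abbrev q : PowerSeries ℚ := PowerSeries.X

/-- The quotient `a / b` of power series; here `b` has constant term `1`, so that `b⁻¹` is the
inverse of `b`. -/
noncomputable abbrev frac (a b : PowerSeries ℚ) : PowerSeries ℚ := a * b⁻¹

/-!
The proof is an explicit `5`-dissection of `1 / (E 1 ^ k * E 3 ^ k)`, followed by a computation in
the function field of a curve of genus one.

By the pentagonal number theorem, `E 1 = a - q e - q ^ 2 b`, where `a`, `e` and `b` are the series
`dissectA`, `E 5` and `dissectB` in `q ^ 5` (`E_one_eq_dissection`). The Jacobi triple product gives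
`a b = e ^ 2` (`dissectA_mul_dissectB`), and the product of the conjugates of `E 1` under
`q ↦ ζ q`, `ζ ^ 5 = 1`, gives `e (a ^ 5 - 11 q e ^ 5 - q ^ 2 b ^ 5) = E 1 ^ 6` before the
substitution of `q ^ 5` (`E_five_mul_quintic`). Since `a ^ 2 - a u - u ^ 2` divides
`a ^ 10 - 11 a ^ 5 u ^ 5 - u ^ 10`, the reciprocal of `E 1` is a polynomial in `q`, `a` and `e`
times a series in `q ^ 5` (`E_one_mul_cofactorForm`); for `E 3`, replace `q` by `q ^ 3`. The
generating function of the colored partitions is `1 / (E 1 ^ k * E 3 ^ k)`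
(`mk_coloredPartitionCount_mul`), so its section along `5 n + k` is a known polynomial in
`F = a / E 5` and `G = F(q ^ 3)`, up to eta quotients (`coloredSection_eq_of_dissection`).

The terms of this polynomial are monomials in `x = F ^ 2 G / q` and `y = G ^ 2 / (F q)`. The
functions `F` and `G` are quotients of theta series modulo `15`, and two instances of Weierstrass'
three-term relation (`thetaSeries_three_term`) yield `x - 1 / x = y - 1 / y + 3`, together with
`E 5 ^ 5 E 3 / (q ^ 2 E 1 E 15 ^ 5) = (x y + 1) ^ 2 / (x y)` (`curve_of_theta_relations`). The
quintic relation expresses `E 1 ^ 6 / (q E 5 ^ 6)` and `E 3 ^ 6 / (q ^ 3 E 15 ^ 6)` through `x` and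
`y`, too (`exists_point_on_curve`). After division by `(E 5 ^ 5 E 15 ^ 5 / (E 1 ^ 6 E 3 ^ 6)) ^ k`,
all the eta quotients in the theorem are monomials in these three functions, and each of the
identities becomes one between polynomials in `x` and `y`, modulo the equation of the curve
(`coloredSection_one_eq`, `coloredSection_two_eq`, `coloredSection_three_eq`).
-/

section

open PowerSeries Filter Topology
open scoped PowerSeries.WithPiTopology

/-! ### Infinite products and sums of monomials -/

section Convergence

variable {K : Type*} [Field K] [TopologicalSpace K]

theorem multipliable_one_sub_X_pow_linear {m x : ℕ} (hm : 0 < m) (hx : 0 < x) (c : ℕ → K) :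
    Multipliable fun j : ℕ => (1 : K⟦X⟧) - C (c j) * X ^ (m * j + x) := by
  simp_rw [sub_eq_add_neg]
  apply PowerSeries.WithPiTopology.multipliable_one_add_of_tendsto_order_atTop_nhds_top
  refine ENat.tendsto_nhds_top_iff_natCast_lt.mpr fun n =>
    eventually_atTop.mpr ⟨n, fun j hj => ?_⟩
  rw [order_neg]
  have h1 : (X : K⟦X⟧) ^ (m * j + x) ∣ C (c j) * X ^ (m * j + x) := dvd_mul_left _ _
  refine lt_of_lt_of_le ?_ (PowerSeries.le_order _ (m * j + x : ℕ) ?_)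
  · have : n < m * j + x := by nlinarith
    exact_mod_cast this
  · intro i hi
    exact X_pow_dvd_iff.1 h1 i (by exact_mod_cast hi)

theorem summable_mul_X_pow {ι : Type*} {e : ι → ℕ} (he : ∀ n, {i | e i ≤ n}.Finite)
    (c : ι → K⟦X⟧) : Summable fun i => c i * X ^ e i := by
  rw [PowerSeries.WithPiTopology.summable_iff_summable_coeff]
  intro d
  refine summable_of_hasFiniteSupport ((he d).subset fun i hi => ?_)
  by_contra h
  apply hi
  simp only [Set.mem_ofPred_eq, not_le] at h
  simp only [coeff_mul_X_pow', if_neg (not_le.2 h)]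

/-- The product of two theta-like series as a series over pairs of indices. -/
theorem tsum_X_pow_mul_tsum_X_pow [IsTopologicalRing K] [T2Space K] {ι κ : Type*} {e : ι → ℕ}
    {f : κ → ℕ} (he : ∀ n, {i | e i ≤ n}.Finite) (hf : ∀ n, {i | f i ≤ n}.Finite)
    (c : ι → K⟦X⟧) (d : κ → K⟦X⟧) :
    (∑' i, c i * X ^ e i) * ∑' j, d j * X ^ f j =
      ∑' p : ι × κ, c p.1 * d p.2 * X ^ (e p.1 + f p.2) := by
  rw [(summable_mul_X_pow he c).tsum_mul_tsum (summable_mul_X_pow hf d)]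
  · exact tsum_congr fun p => by ring
  · have h : ∀ n, {p : ι × κ | e p.1 + f p.2 ≤ n}.Finite := fun n =>
      ((he n).prod (hf n)).subset fun p hp => by
        simp only [Set.mem_ofPred_eq] at hp
        simp only [Set.mem_prod, Set.mem_ofPred_eq]
        omega
    refine (summable_mul_X_pow h fun p => c p.1 * d p.2).congr fun p => by ring

end Convergence

/-- An infinite product of factors congruent to `1` modulo `X ^ D` is itself congruent to `1`. -/
theorem X_pow_dvd_tprod_sub_one {K : Type*} [Field K] [TopologicalSpace K] [T2Space K] {D : ℕ}
    {f : ℕ → K⟦X⟧} (hf : Multipliable f) (h : ∀ j, X ^ D ∣ f j - 1) :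
    X ^ D ∣ (∏' j, f j) - 1 := by
  rw [X_pow_dvd_iff]
  intro i hi
  have hs : ∀ s : Finset ℕ, (X : K⟦X⟧) ^ D ∣ (∏ j ∈ s, f j) - 1 := by
    intro s
    induction s using Finset.cons_induction with
    | empty => simp
    | cons a s ha ih =>
      rw [Finset.prod_cons]
      have : f a * ∏ j ∈ s, f j - 1 = (f a - 1) * ∏ j ∈ s, f j + ((∏ j ∈ s, f j) - 1) := by ring
      rw [this]
      exact dvd_add (Dvd.dvd.mul_right (h a) _) ih
  have h1 := ((PowerSeries.WithPiTopology.continuous_coeff K i).tendsto _).comp hf.hasProd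
  have h2 : (coeff i ∘ fun s : Finset ℕ => ∏ j ∈ s, f j) = fun _ => coeff i (1 : K⟦X⟧) := by
    funext s
    have := X_pow_dvd_iff.1 (hs s) i hi
    rw [map_sub, sub_eq_zero] at this
    exact this
  rw [h2] at h1
  have h3 := tendsto_nhds_unique h1 tendsto_const_nhds
  rw [map_sub, h3, sub_self]

/-- The product `(q^x; q^m)_∞ = ∏_{j ≥ 0} (1 - q^(m j + x))`. -/
noncomputable def progProd (m x : ℕ) : ℚ⟦X⟧ := ∏' j : ℕ, (1 - X ^ (m * j + x))

theorem multipliable_progProd {m x : ℕ} (hm : 0 < m) (hx : 0 < x) :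
    Multipliable fun j : ℕ => (1 : ℚ⟦X⟧) - X ^ (m * j + x) := by
  simpa using multipliable_one_sub_X_pow_linear hm hx fun _ => (1 : ℚ)

theorem E_eq_progProd (n : ℕ) : E n = progProd n n := by
  simp only [E, progProd, mul_add, mul_one]

theorem progProd_eq_prod_mul {m x : ℕ} (hm : 0 < m) (hx : 0 < x) (n : ℕ) :
    progProd m x = (∏ j ∈ Finset.range n, (1 - X ^ (m * j + x))) * progProd m (m * n + x) := by
  have h1 : (fun j : ℕ => (1 : ℚ⟦X⟧) - X ^ (m * (j + n) + x)) =
      fun j => 1 - X ^ (m * j + (m * n + x)) := by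
    funext j
    congr 2
    ring
  have h2 : Multipliable fun j : ℕ => (1 : ℚ⟦X⟧) - X ^ (m * (j + n) + x) := by
    rw [h1]
    exact multipliable_progProd hm (by omega)
  rw [progProd, ← h2.prod_mul_tprod_nat_mul' (f := fun j : ℕ => (1 : ℚ⟦X⟧) - X ^ (m * j + x)), h1,
    progProd]

theorem X_pow_dvd_progProd_sub_one {m x D : ℕ} (hm : 0 < m) (hx : 0 < x) (hD : D ≤ x) :
    (X : ℚ⟦X⟧) ^ D ∣ progProd m x - 1 := by
  refine X_pow_dvd_tprod_sub_one (multipliable_progProd hm hx) fun j => ?_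
  rw [sub_sub_cancel_left, dvd_neg]
  exact pow_dvd_pow _ (by omega)

theorem constantCoeff_progProd {m x : ℕ} (hm : 0 < m) (hx : 0 < x) :
    constantCoeff (progProd m x) = 1 := by
  have := X_pow_dvd_iff.1 (X_pow_dvd_progProd_sub_one hm hx (D := 1) hx) 0 one_pos
  rwa [map_sub, sub_eq_zero, coeff_zero_eq_constantCoeff, map_one] at this

theorem progProd_ne_zero {m x : ℕ} (hm : 0 < m) (hx : 0 < x) : progProd m x ≠ 0 := fun h => by
  simpa [h] using constantCoeff_progProd hm hx

theorem X_pow_dvd_progProd_sub_prod {m x D n : ℕ} (hm : 0 < m) (hx : 0 < x) (hn : D ≤ n) :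
    (X : ℚ⟦X⟧) ^ D ∣ progProd m x - ∏ j ∈ Finset.range n, (1 - X ^ (m * j + x)) := by
  rw [progProd_eq_prod_mul hm hx n, ← mul_sub_one]
  exact Dvd.dvd.mul_left (X_pow_dvd_progProd_sub_one hm (by omega) (by nlinarith)) _

/-- Splitting the factors of a product along an arithmetic progression according to the residue
class of their index modulo `r`. -/
theorem progProd_eq_prod_progProd {m x : ℕ} (hm : 0 < m) (hx : 0 < x) (r : ℕ) [NeZero r] :
    progProd m x = ∏ i : Fin r, progProd (r * m) (x + i * m) := by
  have hr : 0 < r := Nat.pos_of_ne_zero (NeZero.ne r)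
  have h := multipliable_progProd hm hx
  have h1 : HasProd (fun p : Fin r × ℕ => (1 : ℚ⟦X⟧) - X ^ (r * m * p.2 + (x + p.1 * m)))
      (progProd m x) := by
    have h2 := h.hasProd
    change HasProd _ (progProd m x) at h2
    rw [← ((Nat.divModEquiv r).symm).hasProd_iff, ← (Equiv.prodComm (Fin r) ℕ).hasProd_iff] at h2
    convert h2 using 1
    funext p
    simp only [Function.comp, Equiv.prodComm_apply, Prod.swap, Nat.divModEquiv_symm_apply]
    congr 2
    ring
  have h3 := h1.prod_fiberwise fun i =>
    (multipliable_progProd (Nat.mul_pos hr hm) (x := x + i * m) (by omega)).hasProd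
  exact h3.unique (hasProd_fintype _)

/-! ### The Jacobi triple product -/

/-- The Gaussian binomial coefficient `[k + l choose k]` in the variable `Q`, indexed by the two
lower parameters `k` and `l` so that no subtraction occurs. -/
def gaussBinom {R : Type*} [CommRing R] (Q : R) : ℕ → ℕ → R
  | 0, _ => 1
  | _ + 1, 0 => 1
  | k + 1, l + 1 => gaussBinom Q k (l + 1) + Q ^ (k + 1) * gaussBinom Q (k + 1) l

section GaussBinom

variable {R : Type*} [CommRing R] (Q : R)

theorem gaussBinom_zero_left (l : ℕ) : gaussBinom Q 0 l = 1 := by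
  cases l <;> simp [gaussBinom]

theorem gaussBinom_zero_right (k : ℕ) : gaussBinom Q k 0 = 1 := by
  cases k <;> simp [gaussBinom]

/-- The quotient formula for the Gaussian binomial coefficients, with denominators cleared. -/
theorem gaussBinom_mul_prod_mul_prod (k l : ℕ) :
    gaussBinom Q k l * (∏ j ∈ Finset.range k, (1 - Q ^ (j + 1))) *
      ∏ j ∈ Finset.range l, (1 - Q ^ (j + 1)) = ∏ j ∈ Finset.range (k + l), (1 - Q ^ (j + 1)) := by
  induction k generalizing l with
  | zero => simp [gaussBinom_zero_left]
  | succ k ihk =>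
    induction l with
    | zero => simp [gaussBinom_zero_right]
    | succ l ihl =>
      have h1 := ihk (l + 1)
      rw [show k + 1 + (l + 1) = k + (l + 1) + 1 by ring,
        Finset.prod_range_succ _ (k + (l + 1)), ← h1]
      rw [show k + 1 + l = k + (l + 1) by ring, ← h1] at ihl
      rw [gaussBinom, Finset.prod_range_succ _ k, Finset.prod_range_succ _ l]
      rw [Finset.prod_range_succ _ k, Finset.prod_range_succ _ l] at ihl
      linear_combination Q ^ (k + 1) * (1 - Q ^ (l + 1)) * ihl

/-- The finite `q`-binomial theorem. -/
theorem prod_add_mul_pow_eq_sum_gaussBinom (n : ℕ) (y z : R) :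
    ∏ j ∈ Finset.range n, (y + z * Q ^ j) =
      ∑ p ∈ Finset.HasAntidiagonal.antidiagonal n,
        gaussBinom Q p.1 p.2 * Q ^ p.1.choose 2 * z ^ p.1 * y ^ p.2 := by
  induction n generalizing z with
  | zero => simp [gaussBinom_zero_left]
  | succ n ih =>
    let u : ℕ × ℕ → R := fun p => match p.2 with
      | 0 => 0
      | l + 1 => gaussBinom Q p.1 l * Q ^ p.1.choose 2 * (z * Q) ^ p.1 * y ^ (l + 1)
    let v : ℕ × ℕ → R := fun p => match p.1 with
      | 0 => 0
      | k + 1 => gaussBinom Q k p.2 * Q ^ k.choose 2 * (z * Q) ^ k * z * y ^ p.2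
    have huv : ∀ p ∈ Finset.HasAntidiagonal.antidiagonal (n + 1),
        gaussBinom Q p.1 p.2 * Q ^ p.1.choose 2 * z ^ p.1 * y ^ p.2 = u p + v p := by
      rintro ⟨k, l⟩ hp
      rw [Finset.HasAntidiagonal.mem_antidiagonal] at hp
      rcases k with _ | k <;> rcases l with _ | l
      · simp at hp
      · simp [u, v, gaussBinom_zero_left]
      · simp only [u, v, gaussBinom_zero_right, Nat.choose_succ_succ' k 1, Nat.choose_one_right]
        ring
      · simp only [u, v, gaussBinom, Nat.choose_succ_succ' k 1, Nat.choose_one_right]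
        ring
    rw [Finset.sum_congr rfl huv, Finset.sum_add_distrib, Finset.Nat.sum_antidiagonal_succ',
      Finset.Nat.sum_antidiagonal_succ, Finset.prod_range_succ']
    have h1 : ∀ j, y + z * Q ^ (j + 1) = y + z * Q * Q ^ j := fun j => by ring
    simp only [h1, ih, u, v, zero_add, pow_zero, mul_one]
    rw [mul_add, Finset.sum_mul, Finset.sum_mul]
    congr 1 <;> exact Finset.sum_congr rfl fun p _ => by ring

end GaussBinom

/-- The exponent `m k (k - 1) / 2 + x k` of the theta series `thetaSeries m x`; it is nonnegative
for `0 ≤ x ≤ m`. -/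
def thetaExp (m x : ℕ) (k : ℤ) : ℕ := ((m * (k * (k - 1)) + 2 * x * k) / 2).toNat

theorem two_mul_thetaExp {m x : ℕ} (hxm : x ≤ m) (k : ℤ) :
    2 * (thetaExp m x k : ℤ) = m * (k * (k - 1)) + 2 * x * k := by
  have h1 : (2 : ℤ) ∣ m * (k * (k - 1)) + 2 * x * k := by
    refine dvd_add (Dvd.dvd.mul_left ?_ _) ⟨x * k, by ring⟩
    simpa using (Int.even_mul_pred_self k).two_dvd
  have h2 : (0 : ℤ) ≤ m * (k * (k - 1)) + 2 * x * k := by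
    have h4 : (x : ℤ) ≤ m := by exact_mod_cast hxm
    rcases le_or_gt 1 k with h | h
    · have : 0 ≤ k * (k - 1) := by nlinarith
      positivity
    · have h3 : 0 ≤ -k := by linarith
      have : 0 ≤ (-k) * (m * (1 - k) - 2 * x) ∨ k = 0 := by
        rcases eq_or_ne k 0 with h0 | h0
        · exact Or.inr h0
        · left
          have : k ≤ -1 := by omega
          have : 2 * (m : ℤ) ≤ m * (1 - k) := by nlinarith
          exact mul_nonneg h3 (by linarith)
      rcases this with h5 | h5
      · linarith
      · simp [h5]
  rw [thetaExp, Int.toNat_of_nonneg (Int.ediv_nonneg h2 (by norm_num)), Int.mul_ediv_cancel' h1]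

theorem natAbs_le_thetaExp {m x : ℕ} (hx : 0 < x) (hxm : x < m) (k : ℤ) :
    k.natAbs ≤ thetaExp m x k := by
  have h := two_mul_thetaExp hxm.le k
  have h1 : (1 : ℤ) ≤ x := by exact_mod_cast hx
  have h2 : (x : ℤ) + 1 ≤ m := by exact_mod_cast hxm
  have h3 : |k| ≤ (thetaExp m x k : ℤ) := by
    rcases le_or_gt 0 k with h0 | h0
    · rw [abs_of_nonneg h0]
      have : 0 ≤ k * (k - 1) := by
        rcases eq_or_lt_of_le h0 with h5 | h5
        · simp [← h5]
        · exact mul_nonneg h0 (by linarith [Int.add_one_le_iff.2 h5])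
      nlinarith [mul_nonneg (by linarith : (0 : ℤ) ≤ m) this]
    · rw [abs_of_neg h0]
      have h4 : k ≤ -1 := by omega
      have h5 : 0 ≤ (-k) * (-1 - k) := mul_nonneg (by linarith) (by linarith)
      nlinarith [mul_nonneg (by linarith : (0 : ℤ) ≤ m) h5]
  rw [← Int.natCast_natAbs] at h3
  exact_mod_cast h3

theorem finite_thetaExp_le {m x : ℕ} (hx : 0 < x) (hxm : x < m) (n : ℕ) :
    {k | thetaExp m x k ≤ n}.Finite := by
  refine (Set.finite_Icc (-n : ℤ) n).subset fun k hk => ?_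
  have h1 := natAbs_le_thetaExp hx hxm k
  simp only [Set.mem_ofPred_eq] at hk
  simp only [Set.mem_Icc]
  omega

/-- The theta series `∑_{k ∈ ℤ} (-1)^k q^(m k (k - 1) / 2 + x k)`. -/
noncomputable def thetaSeries (m x : ℕ) : ℚ⟦X⟧ :=
  ∑' k : ℤ, (Int.negOnePow k : ℚ⟦X⟧) * X ^ thetaExp m x k

/-- The finite form of the Jacobi triple product. -/
theorem prod_mul_prod_eq_sum_gaussBinom {m x : ℕ} (hxm : x ≤ m) (N : ℕ) :
    (∏ j ∈ Finset.range N, (1 - (X : ℚ⟦X⟧) ^ (m * j + x))) *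
      ∏ j ∈ Finset.range N, (1 - X ^ (m * j + (m - x))) =
      ∑ p ∈ Finset.HasAntidiagonal.antidiagonal (2 * N), gaussBinom (X ^ m) p.1 p.2 *
        ((Int.negOnePow ((p.1 : ℤ) - N) : ℚ⟦X⟧) * X ^ thetaExp m x ((p.1 : ℤ) - N)) := by
  have h := prod_add_mul_pow_eq_sum_gaussBinom (X ^ m : ℚ⟦X⟧) (2 * N) (X ^ (m * N)) (-X ^ x)
  have hsum : ∑ j ∈ Finset.range N, (x + m * j) = x * N + m * N.choose 2 := by
    rw [Finset.sum_add_distrib, ← Finset.mul_sum, Finset.sum_range_id, Nat.choose_two_right]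
    simp [mul_comm]
  have h1 : ∏ j ∈ Finset.range (2 * N), ((X : ℚ⟦X⟧) ^ (m * N) + -X ^ x * (X ^ m) ^ j) =
      X ^ (m * N * N + (x * N + m * N.choose 2)) * (-1) ^ N *
      ((∏ j ∈ Finset.range N, (1 - (X : ℚ⟦X⟧) ^ (m * j + x))) *
        ∏ j ∈ Finset.range N, (1 - X ^ (m * j + (m - x)))) := by
    rw [two_mul, Finset.prod_range_add, ← hsum, pow_add, pow_mul X (m * N) N,
      ← Finset.prod_pow_eq_pow_sum]
    have h2 : ∏ j ∈ Finset.range N, ((X : ℚ⟦X⟧) ^ (m * N) + -X ^ x * (X ^ m) ^ (N + j)) =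
        (X ^ (m * N)) ^ N * ∏ j ∈ Finset.range N, (1 - (X : ℚ⟦X⟧) ^ (m * j + x)) := by
      have h3 : (X ^ (m * N) : ℚ⟦X⟧) ^ N = ∏ j ∈ Finset.range N, X ^ (m * N) := by simp
      rw [h3, ← Finset.prod_mul_distrib]
      exact Finset.prod_congr rfl fun j _ => by ring
    have h4 : ∏ j ∈ Finset.range N, ((X : ℚ⟦X⟧) ^ (m * N) + -X ^ x * (X ^ m) ^ j) =
        (∏ j ∈ Finset.range N, X ^ (x + m * j)) * (-1) ^ N *
          ∏ j ∈ Finset.range N, (1 - X ^ (m * j + (m - x))) := by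
      have h3 : (-1 : ℚ⟦X⟧) ^ N = ∏ j ∈ Finset.range N, (-1) := by simp
      rw [h3, ← Finset.prod_mul_distrib,
        ← Finset.prod_range_reflect fun j => 1 - (X : ℚ⟦X⟧) ^ (m * j + (m - x)),
        ← Finset.prod_mul_distrib]
      refine Finset.prod_congr rfl fun j hj => ?_
      have hj' := Finset.mem_range.1 hj
      have h5 : m * N = x + m * j + (m * (N - 1 - j) + (m - x)) := by
        obtain ⟨d, rfl⟩ : ∃ d, N = j + 1 + d := ⟨N - (j + 1), by omega⟩
        obtain ⟨e, rfl⟩ : ∃ e, m = x + e := ⟨m - x, by omega⟩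
        rw [show j + 1 + d - 1 - j = d by omega, show x + e - x = e by omega]
        ring
      conv_lhs => rw [h5, pow_add X (x + m * j)]
      ring
    rw [h2, h4]
    ring
  have hne : (X : ℚ⟦X⟧) ^ (m * N * N + (x * N + m * N.choose 2)) * (-1) ^ N ≠ 0 :=
    mul_ne_zero (pow_ne_zero _ X_ne_zero) (pow_ne_zero _ (by norm_num))
  refine mul_left_cancel₀ hne ?_
  rw [← h1, h, Finset.mul_sum]
  refine Finset.sum_congr rfl fun p hp => ?_
  rw [Finset.HasAntidiagonal.mem_antidiagonal] at hp
  have hsgn : (Int.negOnePow ((p.1 : ℤ) - N) : ℚ⟦X⟧) = (-1) ^ p.1 * (-1) ^ N := by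
    rw [Int.negOnePow_sub, Int.negOnePow_def, Int.negOnePow_def, zpow_natCast, zpow_natCast]
    push_cast
    simp
  have hexp : m * p.1.choose 2 + x * p.1 + m * N * p.2 =
      m * N * N + (x * N + m * N.choose 2) + thetaExp m x ((p.1 : ℤ) - N) := by
    have e1 := two_mul_thetaExp hxm ((p.1 : ℤ) - N)
    have e2 : ∀ a : ℕ, 2 * ((a.choose 2 : ℕ) : ℤ) = a * (a - 1) := by
      intro a
      rw [← Nat.cast_ofNat, ← Nat.cast_mul, Nat.choose_two_right,
        Nat.mul_div_cancel' (Nat.even_mul_pred_self a).two_dvd]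
      rcases a with _ | a <;> simp
    have e3 : (p.2 : ℤ) = 2 * N - p.1 := by omega
    zify
    have e4 := e2 p.1
    have e5 := e2 N
    refine mul_left_cancel₀ (two_ne_zero (α := ℤ)) ?_
    rw [e3]
    linear_combination (m : ℤ) * e4 - m * e5 - e1
  rw [hsgn, show (-X ^ x : ℚ⟦X⟧) ^ p.1 = (-1) ^ p.1 * X ^ (x * p.1) by
    rw [neg_pow, ← pow_mul]]
  have hone : ((-1 : ℚ⟦X⟧) ^ N) * (-1) ^ N = 1 := by
    rw [← mul_pow]; simp
  calc gaussBinom (X ^ m : ℚ⟦X⟧) p.1 p.2 * (X ^ m) ^ p.1.choose 2 * ((-1) ^ p.1 * X ^ (x * p.1)) *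
        (X ^ (m * N)) ^ p.2
      = gaussBinom (X ^ m : ℚ⟦X⟧) p.1 p.2 * (-1) ^ p.1 *
        X ^ (m * p.1.choose 2 + x * p.1 + m * N * p.2) := by ring
    _ = gaussBinom (X ^ m : ℚ⟦X⟧) p.1 p.2 * (-1) ^ p.1 * ((-1) ^ N * (-1) ^ N) *
        X ^ (m * p.1.choose 2 + x * p.1 + m * N * p.2) := by rw [hone, mul_one]
    _ = _ := by rw [hexp]; ring

theorem X_pow_dvd_tsum_sub_sum {ι : Type*} {e : ι → ℕ} (he : ∀ n, {i | e i ≤ n}.Finite)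
    (c : ι → ℚ⟦X⟧) {D : ℕ} {s : Finset ι} (hs : ∀ i ∉ s, D ≤ e i) :
    X ^ D ∣ (∑' i, c i * X ^ e i) - ∑ i ∈ s, c i * X ^ e i := by
  rw [X_pow_dvd_iff]
  intro d hd
  have h := (PowerSeries.WithPiTopology.hasSum_iff_hasSum_coeff ℚ).1
    (summable_mul_X_pow he c).hasSum d
  rw [map_sub, map_sum, ← h.tsum_eq, tsum_eq_sum, sub_self]
  intro i hi
  rw [coeff_mul_X_pow', if_neg]
  have := hs i hi
  omega

theorem eq_of_forall_X_pow_dvd_sub {f g : ℚ⟦X⟧} (h : ∀ D : ℕ, X ^ D ∣ f - g) : f = g := by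
  ext n
  have := X_pow_dvd_iff.1 (h (n + 1)) n n.lt_succ_self
  rwa [map_sub, sub_eq_zero] at this

/-- A central Gaussian binomial coefficient tends to `1 / (Q; Q)_∞`. -/
theorem X_pow_dvd_prod_mul_gaussBinom_sub_one {m D k l : ℕ} (hm : 0 < m) (hk : D ≤ k)
    (hl : D ≤ l) :
    (X : ℚ⟦X⟧) ^ D ∣ progProd m m * gaussBinom (X ^ m) k l - 1 := by
  have hp : ∀ n, ∏ j ∈ Finset.range n, (1 - (X ^ m : ℚ⟦X⟧) ^ (j + 1)) =
      ∏ j ∈ Finset.range n, (1 - X ^ (m * j + m)) := fun n =>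
    Finset.prod_congr rfl fun j _ => by rw [← pow_mul, mul_add, mul_one]
  have h := gaussBinom_mul_prod_mul_prod (X ^ m : ℚ⟦X⟧) k l
  simp only [hp] at h
  have h1 := X_pow_dvd_progProd_sub_prod hm hm hk
  have h2 := X_pow_dvd_progProd_sub_prod hm hm hl
  have h3 := X_pow_dvd_progProd_sub_prod hm hm (show D ≤ k + l by omega)
  set A := progProd m m
  set a := ∏ j ∈ Finset.range k, (1 - (X : ℚ⟦X⟧) ^ (m * j + m))
  set b := ∏ j ∈ Finset.range l, (1 - (X : ℚ⟦X⟧) ^ (m * j + m))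
  set g := gaussBinom (X ^ m : ℚ⟦X⟧) k l
  have h4 : X ^ D ∣ (A * g - 1) * A := by
    have : (A * g - 1) * A = g * (A - a) * A + g * a * (A - b) -
        (A - ∏ j ∈ Finset.range (k + l), (1 - X ^ (m * j + m))) := by
      rw [← h]
      ring
    rw [this]
    exact dvd_sub (dvd_add (Dvd.dvd.mul_right (Dvd.dvd.mul_left h1 _) _)
      (Dvd.dvd.mul_left h2 _)) h3
  have hu : IsUnit A := by
    rw [PowerSeries.isUnit_iff_constantCoeff, constantCoeff_progProd hm hm]
    exact isUnit_one
  exact (hu.dvd_mul_right).1 h4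

/-- The **Jacobi triple product** identity. -/
theorem progProd_mul_progProd_mul_progProd {m x : ℕ} (hx : 0 < x) (hxm : x < m) :
    progProd m m * progProd m x * progProd m (m - x) = thetaSeries m x := by
  have hm : 0 < m := by omega
  refine eq_of_forall_X_pow_dvd_sub fun D => ?_
  have h1 := X_pow_dvd_progProd_sub_prod hm hx (show D ≤ 2 * D by omega)
  have h2 := X_pow_dvd_progProd_sub_prod hm (show 0 < m - x by omega) (show D ≤ 2 * D by omega)
  have h3 := prod_mul_prod_eq_sum_gaussBinom hxm.le (2 * D)
  set a := ∏ j ∈ Finset.range (2 * D), (1 - (X : ℚ⟦X⟧) ^ (m * j + x))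
  set b := ∏ j ∈ Finset.range (2 * D), (1 - (X : ℚ⟦X⟧) ^ (m * j + (m - x)))
  let φ : ℕ × ℕ → ℤ := fun p => (p.1 : ℤ) - (2 * D : ℕ)
  have hφ : Set.InjOn φ (Finset.HasAntidiagonal.antidiagonal (2 * (2 * D)) : Set (ℕ × ℕ)) := by
    rintro ⟨i, j⟩ h ⟨i', j'⟩ h' he
    simp only [Finset.mem_coe, Finset.HasAntidiagonal.mem_antidiagonal, φ] at h h' he
    ext <;> simp only <;> omega
  have h4 : X ^ D ∣ thetaSeries m x -
      ∑ k ∈ (Finset.HasAntidiagonal.antidiagonal (2 * (2 * D))).image φ,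
      (Int.negOnePow k : ℚ⟦X⟧) * X ^ thetaExp m x k := by
    refine X_pow_dvd_tsum_sub_sum (finite_thetaExp_le hx hxm) _ fun k hk => ?_
    have h5 := natAbs_le_thetaExp hx hxm k
    by_contra h6
    apply hk
    rw [Finset.mem_image]
    refine ⟨((k + (2 * D : ℕ)).toNat, ((2 * D : ℕ) - k).toNat), ?_, ?_⟩
    · rw [Finset.HasAntidiagonal.mem_antidiagonal]
      omega
    · simp only [φ]
      omega
  rw [Finset.sum_image hφ] at h4
  have h5 : X ^ D ∣ progProd m m * (a * b) -
      ∑ p ∈ Finset.HasAntidiagonal.antidiagonal (2 * (2 * D)),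
      (Int.negOnePow (φ p) : ℚ⟦X⟧) * X ^ thetaExp m x (φ p) := by
    rw [h3, Finset.mul_sum, ← Finset.sum_sub_distrib]
    refine Finset.dvd_sum fun p hp => ?_
    rw [Finset.HasAntidiagonal.mem_antidiagonal] at hp
    have h7 : progProd m m * (gaussBinom (X ^ m) p.1 p.2 *
        ((Int.negOnePow ((p.1 : ℤ) - (2 * D : ℕ)) : ℚ⟦X⟧) *
          X ^ thetaExp m x ((p.1 : ℤ) - (2 * D : ℕ)))) -
        (Int.negOnePow (φ p) : ℚ⟦X⟧) * X ^ thetaExp m x (φ p) =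
        (progProd m m * gaussBinom (X ^ m) p.1 p.2 - 1) *
          (Int.negOnePow (φ p) : ℚ⟦X⟧) * X ^ thetaExp m x (φ p) := by
      simp only [φ]
      ring
    rw [h7]
    by_cases h8 : D ≤ thetaExp m x (φ p)
    · exact Dvd.dvd.mul_left (pow_dvd_pow _ h8) _
    · have h9 := natAbs_le_thetaExp hx hxm (φ p)
      simp only [φ] at h8 h9
      exact Dvd.dvd.mul_right (Dvd.dvd.mul_right
        (X_pow_dvd_prod_mul_gaussBinom_sub_one hm (by omega) (by omega)) _) _
  have h6 : progProd m m * progProd m x * progProd m (m - x) - thetaSeries m x =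
      progProd m m * (progProd m x - a) * progProd m (m - x) +
      progProd m m * a * (progProd m (m - x) - b) +
      (progProd m m * (a * b) - ∑ p ∈ Finset.HasAntidiagonal.antidiagonal (2 * (2 * D)),
        (Int.negOnePow (φ p) : ℚ⟦X⟧) * X ^ thetaExp m x (φ p)) -
      (thetaSeries m x - ∑ p ∈ Finset.HasAntidiagonal.antidiagonal (2 * (2 * D)),
        (Int.negOnePow (φ p) : ℚ⟦X⟧) * X ^ thetaExp m x (φ p)) := by ring
  rw [h6]
  exact dvd_sub (dvd_add (dvd_add (Dvd.dvd.mul_right (Dvd.dvd.mul_left h1 _) _)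
    (Dvd.dvd.mul_left h2 _)) h5) h4

/-! ### Weierstrass' three-term relation -/

/-- The exponent `15 i² + 2 a i` of `evenTheta a`. -/
def evenExp (a : ℕ) (i : ℤ) : ℕ := (15 * i ^ 2 + 2 * a * i).toNat

/-- The exponent `(15 i + 2 a) (i + 1)` of `oddTheta a`. -/
def oddExp (a : ℕ) (i : ℤ) : ℕ := ((15 * i + 2 * a) * (i + 1)).toNat

theorem natCast_evenExp {a : ℕ} (ha : a ≤ 7) (i : ℤ) :
    (evenExp a i : ℤ) = 15 * i ^ 2 + 2 * a * i := by
  rw [evenExp, Int.toNat_of_nonneg]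
  have h1 : (a : ℤ) ≤ 7 := by exact_mod_cast ha
  have h2 : (0 : ℤ) ≤ a := by positivity
  rcases lt_trichotomy i 0 with h | h | h
  · have h3 : i ≤ -1 := by omega
    nlinarith
  · simp [h]
  · positivity

theorem natCast_oddExp {a : ℕ} (ha : a ≤ 7) (i : ℤ) :
    (oddExp a i : ℤ) = (15 * i + 2 * a) * (i + 1) := by
  rw [oddExp, Int.toNat_of_nonneg]
  have h1 : (a : ℤ) ≤ 7 := by exact_mod_cast ha
  have h2 : (0 : ℤ) ≤ a := by positivity
  rcases lt_or_ge i 0 with h | h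
  · have h3 : i ≤ -1 := by omega
    exact mul_nonneg_of_nonpos_of_nonpos (by linarith) (by linarith)
  · positivity

theorem natAbs_le_evenExp {a : ℕ} (ha : a ≤ 7) (i : ℤ) : i.natAbs ≤ evenExp a i := by
  zify
  rw [natCast_evenExp ha]
  have h1 : (a : ℤ) ≤ 7 := by exact_mod_cast ha
  have h2 : (0 : ℤ) ≤ a := by positivity
  rcases abs_cases i with h | h
  · rw [h.1]
    nlinarith
  · rw [h.1]
    have h3 : i ≤ -1 := by omega
    nlinarith

theorem natAbs_le_oddExp {a : ℕ} (ha : a ≤ 7) (i : ℤ) : i.natAbs ≤ oddExp a i + 1 := by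
  zify
  rw [natCast_oddExp ha]
  have h1 : (a : ℤ) ≤ 7 := by exact_mod_cast ha
  have h2 : (0 : ℤ) ≤ a := by positivity
  rcases abs_cases i with h | h
  · rw [h.1]
    nlinarith
  · rw [h.1]
    have h3 : i ≤ -1 := by omega
    nlinarith

theorem finite_evenExp_le {a : ℕ} (ha : a ≤ 7) (n : ℕ) : {i | evenExp a i ≤ n}.Finite := by
  refine (Set.finite_Icc (-n : ℤ) n).subset fun k hk => ?_
  have h1 := natAbs_le_evenExp ha k
  simp only [Set.mem_ofPred_eq] at hk
  simp only [Set.mem_Icc]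
  omega

theorem finite_oddExp_le {a : ℕ} (ha : a ≤ 7) (n : ℕ) : {i | oddExp a i ≤ n}.Finite := by
  refine (Set.finite_Icc (-n - 1 : ℤ) (n + 1)).subset fun k hk => ?_
  have h1 := natAbs_le_oddExp ha k
  simp only [Set.mem_ofPred_eq] at hk
  simp only [Set.mem_Icc]
  omega

/-- The theta series `∑_{i ∈ ℤ} q^(15 i² + 2 a i)`. -/
noncomputable def evenTheta (a : ℕ) : ℚ⟦X⟧ := ∑' i : ℤ, 1 * X ^ evenExp a i

/-- The theta series `∑_{i ∈ ℤ} q^((15 i + 2 a) (i + 1))`. -/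
noncomputable def oddTheta (a : ℕ) : ℚ⟦X⟧ := ∑' i : ℤ, 1 * X ^ oddExp a i

/-- The lattice `ℤ²` as the disjoint union of the pairs with even and with odd sum, each
parametrized by half the sum and half the difference. -/
def sumDiff : (ℤ × ℤ) ⊕ (ℤ × ℤ) → ℤ × ℤ :=
  Sum.elim (fun p => (p.1 + p.2 + 1, p.1 - p.2 + 1)) fun p => (p.1 + p.2 + 1, p.1 - p.2)

theorem bijective_sumDiff : Function.Bijective sumDiff := by
  constructor
  · rintro (⟨i, j⟩ | ⟨i, j⟩) (⟨i', j'⟩ | ⟨i', j'⟩) h <;>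
      simp only [sumDiff, Sum.elim_inl, Sum.elim_inr, Prod.mk.injEq, Sum.inl.injEq, Sum.inr.injEq,
        reduceCtorEq] at h ⊢ <;> omega
  · rintro ⟨m, n⟩
    rcases Int.even_or_odd' (m + n) with ⟨k, h | h⟩
    · refine ⟨Sum.inl (k - 1, m - k), ?_⟩
      simp only [sumDiff, Sum.elim_inl, Prod.mk.injEq]
      omega
    · refine ⟨Sum.inr (k, m - k - 1), ?_⟩
      simp only [sumDiff, Sum.elim_inr, Prod.mk.injEq]
      omega

theorem tsum_eq_tsum_add_tsum_sumDiff {e : ℤ × ℤ → ℕ} (he : ∀ n, {p | e p ≤ n}.Finite)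
    {c : ℤ × ℤ → ℚ⟦X⟧} :
    ∑' p, c p * X ^ e p = (∑' p : ℤ × ℤ, c (p.1 + p.2 + 1, p.1 - p.2 + 1) *
        X ^ e (p.1 + p.2 + 1, p.1 - p.2 + 1)) +
      ∑' p : ℤ × ℤ, c (p.1 + p.2 + 1, p.1 - p.2) * X ^ e (p.1 + p.2 + 1, p.1 - p.2) := by
  have hs : ∀ g : ℤ × ℤ → ℤ × ℤ, Function.Injective g → Summable fun p =>
      c (g p) * X ^ e (g p) := fun g hg =>
    summable_mul_X_pow (fun n => Set.Finite.preimage (s := {p | e p ≤ n}) hg.injOn (he n)) _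
  rw [← (Equiv.ofBijective _ bijective_sumDiff).tsum_eq]
  exact Summable.tsum_sum (f := fun p => c (sumDiff p) * X ^ e (sumDiff p))
    (hs _ (bijective_sumDiff.injective.comp Sum.inl_injective))
    (hs _ (bijective_sumDiff.injective.comp Sum.inr_injective))

theorem negOnePow_mul_negOnePow (x y : ℤ) :
    (Int.negOnePow x : ℚ⟦X⟧) * (Int.negOnePow y : ℚ⟦X⟧) =
    (Int.negOnePow (x + y) : ℚ⟦X⟧) := by
  rw [Int.negOnePow_add]
  push_cast
  rfl

/-- A product of two theta series is a two-by-two determinant in theta series of each of the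
two points `a` and `b`. -/
theorem thetaSeries_mul_thetaSeries {a b : ℕ} (hab : b < a) (ha : a ≤ 7) :
    thetaSeries 15 (a + b) * thetaSeries 15 (a - b) =
      oddTheta a * evenTheta b - X ^ (a - b) * (evenTheta a * oddTheta b) := by
  have hb : b ≤ 7 := by omega
  have f1 := finite_thetaExp_le (m := 15) (x := a + b) (by omega) (by omega)
  have f2 := finite_thetaExp_le (m := 15) (x := a - b) (by omega) (by omega)
  have hc : ((a - b : ℕ) : ℤ) = a - b := by omega
  have f3 : ∀ n, {p : ℤ × ℤ | thetaExp 15 (a + b) p.1 + thetaExp 15 (a - b) p.2 ≤ n}.Finite :=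
    fun n => ((f1 n).prod (f2 n)).subset fun p hp => by
      simp only [Set.mem_ofPred_eq] at hp
      simp only [Set.mem_prod, Set.mem_ofPred_eq]
      omega
  have f4 : ∀ n, {p : ℤ × ℤ | evenExp a p.1 + oddExp b p.2 ≤ n}.Finite :=
    fun n => ((finite_evenExp_le ha n).prod (finite_oddExp_le hb n)).subset fun p hp => by
      simp only [Set.mem_ofPred_eq] at hp
      simp only [Set.mem_prod, Set.mem_ofPred_eq]
      omega
  have h5 : Summable fun p : ℤ × ℤ => (1 * 1 : ℚ⟦X⟧) * X ^ (evenExp a p.1 + oddExp b p.2) :=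
    summable_mul_X_pow f4 fun _ => 1 * 1
  have h0 : (∑' p : ℤ × ℤ, (Int.negOnePow p.1 : ℚ⟦X⟧) * (Int.negOnePow p.2 : ℚ⟦X⟧) *
        X ^ (thetaExp 15 (a + b) p.1 + thetaExp 15 (a - b) p.2)) =
      (∑' p : ℤ × ℤ, 1 * 1 * X ^ (oddExp a p.1 + evenExp b p.2)) +
        ∑' p : ℤ × ℤ, -X ^ (a - b) * (1 * 1 * X ^ (evenExp a p.1 + oddExp b p.2)) := by
    rw [tsum_eq_tsum_add_tsum_sumDiff f3]
    congr 1
    · refine tsum_congr fun p => ?_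
      simp only [negOnePow_mul_negOnePow]
      have h1 : Int.negOnePow (p.1 + p.2 + 1 + (p.1 - p.2 + 1)) = 1 :=
        Int.negOnePow_even _ ⟨p.1 + 1, by ring⟩
      have h2 : thetaExp 15 (a + b) (p.1 + p.2 + 1) + thetaExp 15 (a - b) (p.1 - p.2 + 1) =
          oddExp a p.1 + evenExp b p.2 := by
        have e1 := two_mul_thetaExp (m := 15) (x := a + b) (by omega) (p.1 + p.2 + 1)
        have e2 := two_mul_thetaExp (m := 15) (x := a - b) (by omega) (p.1 - p.2 + 1)
        have e3 := natCast_oddExp ha p.1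
        have e4 := natCast_evenExp hb p.2
        rw [hc] at e2
        push_cast at e1 e2
        zify
        linarith
      rw [h1, h2]
      simp
    · refine tsum_congr fun p => ?_
      simp only [negOnePow_mul_negOnePow]
      have h1 : Int.negOnePow (p.1 + p.2 + 1 + (p.1 - p.2)) = -1 :=
        Int.negOnePow_odd _ ⟨p.1, by ring⟩
      have h2 : thetaExp 15 (a + b) (p.1 + p.2 + 1) + thetaExp 15 (a - b) (p.1 - p.2) =
          (a - b) + (evenExp a p.1 + oddExp b p.2) := by
        have e1 := two_mul_thetaExp (m := 15) (x := a + b) (by omega) (p.1 + p.2 + 1)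
        have e2 := two_mul_thetaExp (m := 15) (x := a - b) (by omega) (p.1 - p.2)
        have e3 := natCast_evenExp ha p.1
        have e4 := natCast_oddExp hb p.2
        rw [hc] at e2
        push_cast at e1 e2
        zify
        rw [hc]
        linarith
      rw [h1, h2, pow_add]
      simp
  rw [thetaSeries, thetaSeries, tsum_X_pow_mul_tsum_X_pow f1 f2, h0, oddTheta, evenTheta,
    evenTheta, oddTheta, tsum_X_pow_mul_tsum_X_pow (finite_oddExp_le ha) (finite_evenExp_le hb),
    tsum_X_pow_mul_tsum_X_pow (finite_evenExp_le ha) (finite_oddExp_le hb),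
    h5.tsum_mul_left, neg_mul, ← sub_eq_add_neg]

theorem thetaSeries_sub {m x : ℕ} (hx : x ≤ m) : thetaSeries m (m - x) = thetaSeries m x := by
  rw [thetaSeries, ← (Equiv.neg ℤ).tsum_eq, thetaSeries]
  refine tsum_congr fun k => ?_
  have h : thetaExp m (m - x) (-k) = thetaExp m x k := by
    have e1 := two_mul_thetaExp (m := m) (x := m - x) (by omega) (-k)
    have e2 := two_mul_thetaExp (m := m) (x := x) (by omega) k
    rw [show ((m - x : ℕ) : ℤ) = m - x by omega] at e1
    zify
    linarith
  rw [Equiv.neg_apply, h, Int.negOnePow_neg]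

/-- **Weierstrass' three-term relation** for the theta series modulo `15`: the Plücker relation
between the two-by-two determinants of `thetaSeries_mul_thetaSeries`. -/
theorem thetaSeries_three_term {a b c d : ℕ} (hab : b < a) (hbc : c < b) (hcd : d < c)
    (ha : a ≤ 7) :
    X ^ (b - c) * (thetaSeries 15 (a + b) * thetaSeries 15 (a - b)) *
        (thetaSeries 15 (c + d) * thetaSeries 15 (c - d)) +
      (thetaSeries 15 (a + d) * thetaSeries 15 (a - d)) *
        (thetaSeries 15 (b + c) * thetaSeries 15 (b - c)) =
      (thetaSeries 15 (a + c) * thetaSeries 15 (a - c)) *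
        (thetaSeries 15 (b + d) * thetaSeries 15 (b - d)) := by
  rw [thetaSeries_mul_thetaSeries hab ha, thetaSeries_mul_thetaSeries hcd (by omega),
    thetaSeries_mul_thetaSeries (show d < a by omega) ha,
    thetaSeries_mul_thetaSeries hbc (by omega), thetaSeries_mul_thetaSeries (hbc.trans hab) ha,
    thetaSeries_mul_thetaSeries (hcd.trans hbc) (by omega)]
  obtain ⟨i, rfl⟩ := Nat.exists_eq_add_of_lt hcd
  obtain ⟨j, rfl⟩ := Nat.exists_eq_add_of_lt hbc
  obtain ⟨k, rfl⟩ := Nat.exists_eq_add_of_lt hab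
  simp only [show ∀ m n : ℕ, m + n + 1 - m = n + 1 by omega,
    show d + i + 1 + j + 1 - d = i + 1 + j + 1 by omega,
    show d + i + 1 + j + 1 + k + 1 - d = i + 1 + j + 1 + k + 1 by omega,
    show d + i + 1 + j + 1 + k + 1 - (d + i + 1) = j + 1 + k + 1 by omega]
  ring

/-! ### Substituting a power of the indeterminate, and the `5`-dissection of `E 1` -/

theorem continuous_expand {p : ℕ} (hp : p ≠ 0) :
    Continuous (expand p hp : ℚ⟦X⟧ → ℚ⟦X⟧) := by
  rw [continuous_iff_continuousAt]
  intro f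
  rw [ContinuousAt, PowerSeries.WithPiTopology.tendsto_iff_coeff_tendsto]
  intro d
  simp only [coeff_expand]
  split_ifs with h
  · exact (PowerSeries.WithPiTopology.continuous_coeff ℚ _).tendsto f
  · exact tendsto_const_nhds

theorem expand_progProd {p m x : ℕ} (hp : p ≠ 0) (hm : 0 < m) (hx : 0 < x) :
    expand p hp (progProd m x) = progProd (p * m) (p * x) := by
  rw [progProd, (multipliable_progProd hm hx).map_tprod _ (continuous_expand hp), progProd]
  refine tprod_congr fun j => ?_
  rw [map_sub, map_one, map_pow, expand_X, ← pow_mul]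
  ring_nf

theorem expand_E {p n : ℕ} (hp : p ≠ 0) (hn : 0 < n) : expand p hp (E n) = E (p * n) := by
  rw [E_eq_progProd, expand_progProd hp hn hn, E_eq_progProd]

theorem expand_thetaSeries {p m x : ℕ} (hp : p ≠ 0) (hx : 0 < x) (hxm : x < m) :
    expand p hp (thetaSeries m x) =
      ∑' k : ℤ, (Int.negOnePow k : ℚ⟦X⟧) * X ^ (p * thetaExp m x k) := by
  rw [thetaSeries, (summable_mul_X_pow (finite_thetaExp_le hx hxm) _).map_tsum _
    (continuous_expand hp)]
  refine tsum_congr fun k => ?_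
  rw [map_mul, map_pow, expand_X, ← pow_mul, map_intCast]

theorem thetaExp_three_one (k : ℤ) : thetaExp 3 1 k = pentagonal k := by
  have h1 := two_mul_thetaExp (m := 3) (x := 1) (by norm_num) k
  have h2 := two_mul_natCast_pentagonal k
  push_cast at h1
  zify
  linarith

/-- Euler's pentagonal number theorem. -/
theorem E_one_eq_thetaSeries : E 1 = thetaSeries 3 1 := by
  have h := (PowerSeries.WithPiTopology.hasSum_pentagonalSeries ℚ).tsum_eq
  rw [← PowerSeries.WithPiTopology.tprod_one_sub_X_pow] at h
  simp only [E, one_mul, ← h, thetaSeries, thetaExp_three_one]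

theorem finite_pentagonal_le (n : ℕ) : {k | pentagonal k ≤ n}.Finite :=
  (Set.finite_Iic n).preimage pentagonal_injective.injOn

/-- A sum over `ℤ` split according to the residue of the index modulo `5`. -/
theorem hasSum_fin_five {f : ℤ → ℚ⟦X⟧} {a : ℚ⟦X⟧} {g : Fin 5 → ℚ⟦X⟧} (hf : HasSum f a)
    (hg : ∀ r : Fin 5, HasSum (fun j : ℤ => f (5 * j + (r - 2))) (g r)) : a = ∑ r, g r := by
  have h1 : HasSum (fun p : Fin 5 × ℤ => f (5 * p.2 + (p.1 - 2))) a := by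
    have h2 := hf
    rw [← (Equiv.subRight (2 : ℤ)).hasSum_iff, ← (Int.divModEquiv 5).symm.hasSum_iff,
      ← (Equiv.prodComm (Fin 5) ℤ).hasSum_iff] at h2
    convert h2 using 1
    funext p
    simp [Function.comp, Int.divModEquiv, mul_comm, add_sub_assoc]
  exact (h1.prod_fiberwise hg).unique (hasSum_fintype _)

theorem negOnePow_five_mul_add (j r : ℤ) :
    Int.negOnePow (5 * j + r) = Int.negOnePow r * Int.negOnePow j := by
  rw [show 5 * j + r = 4 * j + (r + j) by ring, Int.negOnePow_add,
    Int.negOnePow_even _ ⟨2 * j, by ring⟩, one_mul, Int.negOnePow_add]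

theorem hasSum_residue {p m x c : ℕ} {r : ℤ} (hp : p ≠ 0) (hx : 0 < x) (hxm : x < m)
    (he : ∀ j : ℤ, (pentagonal (5 * j + r) : ℤ) = c + p * thetaExp m x j) :
    HasSum (fun j : ℤ => (Int.negOnePow (5 * j + r) : ℚ⟦X⟧) * X ^ pentagonal (5 * j + r))
      ((Int.negOnePow r : ℚ⟦X⟧) * X ^ c * expand p hp (thetaSeries m x)) := by
  rw [expand_thetaSeries hp hx hxm]
  have hf : ∀ n, {k | p * thetaExp m x k ≤ n}.Finite := fun n =>
    (finite_thetaExp_le hx hxm n).subset fun k hk =>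
      (Nat.le_mul_of_pos_left _ (Nat.pos_of_ne_zero hp)).trans hk
  have h1 : (fun j : ℤ => (Int.negOnePow (5 * j + r) : ℚ⟦X⟧) * X ^ pentagonal (5 * j + r)) =
      fun j => (Int.negOnePow r : ℚ⟦X⟧) * X ^ c *
        ((Int.negOnePow j : ℚ⟦X⟧) * X ^ (p * thetaExp m x j)) := by
    funext j
    have h2 : pentagonal (5 * j + r) = c + p * thetaExp m x j := by exact_mod_cast he j
    rw [h2, negOnePow_five_mul_add, pow_add]
    push_cast
    ring
  have h3 : Summable fun j : ℤ => (Int.negOnePow j : ℚ⟦X⟧) * X ^ (p * thetaExp m x j) :=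
    summable_mul_X_pow hf _
  rw [h1]
  exact h3.hasSum.mul_left _

/-- The part of `E 1` with exponents divisible by `5`, with `q ^ 5` replaced by `q`. -/
noncomputable def dissectA : ℚ⟦X⟧ := thetaSeries 15 7 + X * thetaSeries 15 2

/-- The part of `-E 1` with exponents congruent to `2` modulo `5`, divided by `q ^ 2`, with `q ^ 5`
replaced by `q`. -/
noncomputable def dissectB : ℚ⟦X⟧ := thetaSeries 15 4 - X * thetaSeries 15 1

/-- The `5`-dissection of `E 1`: the pentagonal numbers represent only the residues `0`, `1`, `2`
modulo `5`. -/
theorem E_one_eq_dissection :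
    E 1 = expand 5 (by norm_num) dissectA - X * expand 5 (by norm_num) (E 5) -
      X ^ 2 * expand 5 (by norm_num) dissectB := by
  have h := (summable_mul_X_pow finite_pentagonal_le fun k : ℤ => (Int.negOnePow k : ℚ⟦X⟧)).hasSum
  have h1 : (∑' k : ℤ, (Int.negOnePow k : ℚ⟦X⟧) * X ^ pentagonal k) = E 1 := by
    rw [E_one_eq_thetaSeries, thetaSeries]
    simp only [thetaExp_three_one]
  rw [h1] at h
  have he : E 5 = expand 5 (by norm_num) (thetaSeries 3 2) := by
    rw [show thetaSeries 3 2 = thetaSeries 3 1 from thetaSeries_sub (m := 3) (x := 1) (by norm_num),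
      ← E_one_eq_thetaSeries, expand_E (by norm_num) one_pos, mul_one]
  have h2 : HasSum _ _ := hasSum_residue (p := 5) (m := 15) (x := 1) (c := 7) (r := -2)
    (by norm_num) (by norm_num) (by norm_num) fun j => by
      have e1 := two_mul_natCast_pentagonal (5 * j + -2)
      have e2 := two_mul_thetaExp (m := 15) (x := 1) (by norm_num) j
      push_cast at e2 ⊢
      linarith
  have h3 : HasSum _ _ := hasSum_residue (p := 5) (m := 15) (x := 4) (c := 2) (r := -1)
    (by norm_num) (by norm_num) (by norm_num) fun j => by
      have e1 := two_mul_natCast_pentagonal (5 * j + -1)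
      have e2 := two_mul_thetaExp (m := 15) (x := 4) (by norm_num) j
      push_cast at e2 ⊢
      linarith
  have h4 : HasSum _ _ := hasSum_residue (p := 5) (m := 15) (x := 7) (c := 0) (r := 0)
    (by norm_num) (by norm_num) (by norm_num) fun j => by
      have e1 := two_mul_natCast_pentagonal (5 * j + 0)
      have e2 := two_mul_thetaExp (m := 15) (x := 7) (by norm_num) j
      push_cast at e2 ⊢
      linarith
  have h5 : HasSum _ _ := hasSum_residue (p := 5 * 5) (m := 3) (x := 2) (c := 1) (r := 1)
    (by norm_num) (by norm_num) (by norm_num) fun j => by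
      have e1 := two_mul_natCast_pentagonal (5 * j + 1)
      have e2 := two_mul_thetaExp (m := 3) (x := 2) (by norm_num) j
      push_cast at e2 ⊢
      linarith
  have h6 : HasSum _ _ := hasSum_residue (p := 5) (m := 15) (x := 13) (c := 5) (r := 2)
    (by norm_num) (by norm_num) (by norm_num) fun j => by
      have e1 := two_mul_natCast_pentagonal (5 * j + 2)
      have e2 := two_mul_thetaExp (m := 15) (x := 13) (by norm_num) j
      push_cast at e2 ⊢
      linarith
  have n1 : Int.negOnePow (-2) = 1 := by decide
  have n2 : Int.negOnePow (-1) = -1 := by decide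
  have n3 : Int.negOnePow 0 = 1 := by decide
  have n4 : Int.negOnePow 1 = -1 := by decide
  have n5 : Int.negOnePow 2 = 1 := by decide
  rw [expand_mul 5 (by norm_num) 5 (by norm_num), ← he] at h5
  rw [show thetaSeries 15 13 = thetaSeries 15 2 from thetaSeries_sub (m := 15) (x := 2)
    (by norm_num)] at h6
  rw [n1] at h2
  rw [n2] at h3
  rw [n3] at h4
  rw [n4] at h5
  rw [n5] at h6
  have h7 := hasSum_fin_five h (g := ![_, _, _, _, _]) fun r => by
    fin_cases r
    exacts [h2, h3, h4, h5, h6]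
  rw [h7, Fin.sum_univ_five, dissectA, dissectB]
  simp
  ring

/-! ### Relations between the theta series modulo `15` -/

theorem thetaSeries_ne_zero {m x : ℕ} (hx : 0 < x) (hxm : x < m) : thetaSeries m x ≠ 0 := by
  rw [← progProd_mul_progProd_mul_progProd hx hxm]
  exact mul_ne_zero (mul_ne_zero (progProd_ne_zero (by omega) (by omega))
    (progProd_ne_zero (by omega) hx)) (progProd_ne_zero (by omega) (by omega))

theorem E_ne_zero {n : ℕ} (hn : 0 < n) : E n ≠ 0 := by
  rw [E_eq_progProd]
  exact progProd_ne_zero hn hn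

theorem constantCoeff_E {n : ℕ} (hn : 0 < n) : constantCoeff (E n) = 1 := by
  rw [E_eq_progProd, constantCoeff_progProd hn hn]

theorem E_five_eq_thetaSeries : E 5 = thetaSeries 15 5 := by
  rw [E_eq_progProd, progProd_eq_prod_progProd (m := 5) (by norm_num) (by norm_num) 3,
    ← progProd_mul_progProd_mul_progProd (by norm_num) (by norm_num)]
  simp only [Fin.prod_univ_succ, Fin.prod_univ_zero]
  norm_num
  ring

theorem E_three_mul_E_fifteen : E 3 * E 15 = thetaSeries 15 3 * thetaSeries 15 6 := by
  rw [E_eq_progProd, E_eq_progProd,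
    progProd_eq_prod_progProd (m := 3) (by norm_num) (by norm_num) 5,
    ← progProd_mul_progProd_mul_progProd (by norm_num) (by norm_num),
    ← progProd_mul_progProd_mul_progProd (by norm_num) (by norm_num)]
  simp only [Fin.prod_univ_succ, Fin.prod_univ_zero]
  norm_num
  ring

theorem E_one_mul_E_fifteen_pow : E 1 * E 15 ^ 6 =
    thetaSeries 15 1 * thetaSeries 15 2 * thetaSeries 15 3 * thetaSeries 15 4 *
      thetaSeries 15 5 * thetaSeries 15 6 * thetaSeries 15 7 := by
  rw [E_eq_progProd, E_eq_progProd,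
    progProd_eq_prod_progProd (m := 1) (by norm_num) (by norm_num) 15]
  simp only [← progProd_mul_progProd_mul_progProd (show 0 < 1 by norm_num)
      (show 1 < 15 by norm_num),
    ← progProd_mul_progProd_mul_progProd (show 0 < 2 by norm_num) (show 2 < 15 by norm_num),
    ← progProd_mul_progProd_mul_progProd (show 0 < 3 by norm_num) (show 3 < 15 by norm_num),
    ← progProd_mul_progProd_mul_progProd (show 0 < 4 by norm_num) (show 4 < 15 by norm_num),
    ← progProd_mul_progProd_mul_progProd (show 0 < 5 by norm_num) (show 5 < 15 by norm_num),
    ← progProd_mul_progProd_mul_progProd (show 0 < 6 by norm_num) (show 6 < 15 by norm_num),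
    ← progProd_mul_progProd_mul_progProd (show 0 < 7 by norm_num) (show 7 < 15 by norm_num)]
  simp only [Fin.prod_univ_succ, Fin.prod_univ_zero]
  norm_num
  ring

theorem thetaSeries_relation_one :
    X * (thetaSeries 15 3 * thetaSeries 15 1 * thetaSeries 15 4) =
    thetaSeries 15 2 * thetaSeries 15 4 * thetaSeries 15 6 -
      thetaSeries 15 1 * thetaSeries 15 6 * thetaSeries 15 7 := by
  have h := thetaSeries_three_term (a := 7) (b := 3) (c := 2) (d := 1) (by norm_num) (by norm_num)
    (by norm_num) (by norm_num)
  norm_num at h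
  have h10 : thetaSeries 15 10 = thetaSeries 15 5 :=
    thetaSeries_sub (m := 15) (x := 5) (by norm_num)
  have h8 : thetaSeries 15 8 = thetaSeries 15 7 := thetaSeries_sub (m := 15) (x := 7) (by norm_num)
  have h9 : thetaSeries 15 9 = thetaSeries 15 6 := thetaSeries_sub (m := 15) (x := 6) (by norm_num)
  rw [h10, h8, h9] at h
  refine mul_left_cancel₀ (thetaSeries_ne_zero (m := 15) (x := 5) (by norm_num) (by norm_num)) ?_
  linear_combination h

theorem thetaSeries_relation_two :
    X ^ 2 * (thetaSeries 15 1 * thetaSeries 15 2 * thetaSeries 15 3) =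
    thetaSeries 15 3 * thetaSeries 15 4 * thetaSeries 15 7 -
      thetaSeries 15 2 * thetaSeries 15 6 * thetaSeries 15 7 := by
  have h := thetaSeries_three_term (a := 6) (b := 4) (c := 2) (d := 1) (by norm_num) (by norm_num)
    (by norm_num) (by norm_num)
  norm_num at h
  have h10 : thetaSeries 15 10 = thetaSeries 15 5 :=
    thetaSeries_sub (m := 15) (x := 5) (by norm_num)
  have h8 : thetaSeries 15 8 = thetaSeries 15 7 := thetaSeries_sub (m := 15) (x := 7) (by norm_num)
  rw [h10, h8] at h
  refine mul_left_cancel₀ (thetaSeries_ne_zero (m := 15) (x := 5) (by norm_num) (by norm_num)) ?_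
  linear_combination h

theorem dissectA_mul_thetaSeries :
    dissectA * (thetaSeries 15 1 * thetaSeries 15 4 * thetaSeries 15 6) =
      thetaSeries 15 5 * (thetaSeries 15 2 * thetaSeries 15 3 * thetaSeries 15 7) := by
  have h := thetaSeries_three_term (a := 5) (b := 4) (c := 3) (d := 1) (by norm_num) (by norm_num)
    (by norm_num) (by norm_num)
  norm_num at h
  have h8 : thetaSeries 15 8 = thetaSeries 15 7 := thetaSeries_sub (m := 15) (x := 7) (by norm_num)
  have h9 : thetaSeries 15 9 = thetaSeries 15 6 := thetaSeries_sub (m := 15) (x := 6) (by norm_num)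
  rw [h8, h9] at h
  rw [dissectA]
  linear_combination h

theorem dissectB_mul_thetaSeries :
    dissectB * (thetaSeries 15 2 * thetaSeries 15 3 * thetaSeries 15 7) =
      thetaSeries 15 5 * (thetaSeries 15 1 * thetaSeries 15 4 * thetaSeries 15 6) := by
  have h := thetaSeries_three_term (a := 5) (b := 3) (c := 2) (d := 1) (by norm_num) (by norm_num)
    (by norm_num) (by norm_num)
  norm_num at h
  have h8 : thetaSeries 15 8 = thetaSeries 15 7 := thetaSeries_sub (m := 15) (x := 7) (by norm_num)
  rw [h8] at h
  rw [dissectB]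
  linear_combination -h

theorem dissectA_mul_dissectB : dissectA * dissectB = E 5 ^ 2 := by
  have h : thetaSeries 15 1 * thetaSeries 15 4 * thetaSeries 15 6 *
      (thetaSeries 15 2 * thetaSeries 15 3 * thetaSeries 15 7) ≠ 0 := by
    simp only [ne_eq, mul_eq_zero, not_or]
    refine ⟨⟨⟨?_, ?_⟩, ?_⟩, ⟨?_, ?_⟩, ?_⟩ <;> exact thetaSeries_ne_zero (by norm_num) (by norm_num)
  refine mul_right_cancel₀ h ?_
  rw [E_five_eq_thetaSeries]
  linear_combination (dissectB * (thetaSeries 15 2 * thetaSeries 15 3 * thetaSeries 15 7)) *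
    dissectA_mul_thetaSeries + (thetaSeries 15 5 * (thetaSeries 15 2 * thetaSeries 15 3 *
    thetaSeries 15 7)) * dissectB_mul_thetaSeries

/-- The quotient `dissectA / E 5` is `q ^ (1 / 5)` over the continued fraction of Rogers and
Ramanujan. -/
theorem dissectA_mul_progProd : dissectA * (progProd 5 1 * progProd 5 4) =
    E 5 * (progProd 5 2 * progProd 5 3) := by
  have h := dissectA_mul_thetaSeries
  rw [← E_five_eq_thetaSeries] at h
  have hne : progProd 15 15 ^ 3 ≠ 0 := pow_ne_zero _ (progProd_ne_zero (by norm_num) (by norm_num))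
  simp only [← progProd_mul_progProd_mul_progProd (show 0 < 1 by norm_num)
      (show 1 < 15 by norm_num),
    ← progProd_mul_progProd_mul_progProd (show 0 < 2 by norm_num) (show 2 < 15 by norm_num),
    ← progProd_mul_progProd_mul_progProd (show 0 < 3 by norm_num) (show 3 < 15 by norm_num),
    ← progProd_mul_progProd_mul_progProd (show 0 < 4 by norm_num) (show 4 < 15 by norm_num),
    ← progProd_mul_progProd_mul_progProd (show 0 < 6 by norm_num) (show 6 < 15 by norm_num),
    ← progProd_mul_progProd_mul_progProd (show 0 < 7 by norm_num) (show 7 < 15 by norm_num)] at h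
  rw [progProd_eq_prod_progProd (m := 5) (x := 1) (by norm_num) (by norm_num) 3,
    progProd_eq_prod_progProd (m := 5) (x := 2) (by norm_num) (by norm_num) 3,
    progProd_eq_prod_progProd (m := 5) (x := 3) (by norm_num) (by norm_num) 3,
    progProd_eq_prod_progProd (m := 5) (x := 4) (by norm_num) (by norm_num) 3]
  simp only [Fin.prod_univ_succ, Fin.prod_univ_zero]
  norm_num at h ⊢
  refine mul_right_cancel₀ hne ?_
  linear_combination h

/-- `dissectA / E 5` becomes a quotient of two theta series modulo `15` when `q ^ 3`
replaces `q`. -/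
theorem expand_three_dissectA : expand 3 (by norm_num) dissectA * thetaSeries 15 3 =
    E 15 * thetaSeries 15 6 := by
  have h := congrArg (expand 3 (by norm_num)) dissectA_mul_progProd
  simp only [map_mul, expand_progProd (p := 3) (m := 5) (x := 1) (by norm_num)
      (by norm_num) (by norm_num),
    expand_progProd (p := 3) (m := 5) (x := 2) (by norm_num) (by norm_num) (by norm_num),
    expand_progProd (p := 3) (m := 5) (x := 3) (by norm_num) (by norm_num) (by norm_num),
    expand_progProd (p := 3) (m := 5) (x := 4) (by norm_num) (by norm_num) (by norm_num),
    expand_E (p := 3) (n := 5) (by norm_num) (by norm_num)] at h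
  rw [← progProd_mul_progProd_mul_progProd (by norm_num) (by norm_num),
    ← progProd_mul_progProd_mul_progProd (by norm_num) (by norm_num)]
  norm_num at h ⊢
  linear_combination progProd 15 15 * h

/-! ### The product of the conjugates of `E 1` under `q ↦ ζ q`, `ζ ^ 5 = 1` -/

theorem continuous_rescale (z : ℂ) : Continuous (rescale z : ℂ⟦X⟧ → ℂ⟦X⟧) := by
  rw [continuous_iff_continuousAt]
  intro f
  rw [ContinuousAt, PowerSeries.WithPiTopology.tendsto_iff_coeff_tendsto]
  intro d
  simp only [coeff_rescale]
  exact ((PowerSeries.WithPiTopology.continuous_coeff ℂ d).tendsto f).const_mul _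

theorem continuous_map_algebraMap :
    Continuous (PowerSeries.map (algebraMap ℚ ℂ) : ℚ⟦X⟧ → ℂ⟦X⟧) := by
  rw [continuous_iff_continuousAt]
  intro f
  rw [ContinuousAt, PowerSeries.WithPiTopology.tendsto_iff_coeff_tendsto]
  intro d
  simp only [coeff_map]
  exact ((continuous_algebraMap ℚ ℂ).tendsto _).comp
    ((PowerSeries.WithPiTopology.continuous_coeff ℚ d).tendsto f)

theorem multipliable_complex {m x : ℕ} (hm : 0 < m) (hx : 0 < x) :
    Multipliable fun j : ℕ => (1 : ℂ⟦X⟧) - X ^ (m * j + x) := by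
  simpa using multipliable_one_sub_X_pow_linear hm hx fun _ => (1 : ℂ)

theorem map_E {n : ℕ} (hn : 0 < n) :
    PowerSeries.map (algebraMap ℚ ℂ) (E n) = ∏' j : ℕ, (1 - X ^ (n * j + n)) := by
  rw [E_eq_progProd, progProd, (multipliable_progProd hn hn).map_tprod _ continuous_map_algebraMap]
  exact tprod_congr fun j => by simp

/-- The product of the conjugates of `1 - y`, if `q ↦ z q` multiplies `y` by `z ^ n`, as it does for
`y = q ^ n`. -/
theorem prod_one_sub_pow_mul {z : ℂ} (hz : IsPrimitiveRoot z 5) (y : ℂ⟦X⟧) (n : ℕ) :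
    ∏ i ∈ Finset.range 5, (1 - C ((z ^ i) ^ n) * y) =
      if 5 ∣ n then (1 - y) ^ 5 else 1 - y ^ 5 := by
  split_ifs with h
  · obtain ⟨k, rfl⟩ := h
    have h1 : ∀ i, (z ^ i) ^ (5 * k) = 1 := fun i => by
      rw [← pow_mul, show i * (5 * k) = 5 * (i * k) by ring, pow_mul, hz.pow_eq_one, one_pow]
    simp [h1]
  · have hn : IsPrimitiveRoot (z ^ n) 5 := hz.pow_of_coprime n
      (((Nat.Prime.coprime_iff_not_dvd (by norm_num)).2 h).symm)
    have h2 : ∑ i ∈ Finset.range 5, (C (z ^ n) : ℂ⟦X⟧) ^ i = 0 := by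
      simp only [← map_pow C (z ^ n)]
      rw [← map_sum, hn.geom_sum_eq_zero (by norm_num), map_zero]
    set w : ℂ⟦X⟧ := C (z ^ n)
    have h3 : ∀ i, C ((z ^ i) ^ n) = w ^ i := fun i => by
      rw [← pow_mul, mul_comm, pow_mul, map_pow]
    simp only [Finset.sum_range_succ, Finset.sum_range_zero] at h2
    simp only [h3, Finset.prod_range_succ, Finset.prod_range_zero]
    -- the elementary symmetric functions of `1, w, …, w⁴`, divided by `1 + w + ⋯ + w⁴`
    linear_combination (-y + (w + w ^ 3) * y ^ 2 - (w ^ 3 + w ^ 5) * y ^ 3 + w ^ 6 * y ^ 4 -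
      (w ^ 5 + 1) * (w - 1) * y ^ 5) * h2

/-- The norm of `E 1`: the conjugates of the factor `1 - q^n` multiply to `1 - q^(5 n)` if `5 ∤ n`,
and to `(1 - q^n)^5` otherwise. -/
theorem prod_rescale_E_one {z : ℂ} (hz : IsPrimitiveRoot z 5) :
    (∏ i ∈ Finset.range 5, rescale (z ^ i) (PowerSeries.map (algebraMap ℚ ℂ) (E 1))) *
      PowerSeries.map (algebraMap ℚ ℂ) (E 25) = PowerSeries.map (algebraMap ℚ ℂ) (E 5) ^ 6 := by
  have h1 : ∀ i, rescale (z ^ i) (PowerSeries.map (algebraMap ℚ ℂ) (E 1)) =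
      ∏' j : ℕ, (1 - C ((z ^ i) ^ (1 * j + 1)) * X ^ (1 * j + 1)) := fun i => by
    rw [map_E one_pos, (multipliable_complex one_pos one_pos).map_tprod _ (continuous_rescale _)]
    refine tprod_congr fun j => ?_
    rw [map_sub, map_one, map_pow, rescale_X, mul_pow, ← map_pow C (z ^ i)]
  let e : ℕ → ℕ := fun j => 5 * j + 4
  have he : Function.Injective e := fun a b h => by simpa [e] using h
  -- the factor `1 - q^(j + 1)`, kept only for `5 ∣ j + 1`
  let d : ℕ → ℂ⟦X⟧ := fun j => if 5 ∣ j + 1 then 1 - X ^ (j + 1) else 1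
  let d5 : ℕ → ℂ⟦X⟧ := fun j => if 5 ∣ j + 1 then 1 - X ^ (5 * (j + 1)) else 1
  have hsupp : ∀ f : ℕ → ℂ⟦X⟧, (∀ j, ¬ 5 ∣ j + 1 → f j = 1) → ∀ j ∉ Set.range e, f j = 1 :=
    fun f hf j hj => hf j fun h => hj <| by
      obtain ⟨k, hk⟩ := h
      exact ⟨k - 1, by simp only [e]; omega⟩
  have hd : HasProd d (PowerSeries.map (algebraMap ℚ ℂ) (E 5)) := by
    rw [← he.hasProd_iff (hsupp d fun j hj => if_neg hj), map_E (by norm_num)]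
    convert (multipliable_complex (m := 5) (x := 5) (by norm_num) (by norm_num)).hasProd using 1
    funext j
    simp only [Function.comp, d, e, add_assoc]
    norm_num
  have hd5 : HasProd d5 (PowerSeries.map (algebraMap ℚ ℂ) (E 25)) := by
    rw [← he.hasProd_iff (hsupp d5 fun j hj => if_neg hj), map_E (by norm_num)]
    convert (multipliable_complex (m := 25) (x := 25) (by norm_num) (by norm_num)).hasProd using 1
    funext j
    simp only [Function.comp, d5, e, add_assoc]
    norm_num
    ring
  have h5 : HasProd (fun j : ℕ => (1 : ℂ⟦X⟧) - X ^ (5 * j + 5))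
      (PowerSeries.map (algebraMap ℚ ℂ) (E 5)) := by
    rw [map_E (by norm_num)]
    exact (multipliable_complex (m := 5) (x := 5) (by norm_num) (by norm_num)).hasProd
  simp only [h1]
  have hm : ∀ i ∈ Finset.range 5, Multipliable fun j : ℕ =>
      (1 : ℂ⟦X⟧) - C ((z ^ i) ^ (1 * j + 1)) * X ^ (1 * j + 1) := fun i _ =>
    multipliable_one_sub_X_pow_linear one_pos one_pos _
  have h6 := (hasProd_prod fun i hi => (hm i hi).hasProd).mul hd5
  have h7 := h5.mul (hasProd_prod (s := Finset.range 5) fun _ _ => hd)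
  have h8 : HasProd (fun j : ℕ => (∏ i ∈ Finset.range 5,
      ((1 : ℂ⟦X⟧) - C ((z ^ i) ^ (1 * j + 1)) * X ^ (1 * j + 1))) * d5 j)
      (PowerSeries.map (algebraMap ℚ ℂ) (E 5) * ∏ i ∈ Finset.range 5,
        PowerSeries.map (algebraMap ℚ ℂ) (E 5)) := by
    convert h7 using 1
    funext j
    rw [prod_one_sub_pow_mul hz]
    simp only [one_mul, d, d5, Finset.prod_const, Finset.card_range]
    split_ifs with h
    · ring
    · ring
  rw [h6.unique h8, Finset.prod_const, Finset.card_range]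
  ring

theorem rescale_map_expand_five {z : ℂ} (hz : z ^ 5 = 1) (f : ℚ⟦X⟧) :
    rescale z (PowerSeries.map (algebraMap ℚ ℂ) (expand 5 (by norm_num) f)) =
      PowerSeries.map (algebraMap ℚ ℂ) (expand 5 (by norm_num) f) := by
  ext n
  rw [coeff_rescale, coeff_map, coeff_expand]
  split_ifs with h
  · obtain ⟨k, rfl⟩ := h
    rw [pow_mul, hz, one_pow, one_mul]
  · simp

/-- The norm of `a - T e - T² b` for `T = w^i x`, `w` a primitive fifth root of unity. -/
theorem prod_sub_sub_eq {R : Type*} [CommRing R] {a e b x w : R} (hab : a * b = e ^ 2)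
    (hw : 1 + w + w ^ 2 + w ^ 3 + w ^ 4 = 0) :
    ∏ i ∈ Finset.range 5, (a - w ^ i * x * e - (w ^ i * x) ^ 2 * b) =
      a ^ 5 - 11 * x ^ 5 * e ^ 5 - x ^ 10 * b ^ 5 := by
  simp only [Finset.prod_range_succ, Finset.prod_range_zero]
  -- the difference of the two sides in the ideal generated by `a b - e ^ 2` and
  -- `1 + w + w ^ 2 + w ^ 3 + w ^ 4`
  linear_combination (-5 * x ^ 5 * e * (2 * e ^ 2 + a * b)) * hab + (
    (-1) * (a ^ 4 * e * x) +
    (-1 + w - w ^ 2 + w ^ 3 - w ^ 4) * (a ^ 4 * b * x ^ 2) +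
    (w + w ^ 3) * (a ^ 3 * e ^ 2 * x ^ 2) +
    (w + w ^ 2 - w ^ 3 + 2 * w ^ 4 - w ^ 5 + w ^ 6 + w ^ 7) * (a ^ 3 * e * b * x ^ 3) +
    (w ^ 2 - w ^ 3 + w ^ 4 - w ^ 5 + 2 * w ^ 6 - w ^ 7 + w ^ 8 - w ^ 9 + w ^ 10) *
      (a ^ 3 * b ^ 2 * x ^ 4) +
    (-w ^ 3 - w ^ 5) * (a ^ 2 * e ^ 3 * x ^ 3) +
    (-w ^ 3 - w ^ 4 + (-2) * w ^ 5 + 2 * w ^ 6 + (-2) * w ^ 7 - w ^ 8 - w ^ 9) *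
      (a ^ 2 * e ^ 2 * b * x ^ 4) +
    (5 * 1 + (-5) * w - w ^ 4 + 4 * w ^ 5 + (-5) * w ^ 6 - w ^ 8 - w ^ 11 - w ^ 12) *
      (a ^ 2 * e * b ^ 2 * x ^ 5) +
    (-w ^ 6 + w ^ 7 - w ^ 8 + w ^ 9 + (-2) * w ^ 10 + w ^ 11 - w ^ 12 + w ^ 13 - w ^ 14) *
      (a ^ 2 * b ^ 3 * x ^ 6) +
    (w ^ 6) * (a * e ^ 4 * x ^ 4) +
    (5 * 1 + (-5) * w + 5 * w ^ 5 + (-4) * w ^ 6 + w ^ 7 + w ^ 8 + w ^ 9 + w ^ 10) *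
      (a * e ^ 3 * b * x ^ 5) +
    (w ^ 7 + w ^ 8 + 2 * w ^ 9 + (-2) * w ^ 10 + 2 * w ^ 11 + w ^ 12 + w ^ 13) *
      (a * e ^ 2 * b ^ 2 * x ^ 6) +
    (w ^ 9 + w ^ 10 - w ^ 11 + 2 * w ^ 12 - w ^ 13 + w ^ 14 + w ^ 15) * (a * e * b ^ 3 * x ^ 7) +
    (w ^ 12 - w ^ 13 + w ^ 14 - w ^ 15 + w ^ 16) * (a * b ^ 4 * x ^ 8) +
    (1 - w + w ^ 5 - w ^ 6) * (e ^ 5 * x ^ 5) +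
    (-w ^ 10) * (e ^ 4 * b * x ^ 6) +
    (-w ^ 11 - w ^ 13) * (e ^ 3 * b ^ 2 * x ^ 7) +
    (-w ^ 13 - w ^ 15) * (e ^ 2 * b ^ 3 * x ^ 8) +
    (-w ^ 16) * (e * b ^ 4 * x ^ 9) +
    (1 - w + w ^ 5 - w ^ 6 + w ^ 10 - w ^ 11 + w ^ 15 - w ^ 16) * (b ^ 5 * x ^ 10)) * hw

/-- The quintic relation of Ramanujan between `dissectA / E 5` and `E 1 / E 5`. -/
theorem E_five_mul_quintic : E 5 * (dissectA ^ 5 - 11 * X * E 5 ^ 5 - X ^ 2 * dissectB ^ 5) =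
    E 1 ^ 6 := by
  obtain ⟨z, hz⟩ : ∃ z : ℂ, IsPrimitiveRoot z 5 := ⟨_, Complex.isPrimitiveRoot_exp 5 (by norm_num)⟩
  have hnorm := prod_rescale_E_one hz
  have h5 : ∀ i, (z ^ i) ^ 5 = 1 := fun i => by
    rw [← pow_mul, mul_comm, pow_mul, hz.pow_eq_one, one_pow]
  let φ : ℚ⟦X⟧ →+* ℂ⟦X⟧ := (PowerSeries.map (algebraMap ℚ ℂ)).comp
    (expand 5 (by norm_num) : ℚ⟦X⟧ →ₐ[ℚ] ℚ⟦X⟧).toRingHom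
  have hφ : Function.Injective φ := by
    intro f g h
    ext n
    have h1 := congrArg (coeff (5 * n)) h
    simpa [φ] using h1
  have hφr : ∀ i f, rescale (z ^ i) (φ f) = φ f := fun i f => rescale_map_expand_five (h5 i) f
  have hφX : φ X = X ^ 5 := by simp [φ]
  have h1 : ∀ i, rescale (z ^ i) (PowerSeries.map (algebraMap ℚ ℂ) (E 1)) =
      φ dissectA - C z ^ i * X * φ (E 5) - (C z ^ i * X) ^ 2 * φ dissectB := fun i => by
    have h2 : PowerSeries.map (algebraMap ℚ ℂ) (E 1) =
        φ dissectA - X * φ (E 5) - X ^ 2 * φ dissectB := by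
      rw [E_one_eq_dissection]
      simp [φ]
    rw [h2, map_sub, map_sub, map_mul, map_mul, map_pow, hφr, hφr, hφr, rescale_X, map_pow]
  have h25 : PowerSeries.map (algebraMap ℚ ℂ) (E 25) = φ (E 5) := by
    rw [← show expand 5 (by norm_num) (E 5) = E 25 from
      expand_E (p := 5) (n := 5) (by norm_num) (by norm_num)]
    rfl
  have h55 : PowerSeries.map (algebraMap ℚ ℂ) (E 5) = φ (E 1) := by
    rw [← show expand 5 (by norm_num) (E 1) = E 5 from
      expand_E (p := 5) (n := 1) (by norm_num) (by norm_num)]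
    rfl
  have hw := congrArg (C (R := ℂ)) (hz.geom_sum_eq_zero (by norm_num))
  simp only [Finset.sum_range_succ, Finset.sum_range_zero, map_add, map_zero, map_pow, pow_zero,
    map_one, pow_one, zero_add] at hw
  rw [h25, h55] at hnorm
  simp only [h1] at hnorm
  rw [prod_sub_sub_eq (by rw [← map_mul, dissectA_mul_dissectB, map_pow]) hw] at hnorm
  apply hφ
  simp only [map_sub, map_mul, map_pow, hφX, map_ofNat]
  linear_combination hnorm

/-! ### The generating function of colored partitions -/

/-- The multisets of elements of `S` whose weights `w` add up to `n`. -/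
def weightedMultisets {α : Type*} (w : α → ℕ) (S : Finset α) (n : ℕ) : Set (Multiset α) :=
  {m | (∀ a ∈ m, a ∈ S) ∧ (m.map w).sum = n}

theorem finite_weightedMultisets {α : Type*} (w : α → ℕ) {S : Finset α} (hw : ∀ a ∈ S, 0 < w a)
    (n : ℕ) : (weightedMultisets w S n).Finite := by
  classical
  refine (Set.finite_Iic (n • S.val)).subset fun m ⟨hm, hs⟩ => ?_
  have hcard : m.card ≤ n := by
    have h := Multiset.card_nsmul_le_sum (s := m.map w) (a := 1) (by
      intro y hy
      obtain ⟨x, hx, rfl⟩ := Multiset.mem_map.1 hy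
      exact hw x (hm x hx))
    rw [hs] at h
    simpa using h
  refine Multiset.le_iff_count.2 fun a => ?_
  by_cases ha : a ∈ m
  · have h1 : 1 ≤ Multiset.count a S.val := Multiset.one_le_count_iff_mem.2 (hm a ha)
    rw [Multiset.count_nsmul]
    exact ((Multiset.count_le_card a m).trans hcard).trans (Nat.le_mul_of_pos_right n h1)
  · simp [Multiset.count_eq_zero_of_notMem ha]

theorem mem_weightedMultisets {α : Type*} {w : α → ℕ} {S : Finset α} {n : ℕ} {m : Multiset α} :
    m ∈ weightedMultisets w S n ↔ (∀ a ∈ m, a ∈ S) ∧ (m.map w).sum = n := Iff.rfl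

/-- A multiset of elements of `insert a S` either avoids `a`, or arises by adding a copy of `a`. -/
theorem weightedMultisets_insert {α : Type*} [DecidableEq α] (w : α → ℕ) (S : Finset α) (a : α)
    (n : ℕ) : weightedMultisets w (insert a S) (n + w a) =
      weightedMultisets w (S.erase a) (n + w a) ∪
        (fun m => a ::ₘ m) '' weightedMultisets w (insert a S) n := by
  ext m
  simp only [Set.mem_union, Set.mem_image, mem_weightedMultisets]
  constructor
  · rintro ⟨h1, h2⟩
    by_cases ha : a ∈ m
    · obtain ⟨t, rfl⟩ := Multiset.exists_cons_of_mem ha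
      refine Or.inr ⟨t, ⟨fun x hx => h1 x (Multiset.mem_cons_of_mem hx), ?_⟩, rfl⟩
      simp at h2
      omega
    · refine Or.inl ⟨fun x hx => ?_, h2⟩
      have hxa : x ≠ a := fun h => ha (h ▸ hx)
      have := h1 x hx
      simp_all
  · rintro (⟨h1, h2⟩ | ⟨t, ⟨h1, h2⟩, rfl⟩)
    · exact ⟨fun x hx => Finset.mem_insert_of_mem (Finset.mem_of_mem_erase (h1 x hx)), h2⟩
    · refine ⟨fun x hx => ?_, ?_⟩
      · rcases Multiset.mem_cons.1 hx with rfl | hx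
        · exact Finset.mem_insert_self _ _
        · exact h1 x hx
      · simp [h2, add_comm]

theorem weightedMultisets_insert_of_lt {α : Type*} [DecidableEq α] (w : α → ℕ) {S : Finset α}
    {a : α} {n : ℕ} (hn : n < w a) : weightedMultisets w (insert a S) n =
      weightedMultisets w (S.erase a) n := by
  ext m
  simp only [mem_weightedMultisets]
  refine and_congr_left fun h2 => forall₂_congr fun x hx => ?_
  have hxa : x ≠ a := by
    rintro rfl
    have := Multiset.le_sum_of_mem (Multiset.mem_map_of_mem w hx)
    omega
  simp [hxa]

/-- The generating function of multisets of elements of a finite set, by weight. -/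
theorem mk_ncard_weightedMultisets_mul_prod {α : Type*} (w : α → ℕ) (S : Finset α)
    (hw : ∀ a ∈ S, 0 < w a) :
    (mk fun n => ((weightedMultisets w S n).ncard : ℚ)) * ∏ a ∈ S, (1 - X ^ w a) = 1 := by
  classical
  induction S using Finset.induction_on with
  | empty =>
    rw [Finset.prod_empty, mul_one]
    ext n
    have h : weightedMultisets w ∅ n = if n = 0 then {0} else ∅ := by
      ext m
      rw [mem_weightedMultisets]
      constructor
      · rintro ⟨h1, h2⟩
        have : m = 0 := Multiset.eq_zero_of_forall_notMem fun a ha => by simpa using h1 a ha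
        subst this
        simp at h2
        simp [← h2]
      · split_ifs with hn
        · rintro rfl
          simp [hn]
        · simp
    rw [coeff_mk, h, coeff_one]
    split_ifs <;> simp
  | insert a S ha ih =>
    rw [Finset.prod_insert ha, ← mul_assoc]
    refine Eq.trans ?_ (ih fun b hb => hw b (Finset.mem_insert_of_mem hb))
    congr 1
    ext n
    rw [mul_sub, mul_one, map_sub, coeff_mul_X_pow', coeff_mk, coeff_mk, coeff_mk]
    by_cases hn : w a ≤ n
    · obtain ⟨d, rfl⟩ := Nat.exists_eq_add_of_le' hn
      have hd : Disjoint (weightedMultisets w (S.erase a) (d + w a))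
          ((fun m => a ::ₘ m) '' weightedMultisets w (insert a S) d) := by
        rw [Set.disjoint_left]
        rintro _ ⟨h1, -⟩ ⟨t, -, rfl⟩
        exact Finset.notMem_erase a S (h1 a (Multiset.mem_cons_self a t))
      rw [weightedMultisets_insert, Set.ncard_union_eq hd
        (finite_weightedMultisets w (fun b hb => hw b
          (Finset.mem_insert_of_mem (Finset.mem_of_mem_erase hb))) _)
        ((finite_weightedMultisets w hw _).image _),
        Set.ncard_image_of_injective _ fun _ _ h => (Multiset.cons_inj_right a).1 h,
        Finset.erase_eq_of_notMem ha]
      simp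
    · rw [weightedMultisets_insert_of_lt w (not_le.1 hn), Finset.erase_eq_of_notMem ha]
      simp [hn]

/-- The colored parts of size at most `N`. -/
def coloredParts (k r N : ℕ) : Finset (Σ m : ℕ, Fin (numColors k r m)) :=
  (Finset.Icc 1 N).sigma fun _ => Finset.univ

theorem coloredPartitionCount_eq_ncard (k r : ℕ) {n N : ℕ} (hn : n ≤ N) :
    coloredPartitionCount k r n =
      (weightedMultisets Sigma.fst (coloredParts k r N) n).ncard := by
  rw [coloredPartitionCount, ← Nat.card_coe_set_eq]
  refine Nat.card_congr ⟨fun p => ⟨p.parts, fun x hx => ?_, p.parts_sum⟩,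
    fun m => ⟨m.1, fun x hx => ?_, m.2.2⟩, fun _ => rfl, fun _ => rfl⟩
  · have h1 := p.parts_pos x hx
    have h2 := Multiset.le_sum_of_mem (Multiset.mem_map_of_mem (fun x => x.1) hx)
    rw [p.parts_sum] at h2
    simp only [coloredParts, Finset.mem_sigma, Finset.mem_Icc, Finset.mem_univ, and_true]
    exact ⟨h1, h2.trans hn⟩
  · have h := m.2.1 x hx
    simp only [coloredParts, Finset.mem_sigma, Finset.mem_Icc, Finset.mem_univ, and_true] at h
    exact h.1

theorem prod_coloredParts (k : ℕ) {r : ℕ} (hr : 0 < r) (M : ℕ) :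
    ∏ a ∈ coloredParts k r (r * M), (1 - (X : ℚ⟦X⟧) ^ a.1) =
      (∏ j ∈ Finset.range (r * M), (1 - X ^ (1 * j + 1))) ^ k *
        (∏ j ∈ Finset.range M, (1 - X ^ (r * j + r))) ^ k := by
  have h2 : ∏ m ∈ (Finset.Icc 1 (r * M)).filter (r ∣ ·), (1 - (X : ℚ⟦X⟧) ^ m) =
      ∏ j ∈ Finset.range M, (1 - X ^ (r * j + r)) := by
    symm
    refine Finset.prod_nbij (fun j => r * (j + 1)) ?_ ?_ ?_ ?_
    · intro j hj
      simp only [Finset.mem_range] at hj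
      simp only [Finset.mem_filter, Finset.mem_Icc, dvd_mul_right, and_true]
      exact ⟨Nat.mul_pos hr (by omega), Nat.mul_le_mul_left r hj⟩
    · intro i _ j _ h
      simpa using Nat.eq_of_mul_eq_mul_left hr h
    · intro m hm
      simp only [Finset.coe_filter, Finset.mem_Icc, Set.mem_ofPred_eq] at hm
      obtain ⟨⟨h1, h2⟩, d, rfl⟩ := hm
      have h3 : d ≤ M := Nat.le_of_mul_le_mul_left h2 hr
      have h4 : 0 < d := Nat.pos_of_mul_pos_left h1
      exact ⟨d - 1, by simp; omega, by simp only; rw [Nat.sub_add_cancel h4]⟩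
    · intro j _
      rw [mul_add, mul_one]
  have h1 : ∏ m ∈ Finset.Icc 1 (r * M), (1 - (X : ℚ⟦X⟧) ^ m) =
      ∏ j ∈ Finset.range (r * M), (1 - X ^ (1 * j + 1)) := by
    simp_rw [one_mul]
    rw [Finset.range_eq_Ico, Finset.prod_Ico_add' (fun m => (1 - (X : ℚ⟦X⟧) ^ m)) 0 (r * M) 1]
    rfl
  rw [coloredParts, Finset.prod_sigma, ← h1, ← h2, ← Finset.prod_pow, ← Finset.prod_pow,
    Finset.prod_filter, ← Finset.prod_mul_distrib]
  refine Finset.prod_congr rfl fun m _ => ?_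
  dsimp only
  rw [Finset.prod_const, Finset.card_univ, Fintype.card_fin, numColors, pow_add]
  split_ifs <;> simp

/-- The generating function of the colored partitions is `1 / (E 1 ^ k * E r ^ k)`. -/
theorem mk_coloredPartitionCount_mul (k : ℕ) {r : ℕ} (hr : 0 < r) :
    (mk fun n => (coloredPartitionCount k r n : ℚ)) * (E 1 ^ k * E r ^ k) = 1 := by
  ext n
  set N := r * (n + 1) with hN
  have hnN : n < N := by nlinarith
  have hP := mk_ncard_weightedMultisets_mul_prod Sigma.fst (coloredParts k r N) (by
    intro a ha
    simp only [coloredParts, Finset.mem_sigma, Finset.mem_Icc] at ha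
    exact ha.1.1)
  rw [← hP, ← sub_eq_zero, ← map_sub]
  suffices h : (X : ℚ⟦X⟧) ^ (n + 1) ∣ _ from X_pow_dvd_iff.1 h n (Nat.lt_succ_self n)
  rw [prod_coloredParts k hr]
  have key : ∀ a b c d : ℚ⟦X⟧, X ^ (n + 1) ∣ a - b → X ^ (n + 1) ∣ c - d →
      X ^ (n + 1) ∣ a * c - b * d := fun a b c d h1 h2 => by
    have : a * c - b * d = (a - b) * c + b * (c - d) := by ring
    rw [this]
    exact dvd_add (h1.mul_right _) (h2.mul_left _)
  refine key _ _ _ _ ?_ (key _ _ _ _ ?_ ?_)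
  · rw [X_pow_dvd_iff]
    intro m hm
    rw [map_sub, coeff_mk, coeff_mk, coloredPartitionCount_eq_ncard k r (N := N) (by omega),
      sub_self]
  · refine Dvd.dvd.trans ?_ (sub_dvd_pow_sub_pow _ _ k)
    rw [E_eq_progProd]
    exact X_pow_dvd_progProd_sub_prod one_pos one_pos hnN
  · refine Dvd.dvd.trans ?_ (sub_dvd_pow_sub_pow _ _ k)
    rw [E_eq_progProd]
    exact X_pow_dvd_progProd_sub_prod hr hr le_rfl

/-! ### Sections of power series along residue classes modulo `5` -/

/-- The linear operator `∑ c n q ^ n ↦ ∑ c (5 n + s) q ^ n`. -/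
noncomputable def residueSection (s : ℕ) : ℚ⟦X⟧ →ₗ[ℚ] ℚ⟦X⟧ where
  toFun f := mk fun n => coeff (5 * n + s) f
  map_add' _ _ := by ext; simp
  map_smul' _ _ := by ext; simp

theorem coeff_residueSection (s n : ℕ) (f : ℚ⟦X⟧) :
    coeff n (residueSection s f) = coeff (5 * n + s) f := by
  simp [residueSection]

theorem residueSection_X_pow_mul_expand {s : ℕ} (hs : s < 5) (j : ℕ) (h : ℚ⟦X⟧) :
    residueSection s (X ^ j * expand 5 (by norm_num) h) =
      if j % 5 = s then X ^ (j / 5) * h else 0 := by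
  ext n
  rw [coeff_residueSection, coeff_X_pow_mul', coeff_expand]
  split_ifs with h1 h2 h3 h3 h3
  · rw [coeff_X_pow_mul', if_pos (by omega)]
    congr 2
    omega
  · omega
  · omega
  · simp
  · rw [coeff_X_pow_mul', if_neg (by omega)]
  · simp

theorem eq_sum_residueSection (f : ℚ⟦X⟧) :
    f = ∑ r ∈ Finset.range 5, X ^ r * expand 5 (by norm_num) (residueSection r f) := by
  ext n
  have h : ∀ r ∈ Finset.range 5, coeff n (X ^ r * expand 5 (by norm_num) (residueSection r f)) =
      if r = n % 5 then coeff n f else 0 := by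
    intro r hr
    rw [Finset.mem_range] at hr
    rw [coeff_X_pow_mul', coeff_expand]
    split_ifs with h1 h2 h3 h3 h3
    · rw [coeff_residueSection]
      congr 2
      omega
    · omega
    · omega
    · rfl
    · omega
    · rfl
  rw [map_sum, Finset.sum_congr rfl h, Finset.sum_ite_eq', if_pos]
  exact Finset.mem_range.2 (Nat.mod_lt _ (by norm_num))

/-- A series in `q ^ 5` can be taken out of a section. -/
theorem residueSection_mul_expand {s : ℕ} (hs : s < 5) (f u : ℚ⟦X⟧) :
    residueSection s (f * expand 5 (by norm_num) u) = residueSection s f * u := by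
  conv_lhs => rw [eq_sum_residueSection f]
  rw [Finset.sum_mul, map_sum, Finset.sum_eq_single s]
  · rw [mul_assoc, ← map_mul, residueSection_X_pow_mul_expand hs, if_pos (Nat.mod_eq_of_lt hs),
      Nat.div_eq_of_lt hs, pow_zero, one_mul]
  · intro r hr hrs
    rw [Finset.mem_range] at hr
    rw [mul_assoc, ← map_mul, residueSection_X_pow_mul_expand hs, if_neg]
    rwa [Nat.mod_eq_of_lt hr]
  · exact fun h => absurd (Finset.mem_range.2 hs) h

/-- The section of a product of two dissected series, the second one with `q ^ 3` for `q`. -/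
theorem residueSection_sum_mul_sum {s : ℕ} (hs : s < 5) (f g : ℕ → ℚ⟦X⟧) :
    residueSection s ((∑ r ∈ Finset.range 5, X ^ r * expand 5 (by norm_num) (f r)) *
        ∑ t ∈ Finset.range 5, X ^ (3 * t) * expand 5 (by norm_num) (g t)) =
      ∑ r ∈ Finset.range 5, ∑ t ∈ Finset.range 5,
        if (r + 3 * t) % 5 = s then X ^ ((r + 3 * t) / 5) * (f r * g t) else 0 := by
  rw [Finset.sum_mul_sum, map_sum]
  refine Finset.sum_congr rfl fun r _ => ?_
  rw [map_sum]
  refine Finset.sum_congr rfl fun t _ => ?_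
  rw [← residueSection_X_pow_mul_expand hs, map_mul (expand 5 _), pow_add]
  congr 1
  ring

/-! ### The dissection of the reciprocal of `E 1` -/

/-- The polynomial `(a ^ 10 - 11 a ^ 5 u ^ 5 - u ^ 10) / (a ^ 2 - a u - u ^ 2)`. At `a = dissectA (q ^ 5)`
and `u = q * E 5 (q ^ 5)`, its denominator is `dissectA * E 1` and its numerator is a series
in `q ^ 5`. -/
def cofactorForm {R : Type*} [CommRing R] (a u : R) : R :=
  a ^ 8 + a ^ 7 * u + 2 * a ^ 6 * u ^ 2 + 3 * a ^ 5 * u ^ 3 + 5 * a ^ 4 * u ^ 4 -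
    3 * a ^ 3 * u ^ 5 + 2 * a ^ 2 * u ^ 6 - a * u ^ 7 + u ^ 8

theorem mul_cofactorForm {R : Type*} [CommRing R] (a u : R) :
    (a ^ 2 - a * u - u ^ 2) * cofactorForm a u = a ^ 10 - 11 * a ^ 5 * u ^ 5 - u ^ 10 := by
  rw [cofactorForm]
  ring

theorem dissectA_ne_zero : dissectA ≠ 0 := fun h =>
  pow_ne_zero 2 (E_ne_zero (by norm_num : 0 < 5)) (by rw [← dissectA_mul_dissectB, h, zero_mul])

/-- The cofactor which turns `E 1` into a series in `q ^ 5`. -/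
theorem E_one_mul_cofactorForm :
    E 1 * (cofactorForm (expand 5 (by norm_num) dissectA) (X * expand 5 (by norm_num) (E 5)) *
      expand 5 (by norm_num) (E 5)) = expand 5 (by norm_num) (dissectA ^ 4 * E 1 ^ 6) := by
  set a := expand 5 (by norm_num) dissectA with ha
  set e := expand 5 (by norm_num) (E 5) with he
  set b := expand 5 (by norm_num) dissectB with hb
  have ha0 : a ≠ 0 := by
    intro h
    refine dissectA_ne_zero ?_
    ext n
    simpa using congrArg (coeff (5 * n)) (ha.symm.trans h)
  have hab : a * b = e ^ 2 := by
    rw [ha, hb, he, ← map_mul, dissectA_mul_dissectB, map_pow]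
  have h1 : E 1 = a - X * e - X ^ 2 * b := E_one_eq_dissection
  have h2 : e * (a ^ 5 - 11 * X ^ 5 * e ^ 5 - X ^ 10 * b ^ 5) =
      expand 5 (by norm_num) (E 1 ^ 6) := by
    rw [← E_five_mul_quintic]
    simp only [map_mul, map_sub, map_pow, expand_X, map_ofNat, ← ha, ← hb, ← he]
    ring
  have h3 := mul_cofactorForm a (X * e)
  have hab5 : a ^ 5 * b ^ 5 = e ^ 10 := by rw [← mul_pow, hab]; ring
  apply mul_left_cancel₀ ha0
  rw [map_mul, ← h2, map_pow, ← ha]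
  rw [show a * (E 1 * (cofactorForm a (X * e) * e)) =
    (a * E 1) * cofactorForm a (X * e) * e by ring, h1,
    show a * (a - X * e - X ^ 2 * b) = a ^ 2 - a * (X * e) - (X * e) ^ 2 by
      linear_combination -X ^ 2 * hab, h3]
  linear_combination X ^ 10 * e * hab5

/-! ### The dissection of powers of the cofactor -/

/-- The part of `cofactorForm a (x * e)` in which the exponent of `x` is congruent
to the last argument modulo `5`, divided by the corresponding power of `x`, with `x ^ 5` replaced
by `x`. -/
def cofactorPart {R : Type*} [CommRing R] (x a e : R) : ℕ → R
  | 0 =>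
      a ^ 8 - 3 * x * a ^ 3 * e ^ 5
  | 1 =>
      a ^ 7 * e + 2 * x * a ^ 2 * e ^ 6
  | 2 =>
      2 * a ^ 6 * e ^ 2 - x * a * e ^ 7
  | 3 =>
      3 * a ^ 5 * e ^ 3 + x * e ^ 8
  | 4 =>
      5 * a ^ 4 * e ^ 4
  | _ => 0

/-- The part of the square of `cofactorForm a (x * e)` in which the exponent of `x` is congruent
to the last argument modulo `5`, divided by the corresponding power of `x`, with `x ^ 5` replaced
by `x`. -/
def cofactorSqPart {R : Type*} [CommRing R] (x a e : R) : ℕ → R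
  | 0 =>
      a ^ 16 + 16 * x * a ^ 11 * e ^ 5 + 27 * x ^ 2 * a ^ 6 * e ^ 10 - 2 * x ^ 3 * a * e ^ 15
  | 1 =>
      2 * a ^ 15 * e + 27 * x * a ^ 10 * e ^ 6 - 16 * x ^ 2 * a ^ 5 * e ^ 11 + x ^ 3 * e ^ 16
  | 2 =>
      5 * a ^ 14 * e ^ 2 + 20 * x * a ^ 9 * e ^ 7 + 20 * x ^ 2 * a ^ 4 * e ^ 12
  | 3 =>
      10 * a ^ 13 * e ^ 3 + 15 * x * a ^ 8 * e ^ 8 - 10 * x ^ 2 * a ^ 3 * e ^ 13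
  | 4 =>
      20 * a ^ 12 * e ^ 4 - 20 * x * a ^ 7 * e ^ 9 + 5 * x ^ 2 * a ^ 2 * e ^ 14
  | _ => 0

/-- The part of the cube of `cofactorForm a (x * e)` in which the exponent of `x` is congruent
to the last argument modulo `5`, divided by the corresponding power of `x`, with `x ^ 5` replaced
by `x`. -/
def cofactorCubePart {R : Type*} [CommRing R] (x a e : R) : ℕ → R
  | 0 =>
      a ^ 24 + 78 * x * a ^ 19 * e ^ 5 + 219 * x ^ 2 * a ^ 14 * e ^ 10 -
      153 * x ^ 3 * a ^ 9 * e ^ 15 + 51 * x ^ 4 * a ^ 4 * e ^ 20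
  | 1 =>
      3 * a ^ 23 * e + 134 * x * a ^ 18 * e ^ 6 + 57 * x ^ 2 * a ^ 13 * e ^ 11 +
      216 * x ^ 3 * a ^ 8 * e ^ 16 - 22 * x ^ 4 * a ^ 3 * e ^ 21
  | 2 =>
      9 * a ^ 22 * e ^ 2 + 177 * x * a ^ 17 * e ^ 7 + 71 * x ^ 2 * a ^ 12 * e ^ 12 -
      177 * x ^ 3 * a ^ 7 * e ^ 17 + 9 * x ^ 4 * a ^ 2 * e ^ 22
  | 3 =>
      22 * a ^ 21 * e ^ 3 + 216 * x * a ^ 16 * e ^ 8 - 57 * x ^ 2 * a ^ 11 * e ^ 13 +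
      134 * x ^ 3 * a ^ 6 * e ^ 18 - 3 * x ^ 4 * a * e ^ 23
  | 4 =>
      51 * a ^ 20 * e ^ 4 + 153 * x * a ^ 15 * e ^ 9 + 219 * x ^ 2 * a ^ 10 * e ^ 14 -
      78 * x ^ 3 * a ^ 5 * e ^ 19 + x ^ 4 * e ^ 24
  | _ => 0

theorem cofactorForm_eq_sum {R : Type*} [CommRing R] (x a e : R) :
    cofactorForm a (x * e) = ∑ r ∈ Finset.range 5, x ^ r * cofactorPart (x ^ 5) a e r := by
  simp only [cofactorForm, cofactorPart, Finset.sum_range_succ, Finset.sum_range_zero]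
  ring

theorem map_cofactorPart {R S : Type*} [CommRing R] [CommRing S] (φ : R →+* S) (x a e : R)
    (r : ℕ) : φ (cofactorPart x a e r) = cofactorPart (φ x) (φ a) (φ e) r := by
  unfold cofactorPart
  split <;> simp [map_ofNat]

theorem cofactorForm_sq_eq_sum {R : Type*} [CommRing R] (x a e : R) :
    cofactorForm a (x * e) ^ 2 = ∑ r ∈ Finset.range 5, x ^ r * cofactorSqPart (x ^ 5) a e r := by
  simp only [cofactorForm, cofactorSqPart, Finset.sum_range_succ, Finset.sum_range_zero]
  ring

theorem map_cofactorSqPart {R S : Type*} [CommRing R] [CommRing S] (φ : R →+* S) (x a e : R)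
    (r : ℕ) : φ (cofactorSqPart x a e r) = cofactorSqPart (φ x) (φ a) (φ e) r := by
  unfold cofactorSqPart
  split <;> simp [map_ofNat]

theorem cofactorForm_cube_eq_sum {R : Type*} [CommRing R] (x a e : R) :
    cofactorForm a (x * e) ^ 3 = ∑ r ∈ Finset.range 5, x ^ r * cofactorCubePart (x ^ 5) a e r := by
  simp only [cofactorForm, cofactorCubePart, Finset.sum_range_succ, Finset.sum_range_zero]
  ring

theorem map_cofactorCubePart {R S : Type*} [CommRing R] [CommRing S] (φ : R →+* S) (x a e : R)
    (r : ℕ) : φ (cofactorCubePart x a e r) = cofactorCubePart (φ x) (φ a) (φ e) r := by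
  unfold cofactorCubePart
  split <;> simp [map_ofNat]

/-- The sections of the generating function, in terms of a dissection of the `k`-th power of the
cofactor of `E 1`. -/
theorem coloredSection_eq_of_dissection {k : ℕ} (hk : k < 5) {f : ℕ → ℚ⟦X⟧}
    (hf : cofactorForm (expand 5 (by norm_num) dissectA) (X * expand 5 (by norm_num) (E 5)) ^ k =
      ∑ r ∈ Finset.range 5, X ^ r * expand 5 (by norm_num) (f r)) :
    coloredSection k k * (dissectA ^ 4 * E 1 ^ 6 *
        (expand 3 (by norm_num) dissectA ^ 4 * E 3 ^ 6)) ^ k =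
      (∑ r ∈ Finset.range 5, ∑ t ∈ Finset.range 5, if (r + 3 * t) % 5 = k then
        X ^ ((r + 3 * t) / 5) * (f r * expand 3 (by norm_num) (f t)) else 0) *
        (E 5 * E 15) ^ k := by
  set F : ℚ⟦X⟧ := mk fun n => (coloredPartitionCount k 3 n : ℚ) with hF
  set P := cofactorForm (expand 5 (by norm_num) dissectA) (X * expand 5 (by norm_num) (E 5))
  have hcs : coloredSection k k = residueSection k F := by
    ext n
    rw [coeff_residueSection, hF, coeff_mk, coloredSection, coeff_mk]
  have hE3 : expand 3 (by norm_num) (E 1) = E 3 :=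
    expand_E (p := 3) (n := 1) (by norm_num) (by norm_num)
  have hE15 : expand 3 (by norm_num) (E 5) = E 15 :=
    expand_E (p := 3) (n := 5) (by norm_num) (by norm_num)
  have hcomm : ∀ g : ℚ⟦X⟧, expand 3 (by norm_num) (expand 5 (by norm_num) g) =
      expand 5 (by norm_num) (expand 3 (by norm_num) g) := fun g => by
    rw [← expand_mul, ← expand_mul]
  have h1 : E 1 * (P * expand 5 (by norm_num) (E 5)) =
      expand 5 (by norm_num) (dissectA ^ 4 * E 1 ^ 6) := E_one_mul_cofactorForm
  have h3 : E 3 * (expand 3 (by norm_num) P * expand 5 (by norm_num) (E 15)) =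
      expand 5 (by norm_num) (expand 3 (by norm_num) dissectA ^ 4 * E 3 ^ 6) := by
    rw [← hE3, ← hE15, ← hcomm, ← map_mul, ← map_mul, h1, hcomm]
    simp only [map_mul, map_pow]
  have hf3 : expand 3 (by norm_num) P ^ k =
      ∑ t ∈ Finset.range 5, X ^ (3 * t) *
        expand 5 (by norm_num) (expand 3 (by norm_num) (f t)) := by
    rw [← map_pow, hf, map_sum]
    refine Finset.sum_congr rfl fun t _ => ?_
    rw [map_mul, hcomm, map_pow, expand_X, pow_mul]
  have hgen : F * (E 1 ^ k * E 3 ^ k) = 1 := mk_coloredPartitionCount_mul k (by norm_num)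
  rw [hcs, ← residueSection_mul_expand hk, ← residueSection_sum_mul_sum hk,
    ← residueSection_mul_expand hk, ← hf, ← hf3]
  congr 1
  rw [map_pow, map_mul, ← h1, ← h3, map_pow, map_mul]
  simp only [mul_pow]
  linear_combination (P ^ k * expand 3 (by norm_num) P ^ k * expand 5 (by norm_num) (E 5) ^ k *
    expand 5 (by norm_num) (E 15) ^ k) * hgen

/-! ### Two functions on a curve -/

/-- The consequences for the functions `x = F ^ 2 G / q` and `y = G ^ 2 / (F q)` of the relations
between the theta series. -/
theorem curve_of_theta_relations {L : Type*} [Field L] {z t1 t2 t3 t4 t5 t6 t7 : L}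
    (hz : z ≠ 0) (h1 : t1 ≠ 0) (h3 : t3 ≠ 0) (h4 : t4 ≠ 0) (h5 : t5 ≠ 0)
    (h6 : t6 ≠ 0) {F G x y : L} (hF : F * (t1 * t4 * t6) = t2 * t3 * t7)
    (hG : G * t3 = t6) (hx : x * z = F ^ 2 * G) (hy : y * (F * z) = G ^ 2)
    (hA : t7 + z * t2 = t5 * F) (hC : (t4 - z * t1) * F = t5)
    (r1 : z * (t3 * t1 * t4) = t2 * t4 * t6 - t1 * t6 * t7)
    (r2 : z ^ 2 * (t1 * t2 * t3) = t3 * t4 * t7 - t2 * t6 * t7) :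
    x ^ 2 * y - x * y ^ 2 - 3 * x * y + x - y = 0 ∧
      t5 ^ 4 * (x * y) = z ^ 2 * (t1 * t2 * t4 * t7) * (x * y + 1) ^ 2 := by
  have hF0 : F ≠ 0 := by
    rintro rfl
    exact h5 (by simpa using hC.symm)
  have hG0 : G ≠ 0 := by
    rintro rfl
    exact h6 (by simpa using hG.symm)
  obtain rfl : x = F ^ 2 * G / z := by rw [eq_div_iff hz, hx]
  obtain rfl : y = G ^ 2 / (F * z) := by rw [eq_div_iff (mul_ne_zero hF0 hz), hy]
  -- `n` and `F * G * n` are the products of the two theta series in `hC` and in `hA`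
  set n := z * (t1 * t4) with hn
  have hn0 : n ≠ 0 := mul_ne_zero hz (mul_ne_zero h1 h4)
  have hm : z * (t2 * t7) = F * G * n := by
    apply mul_left_cancel₀ h3
    rw [hn]
    linear_combination -z * hF - (F * z * t1 * t4) * hG
  have r1' : n = G * (t2 * t4 - t1 * t7) := by
    apply mul_left_cancel₀ h3
    rw [hn]
    linear_combination r1 - (t2 * t4 - t1 * t7) * hG
  have r2' : z ^ 2 * (t1 * t2) = t4 * t7 - t2 * t7 * G := by
    apply mul_left_cancel₀ h3
    linear_combination r2 + t2 * t7 * hG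
  have hs : t5 ^ 2 * (z * G) = n * (F * G ^ 3 + z ^ 2) := by
    have : t5 ^ 2 = (t7 + z * t2) * (t4 - z * t1) := by
      rw [hA]
      linear_combination -t5 * hC
    rw [this]
    linear_combination -z ^ 2 * r1' - z * G * r2' + G ^ 2 * hm
  have hP : (t5 * F) ^ 2 * n * F ^ 2 - t5 ^ 2 * (F * G * n) = 3 * (F * G * n) * n * F ^ 2 := by
    -- this is the product of `r1'` and `r2'`, in which `G` cancels
    have hprod : (t7 + z * t2) ^ 2 * n - (t4 - z * t1) ^ 2 * (z * (t2 * t7)) =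
        3 * (z * (t2 * t7)) * n := by
      have hmn : t2 * t7 * n = (t4 * t7 - z ^ 2 * (t1 * t2)) * (t2 * t4 - t1 * t7) := by
        linear_combination t2 * t7 * r1' + (t2 * t4 - t1 * t7) * r2'
      rw [hn] at hmn ⊢
      linear_combination z * hmn
    rw [← hm, ← hC, mul_pow (t4 - z * t1), hC, ← hA]
    linear_combination F ^ 2 * hprod
  have key : (F * G ^ 3 + z ^ 2) * (F ^ 3 - G) = 3 * F ^ 2 * G ^ 2 * z := by
    apply mul_left_cancel₀ (mul_ne_zero (pow_ne_zero 2 hn0) hF0)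
    linear_combination (-n * F * (F ^ 3 - G)) * hs + z * G * hP
  constructor
  · field_simp
    linear_combination G * key
  · have : z ^ 2 * (t1 * t2 * t4 * t7) = F * G * n ^ 2 := by
      rw [hn] at hm ⊢
      linear_combination z * t1 * t4 * hm
    rw [this]
    field_simp
    linear_combination (t5 ^ 2 * z * G + n * (F * G ^ 3 + z ^ 2)) * hs

theorem X_ne_zero_and_E_ne_zero {L : Type*} [Field L] {ι : ℚ⟦X⟧ →+* L}
    (hι : Function.Injective ι) : ι X ≠ 0 ∧ ι (E 1) ≠ 0 ∧ ι (E 3) ≠ 0 ∧ ι (E 5) ≠ 0 ∧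
      ι (E 15) ≠ 0 := by
  have h : ∀ f, f ≠ 0 → ι f ≠ 0 := fun f hf h0 => hf (hι (by rw [h0, map_zero]))
  exact ⟨h _ X_ne_zero, h _ (E_ne_zero (by norm_num)), h _ (E_ne_zero (by norm_num)),
    h _ (E_ne_zero (by norm_num)), h _ (E_ne_zero (by norm_num))⟩

/-- The point `(x, y)` of the curve `x - 1 / x = y - 1 / y + 3` given by the dissections of `E 1`
and `E 3`, and the eta quotients in the theorem as functions of `x` and `y`. -/
theorem exists_point_on_curve {L : Type*} [Field L] [CharZero L] {ι : ℚ⟦X⟧ →+* L}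
    (hι : Function.Injective ι) : ∃ F G x y : L, F ≠ 0 ∧ x ≠ 0 ∧ y ≠ 0 ∧
      ι dissectA = F * ι (E 5) ∧ ι (expand 3 (by norm_num) dissectA) = G * ι (E 15) ∧
      x * G = y * F ^ 3 ∧ x ^ 2 * ι X = y * F ^ 5 ∧
      x ^ 2 * y - x * y ^ 2 - 3 * x * y + x - y = 0 ∧
      ι (E 1) ^ 6 / (ι X * ι (E 5) ^ 6) * (x ^ 2 * y) = x ^ 4 - 11 * x ^ 2 * y - y ^ 2 ∧
      ι (E 3) ^ 6 / (ι X ^ 3 * ι (E 15) ^ 6) * (x * y ^ 2) =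
        x ^ 2 * y ^ 4 - 11 * x * y ^ 2 - 1 ∧
      ι (E 5) ^ 5 * ι (E 3) / (ι X ^ 2 * ι (E 1) * ι (E 15) ^ 5) * (x * y) = (x * y + 1) ^ 2 ∧
      ι X ^ 2 * ι (E 1) * ι (E 15) ^ 5 / (ι (E 5) ^ 5 * ι (E 3)) * (x * y) =
        (x - y) ^ 2 / 9 := by
  obtain ⟨hz, he1, he3, he5, he15⟩ := X_ne_zero_and_E_ne_zero hι
  have hne : ∀ f, f ≠ 0 → ι f ≠ 0 := fun f hf h0 => hf (hι (by rw [h0, map_zero]))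
  have ht : ∀ i, 0 < i → i < 15 → ι (thetaSeries 15 i) ≠ 0 := fun i h1 h2 =>
    hne _ (thetaSeries_ne_zero h1 h2)
  have ha0 : ι dissectA ≠ 0 := hne _ dissectA_ne_zero
  have hA30 : ι (expand 3 (by norm_num) dissectA) ≠ 0 := by
    refine hne _ fun h => dissectA_ne_zero ?_
    ext n
    simpa using congrArg (coeff (3 * n)) h
  have hF0 : ι dissectA / ι (E 5) ≠ 0 := div_ne_zero ha0 he5
  have hG0 : ι (expand 3 (by norm_num) dissectA) / ι (E 15) ≠ 0 := div_ne_zero hA30 he15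
  -- the quintic relation for `E 1 / E 5`
  have hquint : ∀ (φ : ℚ⟦X⟧ →+* L) (e1 e5 a : L), e1 = φ (E 1) → e5 = φ (E 5) →
      a = φ dissectA → e1 ^ 6 * a ^ 5 = e5 *
        (a ^ 10 - 11 * φ X * e5 ^ 5 * a ^ 5 - φ X ^ 2 * e5 ^ 10) := by
    rintro φ e1 e5 a rfl rfl rfl
    have h1 := congrArg φ E_five_mul_quintic
    have h2 := congrArg φ dissectA_mul_dissectB
    simp only [map_mul, map_sub, map_pow, map_ofNat] at h1 h2
    have h3 : φ dissectA ^ 5 * φ dissectB ^ 5 = φ (E 5) ^ 10 := by rw [← mul_pow, h2]; ring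
    linear_combination -φ dissectA ^ 5 * h1 - φ (E 5) * φ X ^ 2 * h3
  have hE3 : expand 3 (by norm_num) (E 1) = E 3 :=
    expand_E (p := 3) (n := 1) (by norm_num) (by norm_num)
  have hE15 : expand 3 (by norm_num) (E 5) = E 15 :=
    expand_E (p := 3) (n := 5) (by norm_num) (by norm_num)
  have hq1 := hquint ι _ _ _ rfl rfl rfl
  have hq3 := hquint (ι.comp (expand 3 (by norm_num) : ℚ⟦X⟧ →ₐ[ℚ] ℚ⟦X⟧).toRingHom)
    (ι (E 3)) (ι (E 15)) (ι (expand 3 (by norm_num) dissectA)) (by rw [← hE3]; rfl)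
    (by rw [← hE15]; rfl) rfl
  have hX3 : (ι.comp (expand 3 (by norm_num) : ℚ⟦X⟧ →ₐ[ℚ] ℚ⟦X⟧).toRingHom) X = ι X ^ 3 := by
    simp
  rw [hX3] at hq3
  have hE5 := congrArg ι E_five_eq_thetaSeries
  have hprod3 := congrArg ι E_three_mul_E_fifteen
  have hprod1 := congrArg ι E_one_mul_E_fifteen_pow
  simp only [map_mul, map_pow] at hprod3 hprod1
  have hcurve := curve_of_theta_relations (z := ι X) (t1 := ι (thetaSeries 15 1))
    (t2 := ι (thetaSeries 15 2)) (t3 := ι (thetaSeries 15 3)) (t4 := ι (thetaSeries 15 4))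
    (t5 := ι (thetaSeries 15 5)) (t6 := ι (thetaSeries 15 6)) (t7 := ι (thetaSeries 15 7))
    (F := ι dissectA / ι (E 5)) (G := ι (expand 3 (by norm_num) dissectA) / ι (E 15))
    (x := (ι dissectA / ι (E 5)) ^ 2 * (ι (expand 3 (by norm_num) dissectA) / ι (E 15)) / ι X)
    (y := (ι (expand 3 (by norm_num) dissectA) / ι (E 15)) ^ 2 / (ι dissectA / ι (E 5) * ι X))
    hz (ht 1 (by norm_num) (by norm_num)) (ht 3 (by norm_num) (by norm_num))
    (ht 4 (by norm_num) (by norm_num)) (ht 5 (by norm_num) (by norm_num))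
    (ht 6 (by norm_num) (by norm_num))
    (by
      have h := congrArg ι dissectA_mul_thetaSeries
      simp only [map_mul, ← hE5] at h
      rw [div_mul_eq_mul_div, div_eq_iff he5, h]
      ring)
    (by
      have h := congrArg ι expand_three_dissectA
      simp only [map_mul] at h
      rw [div_mul_eq_mul_div, div_eq_iff he15, h]
      ring)
    (by field_simp) (by field_simp)
    (by
      rw [← hE5, mul_div_cancel₀ _ he5, dissectA]
      simp)
    (by
      have h : ι (thetaSeries 15 4) - ι X * ι (thetaSeries 15 1) = ι dissectB := by
        rw [dissectB]
        simp
      have h2 := congrArg ι dissectA_mul_dissectB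
      simp only [map_mul, map_pow] at h2
      rw [h, ← hE5, mul_div_assoc', div_eq_iff he5]
      linear_combination h2)
    (by simpa using congrArg ι thetaSeries_relation_one)
    (by simpa using congrArg ι thetaSeries_relation_two)
  obtain ⟨F, hF⟩ : ∃ F, F = ι dissectA / ι (E 5) := ⟨_, rfl⟩
  obtain ⟨G, hG⟩ : ∃ G, G = ι (expand 3 (by norm_num) dissectA) / ι (E 15) := ⟨_, rfl⟩
  rw [← hF] at hF0 hcurve
  rw [← hG] at hG0 hcurve
  have haF : ι dissectA = F * ι (E 5) := by rw [hF, div_mul_cancel₀ _ he5]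
  have haG : ι (expand 3 (by norm_num) dissectA) = G * ι (E 15) := by
    rw [hG, div_mul_cancel₀ _ he15]
  rw [haF] at hq1
  rw [haG] at hq3
  have ht3 := ht 3 (by norm_num) (by norm_num)
  have ht6 := ht 6 (by norm_num) (by norm_num)
  obtain ⟨hφ, hS⟩ := hcurve
  generalize ι X = z at *
  generalize ι (E 1) = e1 at *
  generalize ι (E 3) = e3 at *
  generalize ι (E 5) = e5 at *
  generalize ι (E 15) = e15 at *
  have hx0 : F ^ 2 * G / z ≠ 0 := by positivity
  have hy0 : G ^ 2 / (F * z) ≠ 0 := by positivity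
  have hs : e5 ^ 5 * e3 / (z ^ 2 * e1 * e15 ^ 5) * (F ^ 2 * G / z * (G ^ 2 / (F * z))) =
      (F ^ 2 * G / z * (G ^ 2 / (F * z)) + 1) ^ 2 := by
    rw [div_mul_eq_mul_div, div_eq_iff (by positivity)]
    apply mul_left_cancel₀ he15
    rw [← hE5] at hS hprod1
    linear_combination (e3 * e15 * e5) * hS +
      (z ^ 2 * (ι (thetaSeries 15 1) * ι (thetaSeries 15 2) * ι (thetaSeries 15 4) *
        ι (thetaSeries 15 7)) * (F ^ 2 * G / z * (G ^ 2 / (F * z)) + 1) ^ 2 * e5) * hprod3 -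
      ((F ^ 2 * G / z * (G ^ 2 / (F * z)) + 1) ^ 2 * z ^ 2) * hprod1
  refine ⟨F, G, F ^ 2 * G / z, G ^ 2 / (F * z), hF0, hx0, hy0, haF, haG, ?_, ?_, hφ, ?_, ?_, hs, ?_⟩
  · field_simp
  · field_simp
  · have key : e1 ^ 6 * F ^ 5 = e5 ^ 6 * (F ^ 10 - 11 * z * F ^ 5 - z ^ 2) := by
      apply mul_left_cancel₀ (pow_ne_zero 5 he5)
      linear_combination hq1
    field_simp
    linear_combination key
  · have key : e3 ^ 6 * G ^ 5 = e15 ^ 6 * (G ^ 10 - 11 * z ^ 3 * G ^ 5 - z ^ 6) := by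
      apply mul_left_cancel₀ (pow_ne_zero 5 he15)
      linear_combination hq3
    field_simp
    linear_combination key
  · generalize F ^ 2 * G / z = x at *
    generalize G ^ 2 / (F * z) = y at *
    have hd : e5 ^ 5 * e3 ≠ 0 := by positivity
    have h1 : (x - y) * (x * y + 1) = 3 * (x * y) := by linear_combination hφ
    have h2 : (x * y + 1) ^ 2 ≠ 0 := pow_ne_zero 2 fun h => by
      rw [h, mul_zero] at h1
      exact mul_ne_zero three_ne_zero (mul_ne_zero hx0 hy0) h1.symm
    have h3 : e5 ^ 5 * e3 / (z ^ 2 * e1 * e15 ^ 5) *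
        (z ^ 2 * e1 * e15 ^ 5 / (e5 ^ 5 * e3)) = 1 := by
      field_simp
    apply mul_left_cancel₀ h2
    rw [← hs]
    linear_combination (x * y) ^ 2 * h3 - (x - y) ^ 2 / 9 * hs -
      ((x - y) * (x * y + 1) + 3 * (x * y)) / 9 * h1

/-! ### The three identities as identities of functions on the curve -/

theorem eval_monomial {L : Type*} [Field L] {x y t1 t3 s T1 T3 S : L} (h1 : t1 * (x ^ 2 * y) = T1)
    (h3 : t3 * (x * y ^ 2) = T3) (hs : s * (x * y) = S) (i j l a b : ℕ) :
    t1 ^ i * t3 ^ j * s ^ l * (x ^ (2 * i + j + l + a) * y ^ (i + 2 * j + l + b)) =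
      T1 ^ i * T3 ^ j * S ^ l * (x ^ a * y ^ b) := by
  rw [← h1, ← h3, ← hs]
  ring

/-- The identity for `k = 1`, with `z`, `e1`, `e3`, `e5`, `e15` for `q`, `E 1`, `E 3`, `E 5`,
`E 15`. -/
theorem coloredSection_one_eq {L : Type*} [Field L] [CharZero L] {z e1 e3 e5 e15 F G x y cs : L}
    (hz : z ≠ 0) (he1 : e1 ≠ 0) (he3 : e3 ≠ 0) (he5 : e5 ≠ 0) (he15 : e15 ≠ 0) (hF : F ≠ 0)
    (hx : x ≠ 0) (hy : y ≠ 0) (hG : x * G = y * F ^ 3) (hxz : x ^ 2 * z = y * F ^ 5)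
    (hφ : x ^ 2 * y - x * y ^ 2 - 3 * x * y + x - y = 0)
    (h1 : e1 ^ 6 / (z * e5 ^ 6) * (x ^ 2 * y) = x ^ 4 - 11 * x ^ 2 * y - y ^ 2)
    (h3 : e3 ^ 6 / (z ^ 3 * e15 ^ 6) * (x * y ^ 2) = x ^ 2 * y ^ 4 - 11 * x * y ^ 2 - 1)
    (hs : e5 ^ 5 * e3 / (z ^ 2 * e1 * e15 ^ 5) * (x * y) = (x * y + 1) ^ 2)
    (hs' : z ^ 2 * e1 * e15 ^ 5 / (e5 ^ 5 * e3) * (x * y) = (x - y) ^ 2 / 9)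
    (hcs : cs * ((F * e5) ^ 4 * e1 ^ 6 * ((G * e15) ^ 4 * e3 ^ 6)) ^ 1 =
      (∑ r ∈ Finset.range 5, ∑ t ∈ Finset.range 5, if (r + 3 * t) % 5 = 1 then
        z ^ ((r + 3 * t) / 5) * (cofactorPart z (F * e5) e5 r *
          cofactorPart (z ^ 3) (G * e15) e15 t)
        else 0) * (e5 * e15) ^ 1) :
    cs =
      (e5 ^ 5 / (e1 ^ 6 * e15)) + 10 * z * (e5 ^ 10 / (e1 ^ 7 * e3 ^ 5)) +
      z ^ 2 * (e15 ^ 5 / (e3 ^ 6 * e5)) + 45 * z ^ 3 * (e5 ^ 5 * e15 ^ 5 / (e1 ^ 6 * e3 ^ 6)) -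
      90 * z ^ 5 * (e15 ^ 10 / (e1 ^ 5 * e3 ^ 7)) := by
  obtain ⟨t1, ht1⟩ : ∃ t, t = e1 ^ 6 / (z * e5 ^ 6) := ⟨_, rfl⟩
  obtain ⟨t3, ht3⟩ : ∃ t, t = e3 ^ 6 / (z ^ 3 * e15 ^ 6) := ⟨_, rfl⟩
  obtain ⟨s, hs0⟩ : ∃ t, t = e5 ^ 5 * e3 / (z ^ 2 * e1 * e15 ^ 5) := ⟨_, rfl⟩
  obtain ⟨s', hs0'⟩ : ∃ t, t = z ^ 2 * e1 * e15 ^ 5 / (e5 ^ 5 * e3) := ⟨_, rfl⟩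
  obtain ⟨W, hW⟩ : ∃ t, t = (e5 ^ 5 * e15 ^ 5 / (e1 ^ 6 * e3 ^ 6)) * z ^ 3 := ⟨_, rfl⟩
  obtain ⟨P, hP⟩ : ∃ P, P =
      x * (x ^ 2 - 3 * y) * (2 * x * y ^ 2 - 1) +
      x * y * (x ^ 2 + 2 * y) * (x * y ^ 2 - 3) +
      (2 * x ^ 2 - y) * (3 * x * y ^ 2 + 1) +
      y * (3 * x ^ 2 + y) * (x * y ^ 2 + 2) +
      x ^ 2 * y ^ 2 * 5 ^ 2 := ⟨_, rfl⟩
  -- the dissection is homogeneous in `F`, so that its terms are monomials in `x` and `y`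
  have hsec : cs * (x ^ 2 * y ^ 2) = W * P := by
    obtain rfl : G = y * F ^ 3 / x := by rw [eq_div_iff hx, ← hG, mul_comm]
    obtain rfl : z = y * F ^ 5 / x ^ 2 := by rw [eq_div_iff (pow_ne_zero 2 hx), ← hxz, mul_comm]
    have hN : ((F * e5) ^ 4 * e1 ^ 6 * ((y * F ^ 3 / x * e15) ^ 4 * e3 ^ 6)) ^ 1 ≠ 0 := by
      positivity
    rw [eq_div_of_mul_eq hN hcs, hW, hP]
    simp [Finset.sum_range_succ, cofactorPart]
    field_simp
  -- each eta quotient is a monomial in `t1`, `t3` and `s` or `s' = 1 / s`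
  have m1 : (e5 ^ 5 / (e1 ^ 6 * e15)) = W * t3 := by
    rw [hW, ht3]
    field_simp
  have m2 : z * (e5 ^ 10 / (e1 ^ 7 * e3 ^ 5)) = W * s := by
    rw [hW, hs0]
    field_simp
  have m3 : z ^ 2 * (e15 ^ 5 / (e3 ^ 6 * e5)) = W * t1 := by
    rw [hW, ht1]
    field_simp
  have m4 : z ^ 3 * (e5 ^ 5 * e15 ^ 5 / (e1 ^ 6 * e3 ^ 6)) = W * 1 := by
    rw [hW]
    field_simp
  have m5 : z ^ 5 * (e15 ^ 10 / (e1 ^ 5 * e3 ^ 7)) = W * s' := by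
    rw [hW, hs0']
    field_simp
  rw [← ht1] at h1
  rw [← ht3] at h3
  rw [← hs0] at hs
  rw [← hs0'] at hs'
  -- both sides are polynomials in `x` and `y`, equal modulo the equation of the curve
  have hpoly : (
      t3 + 10 * s + t1 + 45 - 90 * s') *
      (x ^ 2 * y ^ 2) = P := by
    rw [hP]
    -- the coefficient of `hφ` is a quotient by long division in `x`
    linear_combination
      eval_monomial h1 h3 hs 0 1 0 1 0 + 10 * eval_monomial h1 h3 hs 0 0 1 1 1 +
      eval_monomial h1 h3 hs 1 0 0 0 1 + 45 * eval_monomial h1 h3 hs 0 0 0 2 2 -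
      90 * eval_monomial h1 h3 hs' 0 0 1 1 1 +
      (
        -x ^ 2 * y ^ 2 - 2 * x ^ 2 * y + x ^ 2 + 2 * x * y ^ 2 - 10 * x * y - 2 * x + y ^ 2 +
        2 * y - 1) * hφ
  refine mul_right_cancel₀ (mul_ne_zero (pow_ne_zero 2 hx) (pow_ne_zero 2 hy)) ?_
  rw [hsec, ← hpoly, ← mul_assoc]
  congr 1
  symm
  linear_combination
    m1 + 10 * m2 + m3 + 45 * m4 - 90 * m5

/-- The identity for `k = 2`, with `z`, `e1`, `e3`, `e5`, `e15` for `q`, `E 1`, `E 3`, `E 5`,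
`E 15`. -/
theorem coloredSection_two_eq {L : Type*} [Field L] [CharZero L] {z e1 e3 e5 e15 F G x y cs : L}
    (hz : z ≠ 0) (he1 : e1 ≠ 0) (he3 : e3 ≠ 0) (he5 : e5 ≠ 0) (he15 : e15 ≠ 0) (hF : F ≠ 0)
    (hx : x ≠ 0) (hy : y ≠ 0) (hG : x * G = y * F ^ 3) (hxz : x ^ 2 * z = y * F ^ 5)
    (hφ : x ^ 2 * y - x * y ^ 2 - 3 * x * y + x - y = 0)
    (h1 : e1 ^ 6 / (z * e5 ^ 6) * (x ^ 2 * y) = x ^ 4 - 11 * x ^ 2 * y - y ^ 2)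
    (h3 : e3 ^ 6 / (z ^ 3 * e15 ^ 6) * (x * y ^ 2) = x ^ 2 * y ^ 4 - 11 * x * y ^ 2 - 1)
    (hs : e5 ^ 5 * e3 / (z ^ 2 * e1 * e15 ^ 5) * (x * y) = (x * y + 1) ^ 2)
    (hs' : z ^ 2 * e1 * e15 ^ 5 / (e5 ^ 5 * e3) * (x * y) = (x - y) ^ 2 / 9)
    (hcs : cs * ((F * e5) ^ 4 * e1 ^ 6 * ((G * e15) ^ 4 * e3 ^ 6)) ^ 2 =
      (∑ r ∈ Finset.range 5, ∑ t ∈ Finset.range 5, if (r + 3 * t) % 5 = 2 then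
        z ^ ((r + 3 * t) / 5) * (cofactorSqPart z (F * e5) e5 r *
          cofactorSqPart (z ^ 3) (G * e15) e15 t)
        else 0) * (e5 * e15) ^ 2) :
    cs =
      5 * (
        (e5 ^ 10 / (e1 ^ 12 * e15 ^ 2)) + 20 * z * (e5 ^ 15 / (e1 ^ 13 * e3 ^ 5 * e15)) +
        80 * z ^ 2 * (e5 ^ 20 / (e1 ^ 14 * e3 ^ 10)) +
        12 * z ^ 2 * (e5 ^ 4 * e15 ^ 4 / (e1 ^ 6 * e3 ^ 6)) +
        306 * z ^ 3 * (e5 ^ 10 * e15 ^ 4 / (e1 ^ 12 * e3 ^ 6)) -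
        36 * z ^ 3 * (e5 ^ 9 * e15 ^ 5 / (e1 ^ 7 * e3 ^ 11)) +
        z ^ 4 * (e15 ^ 10 / (e3 ^ 12 * e5 ^ 2)) +
        540 * z ^ 4 * (e5 ^ 15 * e15 ^ 5 / (e1 ^ 13 * e3 ^ 11)) +
        306 * z ^ 5 * (e5 ^ 4 * e15 ^ 10 / (e1 ^ 6 * e3 ^ 12)) +
        324 * z ^ 5 * (e5 ^ 5 * e15 ^ 9 / (e1 ^ 11 * e3 ^ 7)) +
        4745 * z ^ 6 * (e5 ^ 10 * e15 ^ 10 / (e1 ^ 12 * e3 ^ 12)) -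
        180 * z ^ 7 * (e15 ^ 15 / (e1 ^ 5 * e3 ^ 13 * e5)) -
        4860 * z ^ 8 * (e5 ^ 5 * e15 ^ 15 / (e1 ^ 11 * e3 ^ 13)) +
        6480 * z ^ 10 * (e15 ^ 20 / (e1 ^ 10 * e3 ^ 14))) := by
  obtain ⟨t1, ht1⟩ : ∃ t, t = e1 ^ 6 / (z * e5 ^ 6) := ⟨_, rfl⟩
  obtain ⟨t3, ht3⟩ : ∃ t, t = e3 ^ 6 / (z ^ 3 * e15 ^ 6) := ⟨_, rfl⟩
  obtain ⟨s, hs0⟩ : ∃ t, t = e5 ^ 5 * e3 / (z ^ 2 * e1 * e15 ^ 5) := ⟨_, rfl⟩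
  obtain ⟨s', hs0'⟩ : ∃ t, t = z ^ 2 * e1 * e15 ^ 5 / (e5 ^ 5 * e3) := ⟨_, rfl⟩
  obtain ⟨W, hW⟩ : ∃ t, t = (e5 ^ 5 * e15 ^ 5 / (e1 ^ 6 * e3 ^ 6)) ^ 2 * z ^ 6 := ⟨_, rfl⟩
  obtain ⟨P, hP⟩ : ∃ P, P =
      (x ^ 6 + 16 * y * x ^ 4 + 27 * y ^ 2 * x ^ 2 - 2 * y ^ 3) * (20 * x ^ 2 * y ^ 4 - 20 * x *
        y ^ 2 + 5) +
      y * (2 * x ^ 6 + 27 * y * x ^ 4 - 16 * y ^ 2 * x ^ 2 + y ^ 3) * (5 * x ^ 2 * y ^ 4 + 20 * x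
        * y ^ 2 + 20) +
      x * (5 * x ^ 4 + 20 * y * x ^ 2 + 20 * y ^ 2) * (x ^ 3 * y ^ 6 + 16 * x ^ 2 * y ^ 4 + 27 *
        x * y ^ 2 - 2) +
      x * y * (10 * x ^ 4 + 15 * y * x ^ 2 - 10 * y ^ 2) * (10 * x ^ 2 * y ^ 4 + 15 * x * y ^ 2 -
        10) +
      (20 * x ^ 4 - 20 * y * x ^ 2 + 5 * y ^ 2) * (2 * x ^ 3 * y ^ 6 + 27 * x ^ 2 * y ^ 4 - 16 *
        x * y ^ 2 + 1) := ⟨_, rfl⟩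
  -- the dissection is homogeneous in `F`, so that its terms are monomials in `x` and `y`
  have hsec : cs * (x ^ 4 * y ^ 4) = W * P := by
    obtain rfl : G = y * F ^ 3 / x := by rw [eq_div_iff hx, ← hG, mul_comm]
    obtain rfl : z = y * F ^ 5 / x ^ 2 := by rw [eq_div_iff (pow_ne_zero 2 hx), ← hxz, mul_comm]
    have hN : ((F * e5) ^ 4 * e1 ^ 6 * ((y * F ^ 3 / x * e15) ^ 4 * e3 ^ 6)) ^ 2 ≠ 0 := by
      positivity
    rw [eq_div_of_mul_eq hN hcs, hW, hP]
    simp [Finset.sum_range_succ, cofactorSqPart]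
    field_simp
  -- each eta quotient is a monomial in `t1`, `t3` and `s` or `s' = 1 / s`
  have m1 : (e5 ^ 10 / (e1 ^ 12 * e15 ^ 2)) = W * t3 ^ 2 := by
    rw [hW, ht3]
    field_simp
  have m2 : z * (e5 ^ 15 / (e1 ^ 13 * e3 ^ 5 * e15)) = W * t3 * s := by
    rw [hW, ht3, hs0]
    field_simp
  have m3 : z ^ 2 * (e5 ^ 20 / (e1 ^ 14 * e3 ^ 10)) = W * s ^ 2 := by
    rw [hW, hs0]
    field_simp
  have m4 : z ^ 2 * (e5 ^ 4 * e15 ^ 4 / (e1 ^ 6 * e3 ^ 6)) = W * t1 * t3 := by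
    rw [hW, ht1, ht3]
    field_simp
  have m5 : z ^ 3 * (e5 ^ 10 * e15 ^ 4 / (e1 ^ 12 * e3 ^ 6)) = W * t3 := by
    rw [hW, ht3]
    field_simp
  have m6 : z ^ 3 * (e5 ^ 9 * e15 ^ 5 / (e1 ^ 7 * e3 ^ 11)) = W * t1 * s := by
    rw [hW, ht1, hs0]
    field_simp
  have m7 : z ^ 4 * (e15 ^ 10 / (e3 ^ 12 * e5 ^ 2)) = W * t1 ^ 2 := by
    rw [hW, ht1]
    field_simp
  have m8 : z ^ 4 * (e5 ^ 15 * e15 ^ 5 / (e1 ^ 13 * e3 ^ 11)) = W * s := by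
    rw [hW, hs0]
    field_simp
  have m9 : z ^ 5 * (e5 ^ 4 * e15 ^ 10 / (e1 ^ 6 * e3 ^ 12)) = W * t1 := by
    rw [hW, ht1]
    field_simp
  have m10 : z ^ 5 * (e5 ^ 5 * e15 ^ 9 / (e1 ^ 11 * e3 ^ 7)) = W * t3 * s' := by
    rw [hW, ht3, hs0']
    field_simp
  have m11 : z ^ 6 * (e5 ^ 10 * e15 ^ 10 / (e1 ^ 12 * e3 ^ 12)) = W * 1 := by
    rw [hW]
    field_simp
  have m12 : z ^ 7 * (e15 ^ 15 / (e1 ^ 5 * e3 ^ 13 * e5)) = W * t1 * s' := by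
    rw [hW, ht1, hs0']
    field_simp
  have m13 : z ^ 8 * (e5 ^ 5 * e15 ^ 15 / (e1 ^ 11 * e3 ^ 13)) = W * s' := by
    rw [hW, hs0']
    field_simp
  have m14 : z ^ 10 * (e15 ^ 20 / (e1 ^ 10 * e3 ^ 14)) = W * s' ^ 2 := by
    rw [hW, hs0']
    field_simp
  rw [← ht1] at h1
  rw [← ht3] at h3
  rw [← hs0] at hs
  rw [← hs0'] at hs'
  -- both sides are polynomials in `x` and `y`, equal modulo the equation of the curve
  have hpoly : (
      5 * t3 ^ 2 + 100 * t3 * s + 400 * s ^ 2 + 60 * t1 * t3 + 1530 * t3 - 180 * t1 * s +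
      5 * t1 ^ 2 + 2700 * s + 1530 * t1 + 1620 * t3 * s' + 23725 - 900 * t1 * s' - 24300 * s' +
      32400 * s' ^ 2) *
      (x ^ 4 * y ^ 4) = P := by
    rw [hP]
    linear_combination
      5 * eval_monomial h1 h3 hs 0 2 0 2 0 + 100 * eval_monomial h1 h3 hs 0 1 1 2 1 +
      400 * eval_monomial h1 h3 hs 0 0 2 2 2 + 60 * eval_monomial h1 h3 hs 1 1 0 1 1 +
      1530 * eval_monomial h1 h3 hs 0 1 0 3 2 - 180 * eval_monomial h1 h3 hs 1 0 1 1 2 +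
      5 * eval_monomial h1 h3 hs 2 0 0 0 2 + 2700 * eval_monomial h1 h3 hs 0 0 1 3 3 +
      1530 * eval_monomial h1 h3 hs 1 0 0 2 3 + 1620 * eval_monomial h1 h3 hs' 0 1 1 2 1 +
      23725 * eval_monomial h1 h3 hs 0 0 0 4 4 - 900 * eval_monomial h1 h3 hs' 1 0 1 1 2 -
      24300 * eval_monomial h1 h3 hs' 0 0 1 3 3 + 32400 * eval_monomial h1 h3 hs' 0 0 2 2 2 +
      (
        -5 * x ^ 6 * y ^ 5 - 10 * x ^ 6 * y ^ 4 - 20 * x ^ 6 * y ^ 3 + 5 * x ^ 6 * y -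
        5 * x ^ 5 * y ^ 6 - 65 * x ^ 5 * y ^ 5 - 85 * x ^ 5 * y ^ 4 - 310 * x ^ 5 * y ^ 3 -
        15 * x ^ 5 * y ^ 2 - 65 * x ^ 5 * y - 5 * x ^ 5 - 15 * x ^ 4 * y ^ 5 -
        650 * x ^ 4 * y ^ 4 - 1420 * x ^ 4 * y ^ 3 + 650 * x ^ 4 * y ^ 2 + 85 * x ^ 4 * y +
        10 * x ^ 4 + 20 * x ^ 3 * y ^ 6 - 310 * x ^ 3 * y ^ 5 + 1420 * x ^ 3 * y ^ 4 -
        3910 * x ^ 3 * y ^ 3 - 1420 * x ^ 3 * y ^ 2 - 310 * x ^ 3 * y - 20 * x ^ 3 +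
        10 * x ^ 2 * y ^ 6 - 85 * x ^ 2 * y ^ 5 + 650 * x ^ 2 * y ^ 4 + 1420 * x ^ 2 * y ^ 3 -
        650 * x ^ 2 * y ^ 2 + 15 * x ^ 2 * y + 5 * x * y ^ 6 - 65 * x * y ^ 5 + 15 * x * y ^ 4 -
        310 * x * y ^ 3 + 85 * x * y ^ 2 - 65 * x * y + 5 * x - 5 * y ^ 5 + 20 * y ^ 3 -
        10 * y ^ 2 + 5 * y) * hφ
  refine mul_right_cancel₀ (mul_ne_zero (pow_ne_zero 4 hx) (pow_ne_zero 4 hy)) ?_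
  rw [hsec, ← hpoly, ← mul_assoc]
  congr 1
  symm
  linear_combination
    5 * m1 + 100 * m2 + 400 * m3 + 60 * m4 + 1530 * m5 - 180 * m6 + 5 * m7 + 2700 * m8 +
    1530 * m9 + 1620 * m10 + 23725 * m11 - 900 * m12 - 24300 * m13 + 32400 * m14

set_option maxHeartbeats 4000000 in
/-- The identity for `k = 3`, with `z`, `e1`, `e3`, `e5`, `e15` for `q`, `E 1`, `E 3`, `E 5`,
`E 15`. -/
theorem coloredSection_three_eq {L : Type*} [Field L] [CharZero L] {z e1 e3 e5 e15 F G x y cs : L}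
    (hz : z ≠ 0) (he1 : e1 ≠ 0) (he3 : e3 ≠ 0) (he5 : e5 ≠ 0) (he15 : e15 ≠ 0) (hF : F ≠ 0)
    (hx : x ≠ 0) (hy : y ≠ 0) (hG : x * G = y * F ^ 3) (hxz : x ^ 2 * z = y * F ^ 5)
    (hφ : x ^ 2 * y - x * y ^ 2 - 3 * x * y + x - y = 0)
    (h1 : e1 ^ 6 / (z * e5 ^ 6) * (x ^ 2 * y) = x ^ 4 - 11 * x ^ 2 * y - y ^ 2)
    (h3 : e3 ^ 6 / (z ^ 3 * e15 ^ 6) * (x * y ^ 2) = x ^ 2 * y ^ 4 - 11 * x * y ^ 2 - 1)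
    (hs : e5 ^ 5 * e3 / (z ^ 2 * e1 * e15 ^ 5) * (x * y) = (x * y + 1) ^ 2)
    (hs' : z ^ 2 * e1 * e15 ^ 5 / (e5 ^ 5 * e3) * (x * y) = (x - y) ^ 2 / 9)
    (hcs : cs * ((F * e5) ^ 4 * e1 ^ 6 * ((G * e15) ^ 4 * e3 ^ 6)) ^ 3 =
      (∑ r ∈ Finset.range 5, ∑ t ∈ Finset.range 5, if (r + 3 * t) % 5 = 3 then
        z ^ ((r + 3 * t) / 5) * (cofactorCubePart z (F * e5) e5 r *
          cofactorCubePart (z ^ 3) (G * e15) e15 t)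
        else 0) * (e5 * e15) ^ 3) :
    cs =
      25 * (e5 ^ 15 / (e1 ^ 18 * e15 ^ 3)) + 216 * z * (e5 ^ 35 / (e1 ^ 22 * e3 ^ 14 * e15 ^ 5)) +
      234 * z * (e5 ^ 20 / (e1 ^ 19 * e3 ^ 5 * e15 ^ 2)) +
      234 * z * (e5 ^ 19 / (e1 ^ 14 * e3 ^ 10 * e15)) +
      81 * z * (e5 ^ 3 * e15 ^ 3 / (e1 ^ 6 * e3 ^ 6)) +
      2976 * z ^ 2 * (e5 ^ 25 / (e1 ^ 20 * e3 ^ 10 * e15)) +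
      2049 * z ^ 2 * (e5 ^ 24 / (e1 ^ 15 * e3 ^ 15)) +
      27 * z ^ 2 * (e5 ^ 10 * e15 ^ 2 / (e1 ^ 17 * e3)) +
      3528 * z ^ 2 * (e5 ^ 9 * e15 ^ 3 / (e1 ^ 12 * e3 ^ 6)) +
      13224 * z ^ 3 * (e5 ^ 30 / (e1 ^ 21 * e3 ^ 15)) +
      38858 * z ^ 3 * (e5 ^ 15 * e15 ^ 3 / (e1 ^ 18 * e3 ^ 6)) +
      6075 * z ^ 3 * (e5 ^ 14 * e15 ^ 4 / (e1 ^ 13 * e3 ^ 11)) +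
      134 * z ^ 3 * (e5 ^ 13 * e15 ^ 5 / (e1 ^ 8 * e3 ^ 16)) +
      109101 * z ^ 4 * (e5 ^ 20 * e15 ^ 4 / (e1 ^ 19 * e3 ^ 11)) +
      22226 * z ^ 4 * (e5 ^ 19 * e15 ^ 5 / (e1 ^ 14 * e3 ^ 16)) +
      3528 * z ^ 4 * (e5 ^ 3 * e15 ^ 9 / (e1 ^ 6 * e3 ^ 12)) -
      3 * z ^ 4 * (e5 ^ 2 * e15 ^ 10 / (e1 * e3 ^ 17)) +
      270086 * z ^ 5 * (e5 ^ 25 * e15 ^ 5 / (e1 ^ 20 * e3 ^ 16)) +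
      18018 * z ^ 5 * (e5 ^ 10 * e15 ^ 8 / (e1 ^ 17 * e3 ^ 7)) +
      138555 * z ^ 5 * (e5 ^ 9 * e15 ^ 9 / (e1 ^ 12 * e3 ^ 12)) -
      2002 * z ^ 5 * (e5 ^ 8 * e15 ^ 10 / (e1 ^ 7 * e3 ^ 17)) +
      1270766 * z ^ 6 * (e5 ^ 15 * e15 ^ 9 / (e1 ^ 18 * e3 ^ 12)) -
      55171 * z ^ 6 * (e5 ^ 14 * e15 ^ 10 / (e1 ^ 13 * e3 ^ 17)) +
      25 * z ^ 6 * (e15 ^ 15 / (e3 ^ 18 * e5 ^ 3)) +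
      441524 * z ^ 7 * (e5 ^ 20 * e15 ^ 10 / (e1 ^ 19 * e3 ^ 17)) +
      10854 * z ^ 7 * (e5 ^ 5 * e15 ^ 13 / (e1 ^ 16 * e3 ^ 8)) -
      54675 * z ^ 7 * (e5 ^ 4 * e15 ^ 14 / (e1 ^ 11 * e3 ^ 13)) +
      38858 * z ^ 7 * (e5 ^ 3 * e15 ^ 15 / (e1 ^ 6 * e3 ^ 18)) +
      1270766 * z ^ 8 * (e5 ^ 9 * e15 ^ 15 / (e1 ^ 12 * e3 ^ 18)) +
      496539 * z ^ 8 * (e5 ^ 10 * e15 ^ 14 / (e1 ^ 17 * e3 ^ 13)) +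
      12104417 * z ^ 9 * (e5 ^ 15 * e15 ^ 15 / (e1 ^ 18 * e3 ^ 18)) -
      2106 * z ^ 9 * (e15 ^ 20 / (e1 ^ 5 * e3 ^ 19 * e5 ^ 2)) +
      18954 * z ^ 9 * (e15 ^ 19 / (e1 ^ 10 * e3 ^ 14 * e5)) +
      1800306 * z ^ 10 * (e5 ^ 5 * e15 ^ 19 / (e1 ^ 16 * e3 ^ 14)) -
      981909 * z ^ 10 * (e5 ^ 4 * e15 ^ 20 / (e1 ^ 11 * e3 ^ 19)) -
      3973716 * z ^ 11 * (e5 ^ 10 * e15 ^ 20 / (e1 ^ 17 * e3 ^ 19)) +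
      241056 * z ^ 12 * (e15 ^ 25 / (e1 ^ 10 * e3 ^ 20 * e5)) -
      1493721 * z ^ 12 * (e15 ^ 24 / (e1 ^ 15 * e3 ^ 15)) +
      21876966 * z ^ 13 * (e5 ^ 5 * e15 ^ 25 / (e1 ^ 16 * e3 ^ 20)) -
      9640296 * z ^ 15 * (e15 ^ 30 / (e1 ^ 15 * e3 ^ 21)) +
      1417176 * z ^ 17 * (e15 ^ 35 / (e1 ^ 14 * e3 ^ 22 * e5 ^ 5)) := by
  obtain ⟨t1, ht1⟩ : ∃ t, t = e1 ^ 6 / (z * e5 ^ 6) := ⟨_, rfl⟩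
  obtain ⟨t3, ht3⟩ : ∃ t, t = e3 ^ 6 / (z ^ 3 * e15 ^ 6) := ⟨_, rfl⟩
  obtain ⟨s, hs0⟩ : ∃ t, t = e5 ^ 5 * e3 / (z ^ 2 * e1 * e15 ^ 5) := ⟨_, rfl⟩
  obtain ⟨s', hs0'⟩ : ∃ t, t = z ^ 2 * e1 * e15 ^ 5 / (e5 ^ 5 * e3) := ⟨_, rfl⟩
  obtain ⟨W, hW⟩ : ∃ t, t = (e5 ^ 5 * e15 ^ 5 / (e1 ^ 6 * e3 ^ 6)) ^ 3 * z ^ 9 := ⟨_, rfl⟩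
  obtain ⟨P, hP⟩ : ∃ P, P =
      x ^ 2 * y * (x ^ 8 + 78 * y * x ^ 6 + 219 * y ^ 2 * x ^ 4 - 153 * y ^ 3 * x ^ 2 + 51 * y ^
        4) * (3 * x ^ 4 * y ^ 8 + 134 * x ^ 3 * y ^ 6 + 57 * x ^ 2 * y ^ 4 + 216 * x * y ^ 2 -
        22) +
      x * (3 * x ^ 8 + 134 * y * x ^ 6 + 57 * y ^ 2 * x ^ 4 + 216 * y ^ 3 * x ^ 2 - 22 * y ^ 4) *
        (51 * x ^ 4 * y ^ 8 + 153 * x ^ 3 * y ^ 6 + 219 * x ^ 2 * y ^ 4 - 78 * x * y ^ 2 + 1) +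
      x * y * (9 * x ^ 8 + 177 * y * x ^ 6 + 71 * y ^ 2 * x ^ 4 - 177 * y ^ 3 * x ^ 2 + 9 * y ^
        4) * (9 * x ^ 4 * y ^ 8 + 177 * x ^ 3 * y ^ 6 + 71 * x ^ 2 * y ^ 4 - 177 * x * y ^ 2 + 9)
        +
      x * y ^ 2 * (22 * x ^ 8 + 216 * y * x ^ 6 - 57 * y ^ 2 * x ^ 4 + 134 * y ^ 3 * x ^ 2 - 3 *
        y ^ 4) * (x ^ 4 * y ^ 8 + 78 * x ^ 3 * y ^ 6 + 219 * x ^ 2 * y ^ 4 - 153 * x * y ^ 2 +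
        51) +
      y * (51 * x ^ 8 + 153 * y * x ^ 6 + 219 * y ^ 2 * x ^ 4 - 78 * y ^ 3 * x ^ 2 + y ^ 4) * (22
        * x ^ 4 * y ^ 8 + 216 * x ^ 3 * y ^ 6 - 57 * x ^ 2 * y ^ 4 + 134 * x * y ^ 2 - 3) := ⟨_,
        rfl⟩
  -- the dissection is homogeneous in `F`, so that its terms are monomials in `x` and `y`
  have hsec : cs * (x ^ 7 * y ^ 7) = W * P := by
    obtain rfl : G = y * F ^ 3 / x := by rw [eq_div_iff hx, ← hG, mul_comm]
    obtain rfl : z = y * F ^ 5 / x ^ 2 := by rw [eq_div_iff (pow_ne_zero 2 hx), ← hxz, mul_comm]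
    have hN : ((F * e5) ^ 4 * e1 ^ 6 * ((y * F ^ 3 / x * e15) ^ 4 * e3 ^ 6)) ^ 3 ≠ 0 := by
      positivity
    rw [eq_div_of_mul_eq hN hcs, hW, hP]
    simp [Finset.sum_range_succ, cofactorCubePart]
    field_simp
  -- each eta quotient is a monomial in `t1`, `t3` and `s` or `s' = 1 / s`
  have m1 : (e5 ^ 15 / (e1 ^ 18 * e15 ^ 3)) = W * t3 ^ 3 := by
    rw [hW, ht3]
    field_simp
  have m2 : z * (e5 ^ 35 / (e1 ^ 22 * e3 ^ 14 * e15 ^ 5)) = W * s ^ 4 := by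
    rw [hW, hs0]
    field_simp
  have m3 : z * (e5 ^ 20 / (e1 ^ 19 * e3 ^ 5 * e15 ^ 2)) = W * t3 ^ 2 * s := by
    rw [hW, ht3, hs0]
    field_simp
  have m4 : z * (e5 ^ 19 / (e1 ^ 14 * e3 ^ 10 * e15)) = W * t1 * t3 * s ^ 2 := by
    rw [hW, ht1, ht3, hs0]
    field_simp
  have m5 : z * (e5 ^ 3 * e15 ^ 3 / (e1 ^ 6 * e3 ^ 6)) = W * t1 ^ 2 * t3 ^ 2 := by
    rw [hW, ht1, ht3]
    field_simp
  have m6 : z ^ 2 * (e5 ^ 25 / (e1 ^ 20 * e3 ^ 10 * e15)) = W * t3 * s ^ 2 := by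
    rw [hW, ht3, hs0]
    field_simp
  have m7 : z ^ 2 * (e5 ^ 24 / (e1 ^ 15 * e3 ^ 15)) = W * t1 * s ^ 3 := by
    rw [hW, ht1, hs0]
    field_simp
  have m8 : z ^ 2 * (e5 ^ 10 * e15 ^ 2 / (e1 ^ 17 * e3)) = W * t3 ^ 3 * s' := by
    rw [hW, ht3, hs0']
    field_simp
  have m9 : z ^ 2 * (e5 ^ 9 * e15 ^ 3 / (e1 ^ 12 * e3 ^ 6)) = W * t1 * t3 ^ 2 := by
    rw [hW, ht1, ht3]
    field_simp
  have m10 : z ^ 3 * (e5 ^ 30 / (e1 ^ 21 * e3 ^ 15)) = W * s ^ 3 := by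
    rw [hW, hs0]
    field_simp
  have m11 : z ^ 3 * (e5 ^ 15 * e15 ^ 3 / (e1 ^ 18 * e3 ^ 6)) = W * t3 ^ 2 := by
    rw [hW, ht3]
    field_simp
  have m12 : z ^ 3 * (e5 ^ 14 * e15 ^ 4 / (e1 ^ 13 * e3 ^ 11)) = W * t1 * t3 * s := by
    rw [hW, ht1, ht3, hs0]
    field_simp
  have m13 : z ^ 3 * (e5 ^ 13 * e15 ^ 5 / (e1 ^ 8 * e3 ^ 16)) = W * t1 ^ 2 * s ^ 2 := by
    rw [hW, ht1, hs0]
    field_simp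
  have m14 : z ^ 4 * (e5 ^ 20 * e15 ^ 4 / (e1 ^ 19 * e3 ^ 11)) = W * t3 * s := by
    rw [hW, ht3, hs0]
    field_simp
  have m15 : z ^ 4 * (e5 ^ 19 * e15 ^ 5 / (e1 ^ 14 * e3 ^ 16)) = W * t1 * s ^ 2 := by
    rw [hW, ht1, hs0]
    field_simp
  have m16 : z ^ 4 * (e5 ^ 3 * e15 ^ 9 / (e1 ^ 6 * e3 ^ 12)) = W * t1 ^ 2 * t3 := by
    rw [hW, ht1, ht3]
    field_simp
  have m17 : z ^ 4 * (e5 ^ 2 * e15 ^ 10 / (e1 * e3 ^ 17)) = W * t1 ^ 3 * s := by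
    rw [hW, ht1, hs0]
    field_simp
  have m18 : z ^ 5 * (e5 ^ 25 * e15 ^ 5 / (e1 ^ 20 * e3 ^ 16)) = W * s ^ 2 := by
    rw [hW, hs0]
    field_simp
  have m19 : z ^ 5 * (e5 ^ 10 * e15 ^ 8 / (e1 ^ 17 * e3 ^ 7)) = W * t3 ^ 2 * s' := by
    rw [hW, ht3, hs0']
    field_simp
  have m20 : z ^ 5 * (e5 ^ 9 * e15 ^ 9 / (e1 ^ 12 * e3 ^ 12)) = W * t1 * t3 := by
    rw [hW, ht1, ht3]
    field_simp
  have m21 : z ^ 5 * (e5 ^ 8 * e15 ^ 10 / (e1 ^ 7 * e3 ^ 17)) = W * t1 ^ 2 * s := by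
    rw [hW, ht1, hs0]
    field_simp
  have m22 : z ^ 6 * (e5 ^ 15 * e15 ^ 9 / (e1 ^ 18 * e3 ^ 12)) = W * t3 := by
    rw [hW, ht3]
    field_simp
  have m23 : z ^ 6 * (e5 ^ 14 * e15 ^ 10 / (e1 ^ 13 * e3 ^ 17)) = W * t1 * s := by
    rw [hW, ht1, hs0]
    field_simp
  have m24 : z ^ 6 * (e15 ^ 15 / (e3 ^ 18 * e5 ^ 3)) = W * t1 ^ 3 := by
    rw [hW, ht1]
    field_simp
  have m25 : z ^ 7 * (e5 ^ 20 * e15 ^ 10 / (e1 ^ 19 * e3 ^ 17)) = W * s := by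
    rw [hW, hs0]
    field_simp
  have m26 : z ^ 7 * (e5 ^ 5 * e15 ^ 13 / (e1 ^ 16 * e3 ^ 8)) = W * t3 ^ 2 * s' ^ 2 := by
    rw [hW, ht3, hs0']
    field_simp
  have m27 : z ^ 7 * (e5 ^ 4 * e15 ^ 14 / (e1 ^ 11 * e3 ^ 13)) = W * t1 * t3 * s' := by
    rw [hW, ht1, ht3, hs0']
    field_simp
  have m28 : z ^ 7 * (e5 ^ 3 * e15 ^ 15 / (e1 ^ 6 * e3 ^ 18)) = W * t1 ^ 2 := by
    rw [hW, ht1]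
    field_simp
  have m29 : z ^ 8 * (e5 ^ 9 * e15 ^ 15 / (e1 ^ 12 * e3 ^ 18)) = W * t1 := by
    rw [hW, ht1]
    field_simp
  have m30 : z ^ 8 * (e5 ^ 10 * e15 ^ 14 / (e1 ^ 17 * e3 ^ 13)) = W * t3 * s' := by
    rw [hW, ht3, hs0']
    field_simp
  have m31 : z ^ 9 * (e5 ^ 15 * e15 ^ 15 / (e1 ^ 18 * e3 ^ 18)) = W * 1 := by
    rw [hW]
    field_simp
  have m32 : z ^ 9 * (e15 ^ 20 / (e1 ^ 5 * e3 ^ 19 * e5 ^ 2)) = W * t1 ^ 2 * s' := by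
    rw [hW, ht1, hs0']
    field_simp
  have m33 : z ^ 9 * (e15 ^ 19 / (e1 ^ 10 * e3 ^ 14 * e5)) = W * t1 * t3 * s' ^ 2 := by
    rw [hW, ht1, ht3, hs0']
    field_simp
  have m34 : z ^ 10 * (e5 ^ 5 * e15 ^ 19 / (e1 ^ 16 * e3 ^ 14)) = W * t3 * s' ^ 2 := by
    rw [hW, ht3, hs0']
    field_simp
  have m35 : z ^ 10 * (e5 ^ 4 * e15 ^ 20 / (e1 ^ 11 * e3 ^ 19)) = W * t1 * s' := by
    rw [hW, ht1, hs0']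
    field_simp
  have m36 : z ^ 11 * (e5 ^ 10 * e15 ^ 20 / (e1 ^ 17 * e3 ^ 19)) = W * s' := by
    rw [hW, hs0']
    field_simp
  have m37 : z ^ 12 * (e15 ^ 25 / (e1 ^ 10 * e3 ^ 20 * e5)) = W * t1 * s' ^ 2 := by
    rw [hW, ht1, hs0']
    field_simp
  have m38 : z ^ 12 * (e15 ^ 24 / (e1 ^ 15 * e3 ^ 15)) = W * t3 * s' ^ 3 := by
    rw [hW, ht3, hs0']
    field_simp
  have m39 : z ^ 13 * (e5 ^ 5 * e15 ^ 25 / (e1 ^ 16 * e3 ^ 20)) = W * s' ^ 2 := by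
    rw [hW, hs0']
    field_simp
  have m40 : z ^ 15 * (e15 ^ 30 / (e1 ^ 15 * e3 ^ 21)) = W * s' ^ 3 := by
    rw [hW, hs0']
    field_simp
  have m41 : z ^ 17 * (e15 ^ 35 / (e1 ^ 14 * e3 ^ 22 * e5 ^ 5)) = W * s' ^ 4 := by
    rw [hW, hs0']
    field_simp
  rw [← ht1] at h1
  rw [← ht3] at h3
  rw [← hs0] at hs
  rw [← hs0'] at hs'
  -- both sides are polynomials in `x` and `y`, equal modulo the equation of the curve
  have hpoly : (
      25 * t3 ^ 3 + 216 * s ^ 4 + 234 * t3 ^ 2 * s + 234 * t1 * t3 * s ^ 2 +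
      81 * t1 ^ 2 * t3 ^ 2 + 2976 * t3 * s ^ 2 + 2049 * t1 * s ^ 3 + 27 * t3 ^ 3 * s' +
      3528 * t1 * t3 ^ 2 + 13224 * s ^ 3 + 38858 * t3 ^ 2 + 6075 * t1 * t3 * s +
      134 * t1 ^ 2 * s ^ 2 + 109101 * t3 * s + 22226 * t1 * s ^ 2 + 3528 * t1 ^ 2 * t3 -
      3 * t1 ^ 3 * s + 270086 * s ^ 2 + 18018 * t3 ^ 2 * s' + 138555 * t1 * t3 -
      2002 * t1 ^ 2 * s + 1270766 * t3 - 55171 * t1 * s + 25 * t1 ^ 3 + 441524 * s +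
      10854 * t3 ^ 2 * s' ^ 2 - 54675 * t1 * t3 * s' + 38858 * t1 ^ 2 + 1270766 * t1 +
      496539 * t3 * s' + 12104417 - 2106 * t1 ^ 2 * s' + 18954 * t1 * t3 * s' ^ 2 +
      1800306 * t3 * s' ^ 2 - 981909 * t1 * s' - 3973716 * s' + 241056 * t1 * s' ^ 2 -
      1493721 * t3 * s' ^ 3 + 21876966 * s' ^ 2 - 9640296 * s' ^ 3 + 1417176 * s' ^ 4) *
      (x ^ 7 * y ^ 7) = P := by
    rw [hP]
    linear_combination
      25 * eval_monomial h1 h3 hs 0 3 0 4 1 + 216 * eval_monomial h1 h3 hs 0 0 4 3 3 +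
      234 * eval_monomial h1 h3 hs 0 2 1 4 2 + 234 * eval_monomial h1 h3 hs 1 1 2 2 2 +
      81 * eval_monomial h1 h3 hs 2 2 0 1 1 + 2976 * eval_monomial h1 h3 hs 0 1 2 4 3 +
      2049 * eval_monomial h1 h3 hs 1 0 3 2 3 + 27 * eval_monomial h1 h3 hs' 0 3 1 3 0 +
      3528 * eval_monomial h1 h3 hs 1 2 0 3 2 + 13224 * eval_monomial h1 h3 hs 0 0 3 4 4 +
      38858 * eval_monomial h1 h3 hs 0 2 0 5 3 + 6075 * eval_monomial h1 h3 hs 1 1 1 3 3 +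
      134 * eval_monomial h1 h3 hs 2 0 2 1 3 + 109101 * eval_monomial h1 h3 hs 0 1 1 5 4 +
      22226 * eval_monomial h1 h3 hs 1 0 2 3 4 + 3528 * eval_monomial h1 h3 hs 2 1 0 2 3 -
      3 * eval_monomial h1 h3 hs 3 0 1 0 3 + 270086 * eval_monomial h1 h3 hs 0 0 2 5 5 +
      18018 * eval_monomial h1 h3 hs' 0 2 1 4 2 + 138555 * eval_monomial h1 h3 hs 1 1 0 4 4 -
      2002 * eval_monomial h1 h3 hs 2 0 1 2 4 + 1270766 * eval_monomial h1 h3 hs 0 1 0 6 5 -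
      55171 * eval_monomial h1 h3 hs 1 0 1 4 5 + 25 * eval_monomial h1 h3 hs 3 0 0 1 4 +
      441524 * eval_monomial h1 h3 hs 0 0 1 6 6 + 10854 * eval_monomial h1 h3 hs' 0 2 2 3 1 -
      54675 * eval_monomial h1 h3 hs' 1 1 1 3 3 + 38858 * eval_monomial h1 h3 hs 2 0 0 3 5 +
      1270766 * eval_monomial h1 h3 hs 1 0 0 5 6 + 496539 * eval_monomial h1 h3 hs' 0 1 1 5 4 +
      12104417 * eval_monomial h1 h3 hs 0 0 0 7 7 - 2106 * eval_monomial h1 h3 hs' 2 0 1 2 4 +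
      18954 * eval_monomial h1 h3 hs' 1 1 2 2 2 + 1800306 * eval_monomial h1 h3 hs' 0 1 2 4 3 -
      981909 * eval_monomial h1 h3 hs' 1 0 1 4 5 - 3973716 * eval_monomial h1 h3 hs' 0 0 1 6 6 +
      241056 * eval_monomial h1 h3 hs' 1 0 2 3 4 - 1493721 * eval_monomial h1 h3 hs' 0 1 3 3 2 +
      21876966 * eval_monomial h1 h3 hs' 0 0 2 5 5 - 9640296 * eval_monomial h1 h3 hs' 0 0 3 4 4 +
      1417176 * eval_monomial h1 h3 hs' 0 0 4 3 3 +
      (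
        -3 * x ^ 12 * y ^ 8 - 3 * x ^ 12 * y ^ 4 - 25 * x ^ 11 * y ^ 9 - 9 * x ^ 11 * y ^ 8 -
        150 * x ^ 11 * y ^ 7 - 3 * x ^ 11 * y ^ 5 - 9 * x ^ 11 * y ^ 4 + 22 * x ^ 11 * y ^ 3 -
        25 * x ^ 10 * y ^ 10 - 84 * x ^ 10 * y ^ 9 + 772 * x ^ 10 * y ^ 8 -
        2157 * x ^ 10 * y ^ 7 + 300 * x ^ 10 * y ^ 6 - 1610 * x ^ 10 * y ^ 5 -
        62 * x ^ 10 * y ^ 4 - 159 * x ^ 10 * y ^ 3 - 25 * x ^ 10 * y ^ 2 - 22 * x ^ 9 * y ^ 11 -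
        159 * x ^ 9 * y ^ 10 + 673 * x ^ 9 * y ^ 9 + 545 * x ^ 9 * y ^ 8 + 11453 * x ^ 9 * y ^ 7 -
        16580 * x ^ 9 * y ^ 6 - 12062 * x ^ 9 * y ^ 5 + 6947 * x ^ 9 * y ^ 4 -
        673 * x ^ 9 * y ^ 3 + 84 * x ^ 9 * y ^ 2 + 25 * x ^ 9 * y - 3 * x ^ 8 * y ^ 12 +
        9 * x ^ 8 * y ^ 11 - 62 * x ^ 8 * y ^ 10 - 6947 * x ^ 8 * y ^ 9 - 3661 * x ^ 8 * y ^ 8 +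
        33383 * x ^ 8 * y ^ 7 - 45940 * x ^ 8 * y ^ 6 - 19183 * x ^ 8 * y ^ 5 -
        3661 * x ^ 8 * y ^ 4 + 545 * x ^ 8 * y ^ 3 + 772 * x ^ 8 * y ^ 2 - 9 * x ^ 8 * y -
        3 * x ^ 8 + 3 * x ^ 7 * y ^ 11 - 1610 * x ^ 7 * y ^ 10 + 12062 * x ^ 7 * y ^ 9 -
        19183 * x ^ 7 * y ^ 8 + 17756 * x ^ 7 * y ^ 7 - 247259 * x ^ 7 * y ^ 6 -
        17756 * x ^ 7 * y ^ 5 - 33383 * x ^ 7 * y ^ 4 - 11453 * x ^ 7 * y ^ 3 +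
        2157 * x ^ 7 * y ^ 2 + 150 * x ^ 7 * y + 300 * x ^ 6 * y ^ 10 + 16580 * x ^ 6 * y ^ 9 -
        45940 * x ^ 6 * y ^ 8 + 247259 * x ^ 6 * y ^ 7 - 874850 * x ^ 6 * y ^ 6 -
        247259 * x ^ 6 * y ^ 5 - 45940 * x ^ 6 * y ^ 4 - 16580 * x ^ 6 * y ^ 3 +
        300 * x ^ 6 * y ^ 2 + 150 * x ^ 5 * y ^ 11 - 2157 * x ^ 5 * y ^ 10 -
        11453 * x ^ 5 * y ^ 9 + 33383 * x ^ 5 * y ^ 8 - 17756 * x ^ 5 * y ^ 7 +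
        247259 * x ^ 5 * y ^ 6 + 17756 * x ^ 5 * y ^ 5 + 19183 * x ^ 5 * y ^ 4 +
        12062 * x ^ 5 * y ^ 3 + 1610 * x ^ 5 * y ^ 2 + 3 * x ^ 5 * y - 3 * x ^ 4 * y ^ 12 +
        9 * x ^ 4 * y ^ 11 + 772 * x ^ 4 * y ^ 10 - 545 * x ^ 4 * y ^ 9 - 3661 * x ^ 4 * y ^ 8 +
        19183 * x ^ 4 * y ^ 7 - 45940 * x ^ 4 * y ^ 6 - 33383 * x ^ 4 * y ^ 5 -
        3661 * x ^ 4 * y ^ 4 + 6947 * x ^ 4 * y ^ 3 - 62 * x ^ 4 * y ^ 2 - 9 * x ^ 4 * y -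
        3 * x ^ 4 + 25 * x ^ 3 * y ^ 11 - 84 * x ^ 3 * y ^ 10 - 673 * x ^ 3 * y ^ 9 -
        6947 * x ^ 3 * y ^ 8 - 12062 * x ^ 3 * y ^ 7 + 16580 * x ^ 3 * y ^ 6 +
        11453 * x ^ 3 * y ^ 5 - 545 * x ^ 3 * y ^ 4 + 673 * x ^ 3 * y ^ 3 + 159 * x ^ 3 * y ^ 2 -
        22 * x ^ 3 * y - 25 * x ^ 2 * y ^ 10 + 159 * x ^ 2 * y ^ 9 - 62 * x ^ 2 * y ^ 8 +
        1610 * x ^ 2 * y ^ 7 + 300 * x ^ 2 * y ^ 6 + 2157 * x ^ 2 * y ^ 5 + 772 * x ^ 2 * y ^ 4 +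
        84 * x ^ 2 * y ^ 3 - 25 * x ^ 2 * y ^ 2 + 22 * x * y ^ 9 + 9 * x * y ^ 8 - 3 * x * y ^ 7 -
        150 * x * y ^ 5 + 9 * x * y ^ 4 - 25 * x * y ^ 3 - 3 * y ^ 8 - 3 * y ^ 4) * hφ
  refine mul_right_cancel₀ (mul_ne_zero (pow_ne_zero 7 hx) (pow_ne_zero 7 hy)) ?_
  rw [hsec, ← hpoly, ← mul_assoc]
  congr 1
  symm
  linear_combination
    25 * m1 + 216 * m2 + 234 * m3 + 234 * m4 + 81 * m5 + 2976 * m6 + 2049 * m7 + 27 * m8 +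
    3528 * m9 + 13224 * m10 + 38858 * m11 + 6075 * m12 + 134 * m13 + 109101 * m14 +
    22226 * m15 + 3528 * m16 - 3 * m17 + 270086 * m18 + 18018 * m19 + 138555 * m20 -
    2002 * m21 + 1270766 * m22 - 55171 * m23 + 25 * m24 + 441524 * m25 + 10854 * m26 -
    54675 * m27 + 38858 * m28 + 1270766 * m29 + 496539 * m30 + 12104417 * m31 - 2106 * m32 +
    18954 * m33 + 1800306 * m34 - 981909 * m35 - 3973716 * m36 + 241056 * m37 - 1493721 * m38 +
    21876966 * m39 - 9640296 * m40 + 1417176 * m41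

/-! ### Passage to the field of fractions -/

theorem map_inv_of_constantCoeff_ne_zero {L : Type*} [Field L] (ι : ℚ⟦X⟧ →+* L) {b : ℚ⟦X⟧}
    (hb : constantCoeff b ≠ 0) : ι b⁻¹ = (ι b)⁻¹ := by
  refine eq_inv_of_mul_eq_one_right ?_
  rw [← map_mul, PowerSeries.mul_inv_cancel b hb, map_one]

/-- `coloredSection_eq_of_dissection` in a field that contains the power series, for a dissection
`part` of the `k`-th power of the cofactor which is natural in the ring. -/
theorem map_coloredSection {L : Type} [Field L] (ι : ℚ⟦X⟧ →+* L) {k : ℕ} (hk : k < 5)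
    (part : ∀ {R : Type} [CommRing R], R → R → R → ℕ → R)
    (hpart : ∀ {R : Type} [CommRing R] (x a e : R), cofactorForm a (x * e) ^ k =
      ∑ r ∈ Finset.range 5, x ^ r * part (x ^ 5) a e r)
    (hmap : ∀ {R S : Type} [CommRing R] [CommRing S] (φ : R →+* S) (x a e : R) (r : ℕ),
      φ (part x a e r) = part (φ x) (φ a) (φ e) r) {F G : L} (hF : ι dissectA = F * ι (E 5))
    (hG : ι (expand 3 (by norm_num) dissectA) = G * ι (E 15)) :
    ι (coloredSection k k) * ((F * ι (E 5)) ^ 4 * ι (E 1) ^ 6 *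
        ((G * ι (E 15)) ^ 4 * ι (E 3) ^ 6)) ^ k =
      (∑ r ∈ Finset.range 5, ∑ t ∈ Finset.range 5, if (r + 3 * t) % 5 = k then
        ι X ^ ((r + 3 * t) / 5) * (part (ι X) (F * ι (E 5)) (ι (E 5)) r *
          part (ι X ^ 3) (G * ι (E 15)) (ι (E 15)) t) else 0) * (ι (E 5) * ι (E 15)) ^ k := by
  have hE15 : expand 3 (by norm_num) (E 5) = E 15 :=
    expand_E (p := 3) (n := 5) (by norm_num) (by norm_num)
  have hd := coloredSection_eq_of_dissection hk (f := part X dissectA (E 5)) (by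
    rw [hpart]
    refine Finset.sum_congr rfl fun r _ => ?_
    rw [← expand_X (p := 5) (by norm_num)]
    congr 1
    exact (hmap (expand 5 (by norm_num) : ℚ⟦X⟧ →ₐ[ℚ] ℚ⟦X⟧).toRingHom _ _ _ _).symm)
  have hm : ∀ t, expand 3 (by norm_num) (part X dissectA (E 5) t) =
      part (X ^ 3) (expand 3 (by norm_num) dissectA) (E 15) t := fun t => by
    have h := hmap (expand 3 (by norm_num) : ℚ⟦X⟧ →ₐ[ℚ] ℚ⟦X⟧).toRingHom X dissectA (E 5) t
    simpa [hE15] using h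
  have hcs := congrArg ι hd
  simpa only [hm, map_mul, map_pow, map_sum, apply_ite ι, map_zero, hmap, hF, hG] using hcs

end

theorem theorem2 :
    (coloredSection 1 1 =
      frac (E 5 ^ (5 : ℕ)) (E 1 ^ (6 : ℕ) * E 15)
        + 10 * q * frac (E 5 ^ (10 : ℕ)) (E 1 ^ (7 : ℕ) * E 3 ^ (5 : ℕ))
        + q ^ (2 : ℕ) * frac (E 15 ^ (5 : ℕ)) (E 3 ^ (6 : ℕ) * E 5)
        + 45 * q ^ (3 : ℕ) * frac (E 5 ^ (5 : ℕ) * E 15 ^ (5 : ℕ)) (E 1 ^ (6 : ℕ) * E 3 ^ (6 : ℕ))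
        - 90 * q ^ (5 : ℕ) * frac (E 15 ^ (10 : ℕ)) (E 1 ^ (5 : ℕ) * E 3 ^ (7 : ℕ))) ∧
    (coloredSection 2 2 =
      5 * (frac (E 5 ^ (10 : ℕ)) (E 1 ^ (12 : ℕ) * E 15 ^ (2 : ℕ))
        + 20 * q * frac (E 5 ^ (15 : ℕ)) (E 1 ^ (13 : ℕ) * E 3 ^ (5 : ℕ) * E 15)
        + 80 * q ^ (2 : ℕ) * frac (E 5 ^ (20 : ℕ)) (E 1 ^ (14 : ℕ) * E 3 ^ (10 : ℕ))
        + 12 * q ^ (2 : ℕ) * frac (E 5 ^ (4 : ℕ) * E 15 ^ (4 : ℕ)) (E 1 ^ (6 : ℕ) * E 3 ^ (6 : ℕ))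
        + 306 * q ^ (3 : ℕ) * frac (E 5 ^ (10 : ℕ) * E 15 ^ (4 : ℕ)) (E 1 ^ (12 : ℕ) * E 3 ^ (6 : ℕ))
        - 36 * q ^ (3 : ℕ) * frac (E 5 ^ (9 : ℕ) * E 15 ^ (5 : ℕ)) (E 1 ^ (7 : ℕ) * E 3 ^ (11 : ℕ))
        + q ^ (4 : ℕ) * frac (E 15 ^ (10 : ℕ)) (E 3 ^ (12 : ℕ) * E 5 ^ (2 : ℕ))
        + 540 * q ^ (4 : ℕ) * frac (E 5 ^ (15 : ℕ) * E 15 ^ (5 : ℕ)) (E 1 ^ (13 : ℕ) * E 3 ^ (11 : ℕ))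
        + 306 * q ^ (5 : ℕ) * frac (E 5 ^ (4 : ℕ) * E 15 ^ (10 : ℕ)) (E 1 ^ (6 : ℕ) * E 3 ^ (12 : ℕ))
        + 324 * q ^ (5 : ℕ) * frac (E 5 ^ (5 : ℕ) * E 15 ^ (9 : ℕ)) (E 1 ^ (11 : ℕ) * E 3 ^ (7 : ℕ))
        + 4745 * q ^ (6 : ℕ) * frac (E 5 ^ (10 : ℕ) * E 15 ^ (10 : ℕ)) (E 1 ^ (12 : ℕ) * E 3 ^ (12 : ℕ))
        - 180 * q ^ (7 : ℕ) * frac (E 15 ^ (15 : ℕ)) (E 1 ^ (5 : ℕ) * E 3 ^ (13 : ℕ) * E 5)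
        - 4860 * q ^ (8 : ℕ) * frac (E 5 ^ (5 : ℕ) * E 15 ^ (15 : ℕ)) (E 1 ^ (11 : ℕ) * E 3 ^ (13 : ℕ))
        + 6480 * q ^ (10 : ℕ) * frac (E 15 ^ (20 : ℕ)) (E 1 ^ (10 : ℕ) * E 3 ^ (14 : ℕ)))) ∧
    (coloredSection 3 3 =
      25 * frac (E 5 ^ (15 : ℕ)) (E 1 ^ (18 : ℕ) * E 15 ^ (3 : ℕ))
        + 216 * q * frac (E 5 ^ (35 : ℕ)) (E 1 ^ (22 : ℕ) * E 3 ^ (14 : ℕ) * E 15 ^ (5 : ℕ))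
        + 234 * q * frac (E 5 ^ (20 : ℕ)) (E 1 ^ (19 : ℕ) * E 3 ^ (5 : ℕ) * E 15 ^ (2 : ℕ))
        + 234 * q * frac (E 5 ^ (19 : ℕ)) (E 1 ^ (14 : ℕ) * E 3 ^ (10 : ℕ) * E 15)
        + 81 * q * frac (E 5 ^ (3 : ℕ) * E 15 ^ (3 : ℕ)) (E 1 ^ (6 : ℕ) * E 3 ^ (6 : ℕ))
        + 2976 * q ^ (2 : ℕ) * frac (E 5 ^ (25 : ℕ)) (E 1 ^ (20 : ℕ) * E 3 ^ (10 : ℕ) * E 15)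
        + 2049 * q ^ (2 : ℕ) * frac (E 5 ^ (24 : ℕ)) (E 1 ^ (15 : ℕ) * E 3 ^ (15 : ℕ))
        + 27 * q ^ (2 : ℕ) * frac (E 5 ^ (10 : ℕ) * E 15 ^ (2 : ℕ)) (E 1 ^ (17 : ℕ) * E 3)
        + 3528 * q ^ (2 : ℕ) * frac (E 5 ^ (9 : ℕ) * E 15 ^ (3 : ℕ)) (E 1 ^ (12 : ℕ) * E 3 ^ (6 : ℕ))
        + 13224 * q ^ (3 : ℕ) * frac (E 5 ^ (30 : ℕ)) (E 1 ^ (21 : ℕ) * E 3 ^ (15 : ℕ))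
        + 38858 * q ^ (3 : ℕ) * frac (E 5 ^ (15 : ℕ) * E 15 ^ (3 : ℕ)) (E 1 ^ (18 : ℕ) * E 3 ^ (6 : ℕ))
        + 6075 * q ^ (3 : ℕ) * frac (E 5 ^ (14 : ℕ) * E 15 ^ (4 : ℕ)) (E 1 ^ (13 : ℕ) * E 3 ^ (11 : ℕ))
        + 134 * q ^ (3 : ℕ) * frac (E 5 ^ (13 : ℕ) * E 15 ^ (5 : ℕ)) (E 1 ^ (8 : ℕ) * E 3 ^ (16 : ℕ))
        + 109101 * q ^ (4 : ℕ) * frac (E 5 ^ (20 : ℕ) * E 15 ^ (4 : ℕ)) (E 1 ^ (19 : ℕ) * E 3 ^ (11 : ℕ))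
        + 22226 * q ^ (4 : ℕ) * frac (E 5 ^ (19 : ℕ) * E 15 ^ (5 : ℕ)) (E 1 ^ (14 : ℕ) * E 3 ^ (16 : ℕ))
        + 3528 * q ^ (4 : ℕ) * frac (E 5 ^ (3 : ℕ) * E 15 ^ (9 : ℕ)) (E 1 ^ (6 : ℕ) * E 3 ^ (12 : ℕ))
        - 3 * q ^ (4 : ℕ) * frac (E 5 ^ (2 : ℕ) * E 15 ^ (10 : ℕ)) (E 1 * E 3 ^ (17 : ℕ))
        + 270086 * q ^ (5 : ℕ) * frac (E 5 ^ (25 : ℕ) * E 15 ^ (5 : ℕ)) (E 1 ^ (20 : ℕ) * E 3 ^ (16 : ℕ))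
        + 18018 * q ^ (5 : ℕ) * frac (E 5 ^ (10 : ℕ) * E 15 ^ (8 : ℕ)) (E 1 ^ (17 : ℕ) * E 3 ^ (7 : ℕ))
        + 138555 * q ^ (5 : ℕ) * frac (E 5 ^ (9 : ℕ) * E 15 ^ (9 : ℕ)) (E 1 ^ (12 : ℕ) * E 3 ^ (12 : ℕ))
        - 2002 * q ^ (5 : ℕ) * frac (E 5 ^ (8 : ℕ) * E 15 ^ (10 : ℕ)) (E 1 ^ (7 : ℕ) * E 3 ^ (17 : ℕ))
        + 1270766 * q ^ (6 : ℕ) * frac (E 5 ^ (15 : ℕ) * E 15 ^ (9 : ℕ)) (E 1 ^ (18 : ℕ) * E 3 ^ (12 : ℕ))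
        - 55171 * q ^ (6 : ℕ) * frac (E 5 ^ (14 : ℕ) * E 15 ^ (10 : ℕ)) (E 1 ^ (13 : ℕ) * E 3 ^ (17 : ℕ))
        + 25 * q ^ (6 : ℕ) * frac (E 15 ^ (15 : ℕ)) (E 3 ^ (18 : ℕ) * E 5 ^ (3 : ℕ))
        + 441524 * q ^ (7 : ℕ) * frac (E 5 ^ (20 : ℕ) * E 15 ^ (10 : ℕ)) (E 1 ^ (19 : ℕ) * E 3 ^ (17 : ℕ))
        + 10854 * q ^ (7 : ℕ) * frac (E 5 ^ (5 : ℕ) * E 15 ^ (13 : ℕ)) (E 1 ^ (16 : ℕ) * E 3 ^ (8 : ℕ))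
        - 54675 * q ^ (7 : ℕ) * frac (E 5 ^ (4 : ℕ) * E 15 ^ (14 : ℕ)) (E 1 ^ (11 : ℕ) * E 3 ^ (13 : ℕ))
        + 38858 * q ^ (7 : ℕ) * frac (E 5 ^ (3 : ℕ) * E 15 ^ (15 : ℕ)) (E 1 ^ (6 : ℕ) * E 3 ^ (18 : ℕ))
        + 1270766 * q ^ (8 : ℕ) * frac (E 5 ^ (9 : ℕ) * E 15 ^ (15 : ℕ)) (E 1 ^ (12 : ℕ) * E 3 ^ (18 : ℕ))
        + 496539 * q ^ (8 : ℕ) * frac (E 5 ^ (10 : ℕ) * E 15 ^ (14 : ℕ)) (E 1 ^ (17 : ℕ) * E 3 ^ (13 : ℕ))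
        + 12104417 * q ^ (9 : ℕ) * frac (E 5 ^ (15 : ℕ) * E 15 ^ (15 : ℕ)) (E 1 ^ (18 : ℕ) * E 3 ^ (18 : ℕ))
        - 2106 * q ^ (9 : ℕ) * frac (E 15 ^ (20 : ℕ)) (E 1 ^ (5 : ℕ) * E 3 ^ (19 : ℕ) * E 5 ^ (2 : ℕ))
        + 18954 * q ^ (9 : ℕ) * frac (E 15 ^ (19 : ℕ)) (E 1 ^ (10 : ℕ) * E 3 ^ (14 : ℕ) * E 5)
        + 1800306 * q ^ (10 : ℕ) * frac (E 5 ^ (5 : ℕ) * E 15 ^ (19 : ℕ)) (E 1 ^ (16 : ℕ) * E 3 ^ (14 : ℕ))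
        - 981909 * q ^ (10 : ℕ) * frac (E 5 ^ (4 : ℕ) * E 15 ^ (20 : ℕ)) (E 1 ^ (11 : ℕ) * E 3 ^ (19 : ℕ))
        - 3973716 * q ^ (11 : ℕ) * frac (E 5 ^ (10 : ℕ) * E 15 ^ (20 : ℕ)) (E 1 ^ (17 : ℕ) * E 3 ^ (19 : ℕ))
        + 241056 * q ^ (12 : ℕ) * frac (E 15 ^ (25 : ℕ)) (E 1 ^ (10 : ℕ) * E 3 ^ (20 : ℕ) * E 5)
        - 1493721 * q ^ (12 : ℕ) * frac (E 15 ^ (24 : ℕ)) (E 1 ^ (15 : ℕ) * E 3 ^ (15 : ℕ))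
        + 21876966 * q ^ (13 : ℕ) * frac (E 5 ^ (5 : ℕ) * E 15 ^ (25 : ℕ)) (E 1 ^ (16 : ℕ) * E 3 ^ (20 : ℕ))
        - 9640296 * q ^ (15 : ℕ) * frac (E 15 ^ (30 : ℕ)) (E 1 ^ (15 : ℕ) * E 3 ^ (21 : ℕ))
        + 1417176 * q ^ (17 : ℕ) * frac (E 15 ^ (35 : ℕ)) (E 1 ^ (14 : ℕ) * E 3 ^ (22 : ℕ) * E 5 ^ (5 : ℕ))) := by
  let ι := algebraMap (PowerSeries ℚ) (FractionRing (PowerSeries ℚ))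
  have hι : Function.Injective ι := IsFractionRing.injective _ _
  have : CharZero (FractionRing (PowerSeries ℚ)) :=
    charZero_of_injective_ringHom (f := ι.comp (PowerSeries.C (R := ℚ))) (RingHom.injective _)
  obtain ⟨hz, he1, he3, he5, he15⟩ := X_ne_zero_and_E_ne_zero hι
  obtain ⟨F, G, x, y, hF, hx, hy, ha, ha3, hG, hxz, hφ, h1, h3, hs, hs'⟩ :=
    exists_point_on_curve hι
  have c1 : PowerSeries.constantCoeff (E 1) = 1 := constantCoeff_E (by norm_num)
  have c3 : PowerSeries.constantCoeff (E 3) = 1 := constantCoeff_E (by norm_num)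
  have c5 : PowerSeries.constantCoeff (E 5) = 1 := constantCoeff_E (by norm_num)
  have c15 : PowerSeries.constantCoeff (E 15) = 1 := constantCoeff_E (by norm_num)
  refine ⟨hι ?_, hι ?_, hι ?_⟩
  · rw [coloredSection_one_eq hz he1 he3 he5 he15 hF hx hy hG hxz hφ h1 h3 hs hs'
      (map_coloredSection ι (by norm_num) cofactorPart
        (fun x a e => by rw [pow_one, cofactorForm_eq_sum]) map_cofactorPart ha ha3)]
    simp (disch := simp [c1, c3, c5, c15]) only [map_add, map_sub, map_mul, map_pow, map_ofNat,
      map_inv_of_constantCoeff_ne_zero, div_eq_mul_inv]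
  · rw [coloredSection_two_eq hz he1 he3 he5 he15 hF hx hy hG hxz hφ h1 h3 hs hs'
      (map_coloredSection ι (by norm_num) cofactorSqPart
        cofactorForm_sq_eq_sum map_cofactorSqPart ha ha3)]
    simp (disch := simp [c1, c3, c5, c15]) only [map_add, map_sub, map_mul, map_pow, map_ofNat,
      map_inv_of_constantCoeff_ne_zero, div_eq_mul_inv]
  · rw [coloredSection_three_eq hz he1 he3 he5 he15 hF hx hy hG hxz hφ h1 h3 hs hs'
      (map_coloredSection ι (by norm_num) cofactorCubePart
        cofactorForm_cube_eq_sum map_cofactorCubePart ha ha3)]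
    simp (disch := simp [c1, c3, c5, c15]) only [map_add, map_sub, map_mul, map_pow, map_ofNat,
      map_inv_of_constantCoeff_ne_zero, div_eq_mul_inv]
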